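/- **Setting.** Let $G\subset \mathrm{PGL}(2,\mathbb Z)$ be a subgroup of finite index and $\mathbb P=\mathrm{PGL}(2,\mathbb Z)/G$. Let $X_G=\mathrm{PGL}(2,\mathbb Z)\backslash(\mathbb H\times\mathbb P)\cong G\backslash\mathbb H$, compactified by the cusps; matrices of determinant $-1$ act on $\mathbb H$ by $z\mapsto (a\bar z+b)/(c\bar z+d)$. The shift is $$T(\beta,t)=\left(\frac1\beta-\left[\frac1\beta\right],\begin{pmatrix}-[1/\beta]&1\\1&0\end{pmatrix}\cdot t\right)$$ on $[0,1]\times\mathbb P$. For a measurable $E\subset[0,1]\times\mathbb P$ with $T(E)\subset E$ let $\delta_E$ be its Hausdorff dimension and $\mathcal H^{\delta_E}$ the Hausdorff measure on $E$. Let $\mathcal N_E$ be the set of $k\ge1$ such that $E$ meets $[\frac1{k+1},\frac1k]\times\mathbb P$. The Gauss–Kuzmin operators of $E$ act on functions on $E$, read as zero outside $E$, by $$(\mathcal L_{\sigma,E}f)(x,t)=\sum_{k\in\mathcal N_E}\frac1{(x+k)^{\sigma}}\,f\!\left(\frac1{x+k},\begin{pmatrix}0&1\\1&k\end{pmatrix}\cdot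 t\right)\qquad \text{for } \mathcal H^{\delta_E}\text{-almost all } (x,t)\in E .$$ **Good spectral theory (GST).** Let $I\subset\mathbb R$ be an interval containing $2\delta_E$. The set $E$ has GST with parameter range $I$ if there is a real Banach space $\mathbb V$ of functions with the following properties. 1. The restrictions $f|_E$, $f\in\mathbb V$, lie in $L^2(E,d\mathcal H^{\delta_E})$ and form a dense subset of it. 2. For $\sigma\in I$ the operator $\mathcal L_{\sigma,E}$ acts on $\mathbb V$ as a compact operator. 3. For $\sigma\in I$ there are a closed convex cone $K\subset\mathbb V$ with $K\cap(-K)=0$, consisting of functions that are $\ge0$ at the points of $E$, and an element $u$ in the interior of $K$, such that $\mathcal L_{\sigma,E}$ is $u$-positive. This means that $\mathcal L_{\sigma,E}K\subset K$ and that for every nonzero $f\in K$ there are an integer $k>0$ and reals $a,b>0$ with $au\le\mathcal L_{\sigma,E}^kf\le bu$, where $f\le g$ iff $g-f\in K$. 4. $\mathcal L_{2\delta_E,E}$ has spectral radius $1$ on $\mathbb V$. **Modular symbols.** For $(\beta,t)\in E$ let $x_0=x_0(\beta,t)$ be a point, depending measurably on $(\beta,t)$, of the geodesic in $\mathbb H$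 from $i\infty$ to $\beta$. For $\tau\ge0$ let $y(\tau)$ be the point of this geodesic at distance $\tau$ from $x_0$ towards $\beta$. Let $\{x_0,y(\tau)\}=\{x_0,y(\tau)\}(\beta,t)\in H_1(X_G,\mathbb R)$ be the real homology class defined by integrating the differentials of the first kind on $X_G$ (more precisely, the real harmonic $1$-forms on $X_G$) along the image in $X_G$ of the arc $\langle x_0,y(\tau)\rangle\times\{t\}\subset\mathbb H\times\mathbb P$. **Lemma.** Let $E=B\times\mathbb P$, with $B\subset[0,1]$ measurable, satisfy $T(E)\subset E$ and $\mathcal H^{\delta_E}(E)<\infty$, and let $E$ have GST. Then for every test function $f\in L^2(E,d\mathcal H^{\delta_E})$ the integrals below exist, and $$\lim_{\tau\to\infty}\frac1\tau\int_E\{x_0,y(\tau)\}\cdot f\,d\mathcal H^{\delta_E}=0\quad\text{in }H_1(X_G,\mathbb R),$$ that is, the limit is zero after pairing with every real harmonic $1$-form on $X_G$ (equivalently, with every weight-two cusp form for $G$). -/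

import Mathlib

open MeasureTheory Filter Set
open scoped Topology MatrixGroups ENNReal

namespace LimitingModularSymbols

noncomputable section

/-! ### The coset space `ℙ = PGL(2,ℤ)/G` and the shift -/

/-- The coset space `ℙ = PGL(2,ℤ)/G`. -/
def Cosets (G : Subgroup PGL(2, ℤ)) : Type := PGL(2, ℤ) ⧸ G

instance (G : Subgroup PGL(2, ℤ)) : MulAction PGL(2, ℤ) (Cosets G) :=
  inferInstanceAs (MulAction PGL(2, ℤ) (PGL(2, ℤ) ⧸ G))

/-- `ℙ` (finite in the sequel) is a discrete measurable space. -/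
instance (G : Subgroup PGL(2, ℤ)) : MeasurableSpace (Cosets G) := ⊤

/-- The matrix `(-k, 1; 1, 0)`. -/
def shiftMatrix (k : ℤ) : GL (Fin 2) ℤ :=
  ⟨!![-k, 1; 1, 0], !![0, 1; 1, k], by simp [Matrix.one_fin_two], by simp [Matrix.one_fin_two]⟩

/-- The matrix `(0, 1; 1, k)`. -/
def branchMatrix (k : ℤ) : GL (Fin 2) ℤ :=
  ⟨!![0, 1; 1, k], !![-k, 1; 1, 0], by simp [Matrix.one_fin_two], by simp [Matrix.one_fin_two]⟩

/-- The shift `T(β,t) = (1/β - [1/β], (-[1/β], 1; 1, 0)·t)`. -/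
def shift (G : Subgroup PGL(2, ℤ)) (p : ℝ × Cosets G) : ℝ × Cosets G :=
  (1 / p.1 - ⌊1 / p.1⌋, Matrix.ProjGenLinGroup.mk (shiftMatrix ⌊1 / p.1⌋) • p.2)

/-- The inverse branch `(β,t) ↦ (1/(β+k), (0, 1; 1, k)·t)`. -/
def branch (G : Subgroup PGL(2, ℤ)) (k : ℕ) (p : ℝ × Cosets G) : ℝ × Cosets G :=
  (1 / (p.1 + k), Matrix.ProjGenLinGroup.mk (branchMatrix k) • p.2)

/-- `E` is invariant under the shift: `T(E) ⊆ E`. -/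
def ShiftInvariant {G : Subgroup PGL(2, ℤ)} (E : Set (ℝ × Cosets G)) : Prop :=
  MapsTo (shift G) E E

/-! ### Hausdorff dimension and Hausdorff measure of subsets of `ℝ × ℙ`

`ℝ × ℙ` is the disjoint union of the finitely many sheets `ℝ × {t}`, each a copy of `ℝ`. -/

/-- The Hausdorff dimension `δ_E` of `E ⊆ ℝ × ℙ`. -/
def hausdorffDim {G : Subgroup PGL(2, ℤ)} (E : Set (ℝ × Cosets G)) : ℝ :=
  (⨆ t : Cosets G, dimH {β : ℝ | (β, t) ∈ E}).toReal

/-- The `d`-dimensional Hausdorff measure on `ℝ × ℙ`. -/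
def sheetHausdorff (G : Subgroup PGL(2, ℤ)) (d : ℝ) : Measure (ℝ × Cosets G) :=
  Measure.sum fun t : Cosets G => (μH[d] : Measure ℝ).map fun β => (β, t)

/-- The Hausdorff measure `𝓗^{δ_E}` on `E`, for `δ_E` the Hausdorff dimension of `E`. -/
def hausdorffOn {G : Subgroup PGL(2, ℤ)} (E : Set (ℝ × Cosets G)) : Measure (ℝ × Cosets G) :=
  (sheetHausdorff G (hausdorffDim E)).restrict E

/-! ### Good spectral theory -/

/-- `𝓝_E`, the set of `k ≥ 1` for which `E` meets `[1/(k+1), 1/k] × ℙ`. -/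
def digits {G : Subgroup PGL(2, ℤ)} (E : Set (ℝ × Cosets G)) : Set ℕ :=
  {k | 1 ≤ k ∧ ∃ p ∈ E, p.1 ∈ Icc (1 / ((k : ℝ) + 1)) (1 / (k : ℝ))}

/-- `g = 𝓛_{σ,E} f` `𝓗^{δ_E}`-almost everywhere on `E`, where `𝓛_{σ,E}` is the (deformed)
Gauss–Kuzmin operator of `E`:
`(𝓛_{σ,E} f)(x,t) = ∑_{k ∈ 𝓝_E} (x+k)^{-σ} f (1/(x+k), (0, 1; 1, k)·t)`.
It acts on functions on `E`, so `f` is read as zero off `E`. Thereby, for every shift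
invariant `E`, the operator with `σ = 2 δ_E` is the adjoint of composition with the shift on
`L²(E, 𝓗^{δ_E})`. If the inverse branches with `k ∈ 𝓝_E` map `E` into `E`, the cut-off has no
effect. -/
def IsGaussKuzmin {G : Subgroup PGL(2, ℤ)} (E : Set (ℝ × Cosets G)) (σ : ℝ)
    (f g : ℝ × Cosets G → ℝ) : Prop :=
  ∀ᵐ p ∂(hausdorffOn E),
    HasSum (fun k : digits E => (p.1 + (k : ℕ)) ^ (-σ) * E.indicator f (branch G k p)) (g p)

/-- `L` is `u`-positive with respect to the closed convex cone `K`: it is positive, and for every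
nonzero `f ∈ K` there are `k > 0` and `a, b > 0` with `a u ≤ L^k f ≤ b u`, where `f ≤ g` means
`g - f ∈ K`. -/
def IsUPositive {V : Type*} [NormedAddCommGroup V] [NormedSpace ℝ V]
    (K : ProperCone ℝ V) (u : V) (L : V →L[ℝ] V) : Prop :=
  (∀ f ∈ K, L f ∈ K) ∧
    ∀ f ∈ K, f ≠ 0 → ∃ k : ℕ, 0 < k ∧ ∃ a b : ℝ, 0 < a ∧ 0 < b ∧
      (L ^ k) f - a • u ∈ K ∧ b • u - (L ^ k) f ∈ K

/-- `V` is a real Banach space of functions, `res` is restriction to `E` (only the values of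
`res f` at points of `E` matter), and `L σ` is the operator `𝓛_{σ,E}` acting on `V`, for `σ` in
the parameter range `I`. -/
structure IsGSTSpace {G : Subgroup PGL(2, ℤ)} (E : Set (ℝ × Cosets G)) (I : Set ℝ)
    {V : Type*} [NormedAddCommGroup V] [NormedSpace ℝ V]
    (res : V →ₗ[ℝ] (ℝ × Cosets G → ℝ)) (L : ℝ → V →L[ℝ] V) : Prop where
  /-- Restrictions to `E` are square integrable. -/
  memLp : ∀ f, MemLp (res f) 2 (hausdorffOn E)
  /-- The restrictions are dense in `L²(E, 𝓗^{δ_E})`. -/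
  dense : Dense (range fun f => (memLp f).toLp : Set (Lp ℝ 2 (hausdorffOn E)))
  /-- `L σ` is the Gauss–Kuzmin operator `𝓛_{σ,E}`. -/
  gaussKuzmin : ∀ σ ∈ I, ∀ f, IsGaussKuzmin E σ (res f) (res (L σ f))
  /-- `𝓛_{σ,E}` is compact on `V`. -/
  compact : ∀ σ ∈ I, IsCompactOperator (L σ)
  /-- There are a cone `K` of functions that are positive at the points of `E` and an interior
  point `u` of `K` such that `𝓛_{σ,E}` is `u`-positive. -/
  uPositive : ∀ σ ∈ I, ∃ K : ProperCone ℝ V, (∀ f ∈ K, -f ∈ K → f = 0) ∧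
    (∀ f ∈ K, ∀ p ∈ E, 0 ≤ res f p) ∧ ∃ u ∈ interior (K : Set V), IsUPositive K u (L σ)
  /-- `𝓛_{2δ_E,E}` has spectral radius one (as an operator on a real Banach space, whose spectral
  radius is `lim ‖L^n‖^{1/n}`). -/
  spectralRadius :
    Tendsto (fun n : ℕ => ‖L (2 * hausdorffDim E) ^ n‖ ^ (1 / (n : ℝ))) atTop (𝓝 1)

/-- `E` has good spectral theory, with parameter range `I`. -/
def HasGST.{v} {G : Subgroup PGL(2, ℤ)} (E : Set (ℝ × Cosets G)) (I : Set ℝ) : Prop :=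
  ∃ (V : Type v) (_ : NormedAddCommGroup V) (_ : NormedSpace ℝ V) (_ : CompleteSpace V)
    (res : V →ₗ[ℝ] (ℝ × Cosets G → ℝ)) (L : ℝ → V →L[ℝ] V), IsGSTSpace E I res L

/-! ### Modular symbols of geodesic arcs -/

/-- The preimage of `G` in `GL(2,ℤ)`, as a subgroup of `GL(2,ℝ)`. -/
def realGroup (G : Subgroup PGL(2, ℤ)) : Subgroup (GL (Fin 2) ℝ) :=
  (G.comap Matrix.ProjGenLinGroup.mk).map
    (Matrix.GeneralLinearGroup.map (Int.castRingHom ℝ))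

/-- A matrix in `GL(2,ℤ)` that represents the coset `t`. -/
def cosetRep {G : Subgroup PGL(2, ℤ)} (t : Cosets G) : GL (Fin 2) ℤ :=
  Quotient.out (Quotient.out t : PGL(2, ℤ))

/-- The representative does represent the coset. -/
theorem cosetRep_spec {G : Subgroup PGL(2, ℤ)} (t : Cosets G) :
    (QuotientGroup.mk (Matrix.ProjGenLinGroup.mk (cosetRep t)) : PGL(2, ℤ) ⧸ G) = t := by
  have h : Matrix.ProjGenLinGroup.mk (cosetRep t) = (Quotient.out t : PGL(2, ℤ)) :=
    Quotient.out_eq (Quotient.out t : PGL(2, ℤ))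
  rw [h]
  exact Quotient.out_eq t

/-- The point `y(s)` of the vertical geodesic through `z = x + i h`, at hyperbolic distance `s`
from `z` towards the real end point `x`: `y(s) = x + i h e^{-s}`. -/
def geodesicPoint (z : UpperHalfPlane) (s : ℝ) : UpperHalfPlane :=
  ⟨⟨z.re, z.im * Real.exp (-s)⟩, mul_pos z.im_pos (Real.exp_pos _)⟩

/-- The pairing of the real homology class `{x₀, y(τ)}_G` of the geodesic arc
`⟨x₀, y(τ)⟩ × {t}` of `ℍ × ℙ` with a form of weight two.

The modular curve is `X_G = PGL(2,ℤ)\(ℍ × ℙ) = G\ℍ`; the orbit of `(z, gG)` corresponds to that of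
`g⁻¹ z`, where matrices of determinant `-1` act on `ℍ` by `z ↦ (a z̄ + b)/(c z̄ + d)`. A class in
`H₁(X_G, ℝ)` of the compactified curve is given by its integrals of the real harmonic one-forms of
`X_G`. Their lifts to `ℍ` are the forms `Im (ω(z) dz)`, for `ω` a cusp form of weight two for `G`.
(Cusp forms satisfy `ω = ω ∣[2] γ` for all `γ` in `G`, where the slash operator of a matrix of
determinant `-1` involves complex conjugation, so `Im (ω(z) dz)` is invariant under all of `G`. If
`G` preserves the orientation, the differentials of the first kind are the `ω(z) dz`, and their
imaginary and real parts come from `ω` and `i ω`.) -/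
def modularSymbol {G : Subgroup PGL(2, ℤ)} (x₀ : UpperHalfPlane) (τ : ℝ) (t : Cosets G)
    (ω : CuspForm (realGroup G) 2) : ℝ :=
  let y : ℝ → UpperHalfPlane := fun s =>
    (Matrix.GeneralLinearGroup.map (Int.castRingHom ℝ) (cosetRep t))⁻¹ • geodesicPoint x₀ s
  ∫ s in (0 : ℝ)..τ, (ω (y s) * deriv (fun r => (y r : ℂ)) s).im

end

end LimitingModularSymbols

open LimitingModularSymbols

universe v

/-! ### Positive compact operators -/

namespace LimitingModularSymbols

section PositiveOperators

variable {V : Type*} [NormedAddCommGroup V] [NormedSpace ℝ V]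

/-! Geometry. On each sheet `ℍ × {t}` the form Im (ω dz) has a primitive A_t vanishing at i∞, and
the modular symbol is a difference of two of its values. A shift matrix carries A_t to the primitive
of the new sheet up to a constant φ(t), which does not depend on the digit because translations fix
i∞. Moreover φ(t) is a difference along a permutation of ℙ, so it sums to 0 (`exists_isHeight`). At
most 2τ + 2 shifts bring the point at distance τ back to Im ≥ 1/2, where heights are bounded
(`exists_half_le_im`). Hence, up to a bounded error, the symbol is a Birkhoff sum of φ whose length
depends on the point (`exists_abs_height_sub_sum_le`).

Dynamics. By the change of variables for Hausdorff measure, the Gauss–Kuzmin operator L at 2δ_E is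
adjoint to the shift (`integral_comp_shift_mul`), so integration ℓ over E is an L-invariant
functional. Compactness, u-positivity and spectral radius one then give a fixed interior vector h of
the cone with L^n f → ℓ(f) h (`exists_fixed_vector_mem_cone`, `tendsto_pow_apply_smul`). Thus h is a
positive invariant density for which the shift is mixing (`exists_invariant_density`). Since E is a
product and the shift permutes the fibres ℙ, the integral of φ ∘ T^n over E vanishes for all n, and
mixing forces φ to have mean 0 against h. Decay of correlations makes the second moments of Birkhoff
sums o(n²), and a blocking argument handles all lengths up to n at once
(`exists_birkhoffSum_le_integrable`).

It remains to pass from the weight h to a test function (`tendsto_integral_mul_zero`) and from the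
base point β + i to x₀, which changes the symbol by an amount bounded in τ. Rational β, whose orbits
end, are negligible (`ae_irrational`); this is delicate only when δ_E = 0. -/

theorem exists_pos_smul_sub_mem_of_mem_interior {K : ProperCone ℝ V} {h : V}
    (hh : h ∈ interior (K : Set V)) : ∃ C : ℝ, 0 < C ∧ ∀ v, ∀ r, C * ‖v‖ ≤ r → r • h - v ∈ K := by
  rw [mem_interior_iff_mem_nhds, Metric.mem_nhds_iff] at hh
  obtain ⟨ε, hε, hball⟩ := hh
  have hhK : h ∈ K := hball (Metric.mem_ball_self hε)
  -- An interior point is an order unit. The factor 2 puts h - r⁻¹ v strictly inside the ball of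
  -- radius ε around h.
  refine ⟨2 / ε, by positivity, fun v r hr => ?_⟩
  rcases eq_or_ne v 0 with rfl | hv
  · rw [sub_zero]
    exact K.smul_mem hhK (le_trans (by simp) hr)
  · have hv' : 0 < ‖v‖ := norm_pos_iff.2 hv
    have hr0 : 0 < r := lt_of_lt_of_le (by positivity) hr
    have h1 : h - r⁻¹ • v ∈ K := by
      apply hball
      rw [Metric.mem_ball, dist_eq_norm, sub_sub_cancel_left, norm_neg, norm_smul, norm_inv,
        Real.norm_of_nonneg hr0.le, inv_mul_lt_iff₀ hr0]
      have : 2 / ε * ‖v‖ * ε ≤ r * ε := by gcongr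
      have h2 : 2 / ε * ‖v‖ * ε = 2 * ‖v‖ := by field_simp
      nlinarith
    have := K.smul_mem h1 hr0.le
    rwa [smul_sub, smul_smul, mul_inv_cancel₀ hr0.ne', one_smul] at this

theorem pow_apply_mem_of_mapsTo {K : ProperCone ℝ V} {L : V →L[ℝ] V}
    (hL : ∀ f ∈ K, L f ∈ K) (n : ℕ) {f : V} (hf : f ∈ K) : (L ^ n) f ∈ K := by
  induction n with
  | zero => simpa
  | succ n ih => rw [pow_succ']; exact hL _ ih

theorem pow_apply_of_apply_eq {L : V →L[ℝ] V} {h : V} (hh : L h = h) (n : ℕ) : (L ^ n) h = h := by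
  induction n with
  | zero => simp
  | succ n ih => rw [pow_succ', mul_apply_eq_comp, ih, hh]

theorem functional_pow_apply {L : V →L[ℝ] V} {ℓ : V →L[ℝ] ℝ} (hℓ : ∀ f, ℓ (L f) = ℓ f) (n : ℕ)
    (f : V) : ℓ ((L ^ n) f) = ℓ f := by
  induction n with
  | zero => simp
  | succ n ih => rw [pow_succ', mul_apply_eq_comp, hℓ, ih]

theorem exists_tendsto_subseq_of_isCompactOperator {L : V →L[ℝ] V} (hc : IsCompactOperator L)
    {z : ℕ → V} {R : ℝ} (hz : ∀ n, ‖z n‖ ≤ R) :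
    ∃ w, ∃ φ : ℕ → ℕ, StrictMono φ ∧ Tendsto (fun n => L (z (φ n))) atTop (𝓝 w) := by
  obtain ⟨S, hS, hsub⟩ := hc.image_closedBall_subset_compact (f := (L : V →ₗ[ℝ] V)) R
  obtain ⟨w, -, φ, hφ, hw⟩ := hS.tendsto_subseq (x := fun n => L (z n))
    (fun n => hsub ⟨z n, by simpa using hz n, rfl⟩)
  exact ⟨w, φ, hφ, hw⟩

/-- The root limit gives ‖L^n‖ ≤ r^n eventually for each r > 1; any r < 1/s leaves a geometric
majorant. -/
theorem summable_smul_pow_apply [CompleteSpace V] {L : V →L[ℝ] V}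
    (hrad : Tendsto (fun n : ℕ => ‖L ^ n‖ ^ (1 / (n : ℝ))) atTop (𝓝 1)) {s : ℝ} (h0 : 0 < s)
    (h1 : s < 1) (u : V) : Summable fun n : ℕ => s ^ n • (L ^ n) u := by
  obtain ⟨r, hr1, hr2⟩ := exists_between (one_lt_inv_iff₀.2 ⟨h0, h1⟩)
  have hr0 : 0 < r := by linarith
  have hsr : s * r < 1 := by
    have := mul_lt_mul_of_pos_left hr2 h0
    rwa [mul_inv_cancel₀ h0.ne'] at this
  refine Summable.of_norm_bounded_eventually_nat (g := fun n => (s * r) ^ n * ‖u‖)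
    ((summable_geometric_of_lt_one (by positivity) hsr).mul_right _) ?_
  filter_upwards [hrad.eventually_lt_const hr1, eventually_gt_atTop 0] with n hn hn0
  have hLn : ‖L ^ n‖ ≤ r ^ n := by
    have hn' : (n : ℝ) ≠ 0 := by positivity
    calc ‖L ^ n‖ = (‖L ^ n‖ ^ (1 / (n : ℝ))) ^ n := by
          rw [← Real.rpow_natCast, ← Real.rpow_mul (norm_nonneg _), one_div, inv_mul_cancel₀ hn',
            Real.rpow_one]
      _ ≤ r ^ n := by gcongr
  rw [norm_smul, norm_pow, Real.norm_of_nonneg h0.le, mul_pow, mul_assoc]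
  gcongr
  exact ((L ^ n).le_opNorm u).trans (by gcongr)

/-- A compact positive operator of spectral radius one that preserves a functional which is
positive somewhere on the cone has a fixed vector in the cone. -/
theorem exists_fixed_vector_mem_cone [CompleteSpace V] {K : ProperCone ℝ V} {L : V →L[ℝ] V}
    (hc : IsCompactOperator L) (hL : ∀ f ∈ K, L f ∈ K)
    (hrad : Tendsto (fun n : ℕ => ‖L ^ n‖ ^ (1 / (n : ℝ))) atTop (𝓝 1))
    {ℓ : V →L[ℝ] ℝ} (hℓ : ∀ f, ℓ (L f) = ℓ f) {u : V} (hu : u ∈ K) (hℓu : 0 < ℓ u) :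
    ∃ h ∈ K, h ≠ 0 ∧ L h = h := by
  -- With s n → 1 the Neumann series x n for (1 - s n L)⁻¹ u blow up: ℓ is L-invariant, so ℓ (x n) =
  -- ℓ u / (1 - s n).
  set s : ℕ → ℝ := fun n => 1 - 1 / ((n : ℝ) + 2) with hs
  have hs0 : ∀ n, 0 < s n := fun n => by
    have : 1 / ((n : ℝ) + 2) < 1 := by rw [div_lt_one (by positivity)]; linarith [n.cast_nonneg (α := ℝ)]
    simp only [hs]; linarith
  have hs1 : ∀ n, s n < 1 := fun n => by
    have : 0 < 1 / ((n : ℝ) + 2) := by positivity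
    simp only [hs]; linarith
  have hslim : Tendsto s atTop (𝓝 1) := by
    have : Tendsto (fun n : ℕ => 1 / ((n : ℝ) + 2)) atTop (𝓝 0) :=
      Tendsto.div_atTop tendsto_const_nhds
        (tendsto_atTop_add_const_right _ _ tendsto_natCast_atTop_atTop)
    have h2 := this.const_sub 1
    rwa [sub_zero] at h2
  have hsum := fun n => summable_smul_pow_apply hrad (hs0 n) (hs1 n) u
  set x : ℕ → V := fun n => ∑' k : ℕ, s n ^ k • (L ^ k) u with hx
  have hxK : ∀ n, x n ∈ K := fun n =>
    K.isClosed.mem_of_tendsto (hsum n).hasSum (Eventually.of_forall fun t =>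
      sum_mem fun k _ => K.smul_mem (pow_apply_mem_of_mapsTo hL k hu) (pow_nonneg (hs0 n).le k))
  have hxℓ : ∀ n, ℓ (x n) = ℓ u * ((n : ℝ) + 2) := fun n => by
    have h1 : HasSum (fun k => ℓ (s n ^ k • (L ^ k) u)) (ℓ (x n)) := ℓ.hasSum (hsum n).hasSum
    have h2 : HasSum (fun k => s n ^ k * ℓ u) ((1 - s n)⁻¹ * ℓ u) :=
      (hasSum_geometric_of_lt_one (hs0 n).le (hs1 n)).mul_right _
    have h3 : (fun k => ℓ (s n ^ k • (L ^ k) u)) = fun k => s n ^ k * ℓ u := by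
      ext k; rw [map_smul, functional_pow_apply hℓ, smul_eq_mul]
    rw [h3] at h1
    rw [h1.unique h2]
    simp [hs, mul_comm]
  have hxrec : ∀ n, x n = u + s n • L (x n) := fun n => by
    have h1 := (hsum n).tsum_eq_zero_add
    have h2 : L (x n) = ∑' k : ℕ, L (s n ^ k • (L ^ k) u) := L.map_tsum (hsum n)
    have h3 : s n • L (x n) = ∑' k : ℕ, s n ^ (k + 1) • (L ^ (k + 1)) u := by
      rw [h2, ← ((hsum n).mapL L).tsum_const_smul (s n)]
      congr 1; ext k
      rw [map_smul, smul_smul, ← pow_succ', pow_succ' L k]; rfl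
    rw [h3]; rwa [pow_zero, pow_zero, one_smul, one_apply_eq_self] at h1
  have hxpos : ∀ n, 0 < ‖x n‖ := fun n => norm_pos_iff.2 fun h0 => by
    have := hxℓ n
    rw [h0, map_zero] at this
    have : 0 < ℓ u * ((n : ℝ) + 2) := by positivity
    linarith
  have hxinf : Tendsto (fun n => ‖x n‖) atTop atTop := by
    have hℓ0 : 0 < ‖ℓ‖ := norm_pos_iff.2 fun h => by simp [h] at hℓu
    have h1 : Tendsto (fun n : ℕ => ℓ u / ‖ℓ‖ * ((n : ℝ) + 2)) atTop atTop :=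
      (tendsto_atTop_add_const_right _ _ tendsto_natCast_atTop_atTop).const_mul_atTop
        (by positivity)
    refine tendsto_atTop_mono (fun n => ?_) h1
    rw [div_mul_eq_mul_div, div_le_iff₀ hℓ0, ← hxℓ n, mul_comm]
    exact (le_abs_self _).trans (ℓ.le_opNorm _)
  set z : ℕ → V := fun n => ‖x n‖⁻¹ • x n with hz
  have hznorm : ∀ n, ‖z n‖ = 1 := fun n => by
    simp [hz, norm_smul, (hxpos n).ne']
  have hzrec : ∀ n, z n = ‖x n‖⁻¹ • u + s n • L (z n) := fun n => by
    have h1 := congrArg (fun v => ‖x n‖⁻¹ • v) (hxrec n)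
    simp only [hz, map_smul]
    rw [smul_comm, ← smul_add]
    exact h1
  -- After normalization the inhomogeneous term u / ‖x n‖ dies out, so a limit point of L (z n) is
  -- one of z n too: it has norm one and is fixed by L.
  obtain ⟨w, φ, hφ, hw⟩ := exists_tendsto_subseq_of_isCompactOperator hc (fun n => (hznorm n).le)
  have hzw : Tendsto (fun n => z (φ n)) atTop (𝓝 w) := by
    have h1 : Tendsto (fun n => ‖x (φ n)‖⁻¹ • u + s (φ n) • L (z (φ n))) atTop
        (𝓝 ((0 : ℝ) • u + (1 : ℝ) • w)) :=
      ((hxinf.inv_tendsto_atTop.comp hφ.tendsto_atTop).smul_const u).add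
        ((hslim.comp hφ.tendsto_atTop).smul hw)
    simp only [← hzrec] at h1
    simpa using h1
  refine ⟨w, K.isClosed.mem_of_tendsto hzw (Eventually.of_forall fun n =>
    K.smul_mem (hxK _) (by positivity)), fun h0 => ?_,
    tendsto_nhds_unique ((L.continuous.tendsto w).comp hzw) hw⟩
  have := hzw.norm
  simp only [hznorm, h0, norm_zero] at this
  exact one_ne_zero (tendsto_nhds_unique tendsto_const_nhds this)

variable {K : ProperCone ℝ V} {L : V →L[ℝ] V} {h : V}

/-- The orbits of a compact positive operator that fixes an interior point of a pointed cone are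
bounded in norm. -/
theorem exists_norm_pow_apply_le (hpt : ∀ f ∈ K, -f ∈ K → f = 0) (hc : IsCompactOperator L)
    (hL : ∀ f ∈ K, L f ∈ K) (hint : h ∈ interior (K : Set V)) (hLh : L h = h) (f : V) :
    ∃ R, ∀ n, ‖(L ^ n) f‖ ≤ R := by
  obtain ⟨C, hC0, hC⟩ := exists_pos_smul_sub_mem_of_mem_interior hint
  -- The cone is not assumed normal, so the order bounds -b h ≤ L^n f ≤ b h do not by themselves
  -- bound the norm; compactness has to help.
  by_contra! hub
  set b := C * ‖f‖ with hb
  have hb0 : 0 ≤ b := by positivity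
  have hup : ∀ n, b • h - (L ^ n) f ∈ K := fun n => by
    have := pow_apply_mem_of_mapsTo hL n (hC f b le_rfl)
    rwa [map_sub, map_smul, pow_apply_of_apply_eq hLh] at this
  have hlow : ∀ n, b • h + (L ^ n) f ∈ K := fun n => by
    have := pow_apply_mem_of_mapsTo hL n (hC (-f) b (by simp [hb]))
    rwa [sub_neg_eq_add, map_add, map_smul, pow_apply_of_apply_eq hLh] at this
  -- At the first time the norm exceeds a threshold, the previous iterate is no larger. Dividing
  -- both by the later norm gives a bounded sequence whose images under L have norm one. The summand
  -- ‖f‖ makes this first time positive.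
  have hrec : ∀ k : ℕ, ∃ n, (k : ℝ) + 1 + ‖f‖ < ‖(L ^ (n + 1)) f‖ ∧
      ‖(L ^ n) f‖ ≤ ‖(L ^ (n + 1)) f‖ := fun k => by
    classical
    have hex := hub ((k : ℝ) + 1 + ‖f‖)
    set n := Nat.find hex with hn
    have hn1 : (k : ℝ) + 1 + ‖f‖ < ‖(L ^ n) f‖ := Nat.find_spec hex
    obtain ⟨m, hm⟩ : ∃ m, n = m + 1 := Nat.exists_eq_succ_of_ne_zero fun h0 => by
      rw [h0] at hn1
      simp only [pow_zero, one_apply_eq_self] at hn1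
      linarith [k.cast_nonneg (α := ℝ)]
    rw [hm] at hn1
    refine ⟨m, hn1, le_trans ?_ hn1.le⟩
    have := Nat.find_min hex (m := m) (by omega)
    simpa using this
  choose n hn hn' using hrec
  set z : ℕ → V := fun k => ‖(L ^ (n k + 1)) f‖⁻¹ • (L ^ (n k)) f with hz
  have hpos : ∀ k, 0 < ‖(L ^ (n k + 1)) f‖ := fun k => lt_trans (by positivity) (hn k)
  have hzn : ∀ k, ‖z k‖ ≤ 1 := fun k => by
    simp only [hz, norm_smul, norm_inv, norm_norm]
    rw [inv_mul_le_iff₀ (hpos k), mul_one]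
    exact hn' k
  have hLz : ∀ k, L (z k) = ‖(L ^ (n k + 1)) f‖⁻¹ • (L ^ (n k + 1)) f := fun k => by
    simp only [hz, map_smul, pow_succ' L]; rfl
  have hLzn : ∀ k, ‖L (z k)‖ = 1 := fun k => by
    rw [hLz, norm_smul, norm_inv, norm_norm, inv_mul_cancel₀ (hpos k).ne']
  obtain ⟨w, φ, hφ, hw⟩ := exists_tendsto_subseq_of_isCompactOperator hc hzn
  have hinv : Tendsto (fun k => ‖(L ^ (n (φ k) + 1)) f‖⁻¹) atTop (𝓝 0) := by
    refine Tendsto.inv_tendsto_atTop (tendsto_atTop_mono (fun k => ?_)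
      (tendsto_natCast_atTop_atTop.comp hφ.tendsto_atTop))
    have := hn (φ k)
    simp only [Function.comp_apply]
    linarith [norm_nonneg f]
  have hbz : Tendsto (fun k => ‖(L ^ (n (φ k) + 1)) f‖⁻¹ • b • h) atTop (𝓝 0) := by
    simpa using hinv.smul_const (b • h)
  -- Divided by norms tending to infinity, the order bounds put the unit vector w in both K and -K.
  have hw1 : w ∈ K := by
    have h1 : Tendsto (fun k => ‖(L ^ (n (φ k) + 1)) f‖⁻¹ • b • h + L (z (φ k))) atTop (𝓝 w) := by
      simpa using hbz.add hw
    refine K.isClosed.mem_of_tendsto h1 (Eventually.of_forall fun k => ?_)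
    rw [hLz, ← smul_add]
    exact K.smul_mem (hlow _) (by positivity)
  have hw2 : -w ∈ K := by
    have h1 : Tendsto (fun k => ‖(L ^ (n (φ k) + 1)) f‖⁻¹ • b • h - L (z (φ k))) atTop
        (𝓝 (-w)) := by
      simpa using hbz.sub hw
    refine K.isClosed.mem_of_tendsto h1 (Eventually.of_forall fun k => ?_)
    rw [hLz, ← smul_sub]
    exact K.smul_mem (hup _) (by positivity)
  have := hw.norm
  simp only [hLzn, hpt w hw1 hw2, norm_zero] at this
  exact one_ne_zero (tendsto_nhds_unique tendsto_const_nhds this)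

/-- Every limit point of an orbit of a compact `h`-positive operator which fixes the interior
point `h` of a pointed cone is a multiple of `h`. -/
theorem exists_eq_smul_of_tendsto_pow_apply (hpt : ∀ f ∈ K, -f ∈ K → f = 0)
    (hL : ∀ f ∈ K, L f ∈ K) (hint : h ∈ interior (K : Set V)) (hh0 : h ≠ 0) (hLh : L h = h)
    (hpos : ∀ f ∈ K, f ≠ 0 → ∃ k : ℕ, ∃ a : ℝ, 0 < a ∧ (L ^ k) f - a • h ∈ K)
    {f g : V} {n : ℕ → ℕ} (hn : Tendsto n atTop atTop)
    (hg : Tendsto (fun j => (L ^ n j) f) atTop (𝓝 g)) : ∃ c : ℝ, g = c • h := by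
  have hhK : h ∈ K := interior_subset hint
  obtain ⟨C, hC0, hC⟩ := exists_pos_smul_sub_mem_of_mem_interior hint
  -- A bound c h for one iterate persists for all later ones, hence for g. The multiple sought is
  -- the infimum of these c.
  set S : Set ℝ := {c | ∃ m, c • h - (L ^ m) f ∈ K} with hS
  have hSne : S.Nonempty := ⟨C * ‖f‖, 0, by simpa using hC f _ le_rfl⟩
  have hSbdd : BddBelow S := by
    refine ⟨-(C * ‖f‖), fun c ⟨m, hm⟩ => ?_⟩
    have h1 : (C * ‖f‖) • h + (L ^ m) f ∈ K := by
      have := pow_apply_mem_of_mapsTo hL m (hC (-f) (C * ‖f‖) (by simp))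
      rwa [sub_neg_eq_add, map_add, map_smul, pow_apply_of_apply_eq hLh] at this
    have h2 : (c + C * ‖f‖) • h ∈ K := by
      have := add_mem hm h1
      rwa [sub_add_add_cancel, ← add_smul] at this
    by_contra! hlt
    refine hh0 (hpt h hhK ?_)
    have hneg : 0 < -(c + C * ‖f‖) := by linarith
    have := K.smul_mem h2 (inv_nonneg.2 hneg.le)
    rwa [smul_smul, inv_neg, neg_mul, inv_mul_cancel₀ (by linarith), neg_smul, one_smul] at this
  have hup : ∀ c ∈ S, c • h - g ∈ K := fun c ⟨m, hm⟩ => by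
    refine K.isClosed.mem_of_tendsto (hg.const_sub (c • h)) ?_
    filter_upwards [hn.eventually_ge_atTop m] with j hj
    have := pow_apply_mem_of_mapsTo hL (n j - m) hm
    rw [map_sub, map_smul, pow_apply_of_apply_eq hLh, ← mul_apply_eq_comp,
      ← pow_add, Nat.sub_add_cancel hj] at this
    exact this
  have hinf : (sInf S) • h - g ∈ K := by
    obtain ⟨c, -, hc1, hc2⟩ := exists_seq_tendsto_sInf hSne hSbdd
    exact K.isClosed.mem_of_tendsto ((hc1.smul_const h).sub_const g)
      (Eventually.of_forall fun j => hup _ (hc2 j))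
  refine ⟨sInf S, (sub_eq_zero.1 ?_).symm⟩
  by_contra hne
  obtain ⟨k, a, ha, hk⟩ := hpos _ hinf hne
  have hlim : Tendsto (fun j => (L ^ k) ((L ^ n j) f)) atTop (𝓝 ((L ^ k) g)) :=
    ((L ^ k).continuous.tendsto g).comp hg
  have hnear : ∀ᶠ j in atTop, C * ‖(L ^ k) ((L ^ n j) f) - (L ^ k) g‖ < a / 2 := by
    have := ((hlim.sub_const ((L ^ k) g)).norm.const_mul C)
    rw [sub_self, norm_zero, mul_zero] at this
    exact this.eventually_lt_const (by positivity)
  obtain ⟨j, hj⟩ := hnear.exists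
  -- If (inf S) h - g were nonzero, L^k would gain a h on it. Half of that gain survives the passage
  -- from g to a nearby iterate of f, which undercuts the infimum.
  have hmem : sInf S - a / 2 ∈ S := by
    refine ⟨k + n j, ?_⟩
    have h1 := hC _ _ hj.le
    have h2 := add_mem hk h1
    rw [map_sub, map_smul, pow_apply_of_apply_eq hLh] at h2
    rw [pow_add, mul_apply_eq_comp]
    convert h2 using 1
    module
  have := csInf_le hSbdd hmem
  linarith

/-- **Convergence to the principal eigenvector.** -/
theorem tendsto_pow_apply_smul (hpt : ∀ f ∈ K, -f ∈ K → f = 0) (hc : IsCompactOperator L)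
    (hL : ∀ f ∈ K, L f ∈ K) (hint : h ∈ interior (K : Set V)) (hLh : L h = h)
    (hpos : ∀ f ∈ K, f ≠ 0 → ∃ k : ℕ, ∃ a : ℝ, 0 < a ∧ (L ^ k) f - a • h ∈ K)
    {ℓ : V →L[ℝ] ℝ} (hℓ : ∀ f, ℓ (L f) = ℓ f) (hℓh : ℓ h = 1) (f : V) :
    Tendsto (fun n => (L ^ n) f) atTop (𝓝 (ℓ f • h)) := by
  have hh0 : h ≠ 0 := fun h0 => by simp [h0] at hℓh
  obtain ⟨R, hR⟩ := exists_norm_pow_apply_le hpt hc hL hint hLh f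
  -- Shifting by one makes every term the image under L of a bounded vector, so compactness gives
  -- limit points; ℓ identifies the multiple of h.
  rw [← tendsto_add_atTop_iff_nat 1]
  refine tendsto_of_subseq_tendsto fun ns hns => ?_
  obtain ⟨w, φ, hφ, hw⟩ := exists_tendsto_subseq_of_isCompactOperator hc
    (z := fun j => (L ^ ns j) f) (fun n => hR _)
  refine ⟨φ, ?_⟩
  have hw' : Tendsto (fun j => (L ^ (ns (φ j) + 1)) f) atTop (𝓝 w) := by
    simpa only [pow_succ' L, mul_apply_eq_comp] using hw
  obtain ⟨c, rfl⟩ := exists_eq_smul_of_tendsto_pow_apply hpt hL hint hh0 hLh hpos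
    (n := fun j => ns (φ j) + 1)
    ((tendsto_add_atTop_nat 1).comp (hns.comp hφ.tendsto_atTop)) hw'
  have : ℓ f = c := by
    have h1 := (ℓ.continuous.tendsto _).comp hw'
    rw [map_smul, hℓh, smul_eq_mul, mul_one] at h1
    simp only [Function.comp_def, functional_pow_apply hℓ] at h1
    exact tendsto_nhds_unique tendsto_const_nhds h1
  rw [this]
  exact hw'

end PositiveOperators

end LimitingModularSymbols

/-! ### Primitives of holomorphic functions on the upper half-plane -/

namespace LimitingModularSymbols

section Primitives

open Complex Metric

theorem mem_ball_natCast_mul_I_iff {n : ℕ} {z : ℂ} :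
    z ∈ ball ((n : ℂ) * I) n ↔ z.re ^ 2 + z.im ^ 2 < 2 * n * z.im := by
  rw [mem_ball, dist_eq, ← sq_lt_sq₀ (norm_nonneg _) n.cast_nonneg, ← normSq_eq_norm_sq,
    normSq_apply]
  simp only [sub_re, sub_im, mul_re, mul_im, natCast_re, natCast_im, I_re, I_im]
  constructor <;> intro h <;> nlinarith

/-- A holomorphic function on the upper half-plane has a primitive. -/
theorem isExactOn_upperHalfPlane {f : ℂ → ℂ} (hf : DifferentiableOn ℂ f {z | 0 < z.im}) :
    IsExactOn f {z | 0 < z.im} := by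
  -- The discs |z - n i| < n increase to the upper half-plane, and primitives on them glue once
  -- normalized to vanish at i.
  have hsub : ∀ n : ℕ, ball ((n : ℂ) * I) n ⊆ {z | 0 < z.im} := fun n z hz => by
    rw [mem_ball_natCast_mul_I_iff] at hz
    by_contra h
    have h' : z.im ≤ 0 := not_lt.1 h
    nlinarith [sq_nonneg z.re, sq_nonneg z.im, mul_nonneg (n.cast_nonneg (α := ℝ)) (neg_nonneg.2 h')]
  have hmono : ∀ m n : ℕ, m ≤ n → ball ((m : ℂ) * I) m ⊆ ball ((n : ℂ) * I) n :=
    fun m n hmn z hz => by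
      have h0 : 0 < z.im := hsub m hz
      rw [mem_ball_natCast_mul_I_iff] at hz ⊢
      have : (m : ℝ) ≤ n := by exact_mod_cast hmn
      nlinarith [mul_le_mul_of_nonneg_right this h0.le]
  have hI : ∀ n : ℕ, 1 ≤ n → I ∈ ball ((n : ℂ) * I) n := fun n hn => by
    rw [mem_ball_natCast_mul_I_iff]
    have : (1 : ℝ) ≤ n := by exact_mod_cast hn
    simp; linarith
  have hex : ∀ n : ℕ, ∃ g : ℂ → ℂ, g I = 0 ∧ ∀ z ∈ ball ((n : ℂ) * I) n, HasDerivAt g (f z) z :=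
    fun n => (hf.mono (hsub n)).isExactOn_ball.with_val_at I 0
  choose g hg0 hg using hex
  have hagree : ∀ m n : ℕ, 1 ≤ m → m ≤ n → EqOn (g m) (g n) (ball ((m : ℂ) * I) m) :=
    fun m n hm hmn => isOpen_ball.eqOn_of_deriv_eq (convex_ball _ _).isPreconnected
      (fun z hz => (hg m z hz).differentiableAt.differentiableWithinAt)
      (fun z hz => (hg n z (hmono m n hmn hz)).differentiableAt.differentiableWithinAt)
      (fun z hz => by rw [(hg m z hz).deriv, (hg n z (hmono m n hmn hz)).deriv]) (hI m hm)
      (by rw [hg0, hg0])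
  have hcov : ∀ z ∈ {z : ℂ | 0 < z.im}, ∃ n : ℕ, 1 ≤ n ∧ z ∈ ball ((n : ℂ) * I) n :=
    fun z hz => by
      have hz : 0 < z.im := hz
      obtain ⟨n, hn⟩ := exists_nat_gt ((z.re ^ 2 + z.im ^ 2) / (2 * z.im))
      rw [div_lt_iff₀ (by positivity)] at hn
      refine ⟨n, ?_, ?_⟩
      · rw [Nat.one_le_iff_ne_zero]
        rintro rfl
        rw [Nat.cast_zero, zero_mul] at hn
        nlinarith [sq_nonneg z.re, sq_nonneg z.im]
      · rw [mem_ball_natCast_mul_I_iff]; linarith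
  choose! N hN1 hN using hcov
  refine ⟨fun z => g (N z) z, fun z hz => ?_⟩
  refine (hg (N z) z (hN z hz)).congr_of_eventuallyEq ?_
  filter_upwards [isOpen_ball.mem_nhds (hN z hz)] with w hw
  have hw0 := hsub _ hw
  rcases le_total (N z) (N w) with h | h
  · exact (hagree _ _ (hN1 z hz) h hw).symm
  · exact hagree _ _ (hN1 w hw0) h (hN w hw0)

end Primitives

/-! ### Primitives under the slash action, for determinants of either sign -/

section SlashPrimitive

open UpperHalfPlane ModularForm

/-- If `F` is a primitive of `f`, this is a primitive of `f ∣[2] γ`. -/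
noncomputable def slashPrimitive (F : ℂ → ℂ) (γ : GL (Fin 2) ℝ) (w : ℂ) : ℂ :=
  if 0 < γ.det.val then F (num γ w / denom γ w)
  else -(starRingEnd ℂ) (F ((starRingEnd ℂ) (num γ w / denom γ w)))

/-- For negative determinant the action on `ℍ` inserts a conjugation. The outer conjugation and
minus sign restore holomorphy and together leave the imaginary part alone; hence
orientation-reversing matrices preserve Im (ω dz) as well. -/
theorem im_slashPrimitive (F : ℂ → ℂ) (γ : GL (Fin 2) ℝ) (z : ℍ) :
    (slashPrimitive F γ z).im = (F (γ • z : ℍ)).im := by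
  rw [coe_smul, slashPrimitive, σ]
  split_ifs <;> simp

theorem hasDerivAt_num_div_denom (γ : GL (Fin 2) ℝ) (z : ℍ) :
    HasDerivAt (fun w => num γ w / denom γ w) ((γ.det.val : ℂ) / denom γ z ^ 2) z := by
  have h1 : HasDerivAt (num γ) (γ 0 0 : ℂ) z := by
    have := ((hasDerivAt_id (z : ℂ)).const_mul (γ 0 0 : ℂ)).add_const (γ 0 1 : ℂ)
    rwa [mul_one] at this
  have h2 : HasDerivAt (denom γ) (γ 1 0 : ℂ) z := by
    have := ((hasDerivAt_id (z : ℂ)).const_mul (γ 1 0 : ℂ)).add_const (γ 1 1 : ℂ)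
    rwa [mul_one] at this
  refine (h1.div h2 (denom_ne_zero γ z)).congr_deriv ?_
  congr 1
  rw [Matrix.GeneralLinearGroup.val_det_apply, Matrix.det_fin_two]
  simp only [num, denom]
  push_cast
  ring

/-- The chain rule yields det / denom², the weight-two factor; for negative determinant the minus
sign of `slashPrimitive` turns det into |det|. -/
theorem hasDerivAt_slashPrimitive {F : ℂ → ℂ} {f : ℍ → ℂ}
    (hF : ∀ z : ℍ, HasDerivAt F (f z) z) (γ : GL (Fin 2) ℝ) (z : ℍ) :
    HasDerivAt (slashPrimitive F γ) ((f ∣[(2 : ℤ)] γ) z) z := by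
  have hm := hasDerivAt_num_div_denom γ z
  have hz := hF (γ • z)
  rw [slash_apply]
  rcases lt_or_gt_of_ne γ.det.ne_zero with hdet | hdet
  · have hs : slashPrimitive F γ = fun w =>
        -((starRingEnd ℂ) ∘ F ∘ (starRingEnd ℂ)) (num γ w / denom γ w) := by
      ext w; rw [slashPrimitive, if_neg hdet.not_gt]; rfl
    rw [hs]
    have hco : ((γ • z : ℍ) : ℂ) = (starRingEnd ℂ) (num γ z / denom γ z) := by
      rw [coe_smul, σ, if_neg hdet.not_gt]; rfl
    rw [hco] at hz
    have h3 := hz.conj_conj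
    rw [Complex.conj_conj] at h3
    refine (h3.comp (z : ℂ) hm).neg.congr_deriv ?_
    rw [σ, if_neg hdet.not_gt, abs_of_neg hdet]
    simp [zpow_neg]
    ring
  · have hs : slashPrimitive F γ = fun w => F (num γ w / denom γ w) := by
      ext w; rw [slashPrimitive, if_pos hdet]
    rw [hs]
    rw [coe_smul_of_det_pos hdet] at hz
    refine (hz.comp (z : ℂ) hm).congr_deriv ?_
    rw [σ, if_pos hdet, abs_of_pos hdet]
    simp [zpow_neg]
    ring

/-- The hyperbolic norm of a form of weight two is invariant: the automorphy factor cancels against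
that of Im. -/
theorem norm_slash_two_mul_im (f : ℍ → ℂ) (γ : GL (Fin 2) ℝ) (z : ℍ) :
    ‖(f ∣[(2 : ℤ)] γ) z‖ * z.im = ‖f (γ • z)‖ * (γ • z).im := by
  rw [slash_apply, im_smul_eq_div_normSq, Complex.normSq_eq_norm_sq]
  simp [zpow_neg]
  ring

end SlashPrimitive

end LimitingModularSymbols

/-! ### Vertical geodesics and decay at the cusp -/

namespace LimitingModularSymbols

open UpperHalfPlane ModularForm

section Vertical

theorem coe_geodesicPoint (z : ℍ) (s : ℝ) :
    (geodesicPoint z s : ℂ) = z.re + (z.im * Real.exp (-s) : ℝ) * Complex.I := by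
  apply Complex.ext <;> simp [geodesicPoint, -Complex.ofReal_mul, -Complex.ofReal_exp]

theorem im_geodesicPoint (z : ℍ) (s : ℝ) : (geodesicPoint z s).im = z.im * Real.exp (-s) := rfl

theorem geodesicPoint_zero (z : ℍ) : geodesicPoint z 0 = z := by
  ext : 1
  rw [coe_geodesicPoint]
  apply Complex.ext <;> simp

theorem hasDerivAt_geodesicPoint (z : ℍ) (s : ℝ) :
    HasDerivAt (fun r => (geodesicPoint z r : ℂ)) (-(geodesicPoint z s).im * Complex.I) s := by
  simp only [coe_geodesicPoint, im_geodesicPoint]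
  have h1 : HasDerivAt (fun r : ℝ => z.im * Real.exp (-r)) (-(z.im * Real.exp (-s))) s := by
    have := ((hasDerivAt_neg s).exp).const_mul z.im
    simpa using this
  have := (h1.ofReal_comp.mul_const Complex.I).const_add (z.re : ℂ)
  simpa using this

theorem continuous_geodesicPoint (z : ℍ) : Continuous (geodesicPoint z) := by
  rw [UpperHalfPlane.isOpenEmbedding_coe.isInducing.continuous_iff]
  exact continuous_iff_continuousAt.2 fun s => (hasDerivAt_geodesicPoint z s).continuousAt

theorem continuous_geodesicPoint_left (s : ℝ) : Continuous fun z => geodesicPoint z s := by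
  rw [UpperHalfPlane.isOpenEmbedding_coe.isInducing.continuous_iff]
  have : (UpperHalfPlane.coe ∘ fun z => geodesicPoint z s) =
      fun z : ℍ => (z.re + (z.im * Real.exp (-s) : ℝ) * Complex.I : ℂ) := by
    ext z; exact coe_geodesicPoint z s
  rw [this]
  have h1 := UpperHalfPlane.continuous_re
  have h2 := UpperHalfPlane.continuous_im
  fun_prop

variable {F : ℂ → ℂ} {f : ℍ → ℂ}

theorem integral_im_mul_deriv_eq_sub (hF : ∀ z : ℍ, HasDerivAt F (f z) z) (hf : Continuous f)
    (γ : GL (Fin 2) ℝ) (z : ℍ) (τ : ℝ) :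
    ∫ s in (0 : ℝ)..τ, (f (γ • geodesicPoint z s) *
        deriv (fun r => ((γ • geodesicPoint z r : ℍ) : ℂ)) s).im =
      (F (γ • geodesicPoint z τ : ℍ)).im - (F (γ • z : ℍ)).im := by
  have hy : ∀ s, HasDerivAt (fun r => ((γ • geodesicPoint z r : ℍ) : ℂ))
      (σ γ ((γ.det.val : ℂ) / denom γ (geodesicPoint z s) ^ 2 *
        (-(geodesicPoint z s).im * Complex.I))) s := fun s => by
    simp only [coe_smul]
    have h1 := (hasDerivAt_num_div_denom γ (geodesicPoint z s)).comp s (hasDerivAt_geodesicPoint z s)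
    exact ((σ γ : ℂ →L[ℝ] ℂ).hasFDerivAt (x := _)).comp_hasDerivAt s h1
  have hyc : Continuous fun s => γ • geodesicPoint z s :=
    (continuous_const_smul γ).comp (continuous_geodesicPoint z)
  have hder : ∀ s, HasDerivAt (fun r => (F (γ • geodesicPoint z r : ℍ)).im)
      (f (γ • geodesicPoint z s) *
        deriv (fun r => ((γ • geodesicPoint z r : ℍ) : ℂ)) s).im s := fun s => by
    rw [(hy s).deriv]
    exact Complex.imCLM.hasFDerivAt.comp_hasDerivAt s ((hF (γ • geodesicPoint z s)).comp s (hy s))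
  rw [intervalIntegral.integral_eq_sub_of_hasDerivAt (fun s _ => hder s), geodesicPoint_zero]
  refine Continuous.intervalIntegrable ?_ _ _
  have h1 : (deriv fun r => ((γ • geodesicPoint z r : ℍ) : ℂ)) = fun s =>
      σ γ ((γ.det.val : ℂ) / denom γ (geodesicPoint z s) ^ 2 *
        (-(geodesicPoint z s).im * Complex.I)) := funext fun s => (hy s).deriv
  rw [h1]
  have hc := UpperHalfPlane.continuous_coe.comp (continuous_geodesicPoint z)
  have hd : Continuous fun s => denom γ (geodesicPoint z s) := by
    simp only [denom]
    exact (continuous_const.mul hc).add continuous_const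
  refine Complex.continuous_im.comp ((hf.comp hyc).mul ((σ γ).continuous.comp ?_))
  refine (continuous_const.div (hd.pow 2) fun s => pow_ne_zero 2 (denom_ne_zero _ _)).mul ?_
  exact (Complex.continuous_ofReal.comp
    (UpperHalfPlane.continuous_im.comp (continuous_geodesicPoint z))).neg.mul continuous_const

/-- Parametrized by hyperbolic length, the geodesic has Euclidean speed Im, so along it the
integrand is at most the invariant bound C. -/
theorem abs_im_geodesicPoint_sub_le (hF : ∀ z : ℍ, HasDerivAt F (f z) z) {C : ℝ}
    (hC : ∀ z : ℍ, ‖f z‖ * z.im ≤ C) (γ : GL (Fin 2) ℝ) (z : ℍ) (s : ℝ) :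
    |(F (γ • geodesicPoint z s : ℍ)).im - (F (γ • z : ℍ)).im| ≤ C * |s| := by
  have hder : ∀ r : ℝ, HasDerivAt (fun r => slashPrimitive F γ (geodesicPoint z r))
      ((f ∣[(2 : ℤ)] γ) (geodesicPoint z r) * (-(geodesicPoint z r).im * Complex.I)) r := fun r => by
    have h1 := hasDerivAt_slashPrimitive hF γ (geodesicPoint z r)
    exact h1.comp r (hasDerivAt_geodesicPoint z r)
  have h := convex_univ.norm_image_sub_le_of_norm_hasDerivWithin_le (C := C)
    (fun r _ => (hder r).hasDerivWithinAt) (fun r _ => by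
      rw [norm_mul, norm_mul, norm_neg, Complex.norm_I, mul_one, Complex.norm_real,
        Real.norm_of_nonneg (geodesicPoint z r).im_pos.le, norm_slash_two_mul_im]
      exact hC _) (mem_univ 0) (mem_univ s)
  rw [geodesicPoint_zero, sub_zero, Real.norm_eq_abs] at h
  rw [← im_slashPrimitive, ← im_slashPrimitive, ← Complex.sub_im]
  exact (Complex.abs_im_le_norm _).trans h

end Vertical

/-! ### Exponential decay at i∞ -/

section Cusp

variable {F : ℂ → ℂ} {f : ℍ → ℂ} {b c C : ℝ}

/-- The right side is the integral of the majorant C exp (-c v) over [y, y'], used as a comparison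
function. -/
theorem norm_sub_vertical_le (hF : ∀ z : ℍ, HasDerivAt F (f z) z) (hb : 0 < b) (hc : 0 < c)
    (hC : ∀ z : ℍ, b ≤ z.im → ‖f z‖ ≤ C * Real.exp (-c * z.im)) (x : ℝ) {y y' : ℝ} (hy : b ≤ y)
    (hyy' : y ≤ y') :
    ‖F (x + y' * Complex.I) - F (x + y * Complex.I)‖ ≤
      C / c * (Real.exp (-c * y) - Real.exp (-c * y')) := by
  have hpath : ∀ v : ℝ, HasDerivAt (fun v : ℝ => (x + v * Complex.I : ℂ)) Complex.I v := fun v => by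
    simpa using (((hasDerivAt_id v).ofReal_comp).mul_const Complex.I).const_add (x : ℂ)
  have hpt : ∀ v : ℝ, 0 < v → ∃ z : ℍ, (z : ℂ) = x + v * Complex.I ∧ z.im = v := fun v hv =>
    ⟨⟨x + v * Complex.I, by simpa using hv⟩, rfl, by simp [UpperHalfPlane.im]⟩
  have hder : ∀ v : ℝ, b ≤ v → ∃ d : ℂ, HasDerivAt (fun v : ℝ => F (x + v * Complex.I)) d v ∧
      ‖d‖ ≤ C * Real.exp (-c * v) := fun v hv => by
    obtain ⟨z, hz, hzi⟩ := hpt v (hb.trans_le hv)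
    refine ⟨f z * Complex.I, ?_, ?_⟩
    · have := hF z
      rw [hz] at this
      exact this.comp v (hpath v)
    · rw [norm_mul, Complex.norm_I, mul_one, ← hzi]
      exact hC z (by rwa [hzi])
  choose! d hd hdn using hder
  have hB : ∀ v : ℝ, HasDerivAt (fun v => C / c * (Real.exp (-c * y) - Real.exp (-c * v)))
      (C * Real.exp (-c * v)) v := fun v => by
    have h1 := ((((hasDerivAt_id v).const_mul (-c)).exp).const_sub
      (Real.exp (-c * y))).const_mul (C / c)
    refine h1.congr_deriv ?_
    simp only [id, mul_one]
    field_simp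
  refine image_norm_le_of_norm_deriv_right_le_deriv_boundary'
    (f := fun v : ℝ => F (x + v * Complex.I) - F (x + y * Complex.I)) (f' := d)
    (B' := fun v => C * Real.exp (-c * v)) (a := y) (b := y')
    (fun v hv => ((hd v (hy.trans hv.1)).sub_const _).continuousAt.continuousWithinAt)
    (fun v hv => ((hd v (hy.trans hv.1)).sub_const _).hasDerivWithinAt) (by simp)
    (fun v _ => (hB v).continuousAt.continuousWithinAt)
    (fun v _ => (hB v).hasDerivWithinAt) (fun v hv => hdn v (hy.trans hv.1)) ⟨hyy', le_rfl⟩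

theorem norm_sub_horizontal_le (hF : ∀ z : ℍ, HasDerivAt F (f z) z) (hb : 0 < b) (hc : 0 < c)
    (hC0 : 0 ≤ C) (hC : ∀ z : ℍ, b ≤ z.im → ‖f z‖ ≤ C * Real.exp (-c * z.im)) (x x' : ℝ) {y : ℝ}
    (hy : b ≤ y) :
    ‖F (x' + y * Complex.I) - F (x + y * Complex.I)‖ ≤ C * Real.exp (-c * y) * |x' - x| := by
  have hconv : Convex ℝ {w : ℂ | y ≤ w.im} :=
    convex_halfSpace_ge Complex.imCLM.toLinearMap.isLinear y
  have h := hconv.norm_image_sub_le_of_norm_hasDerivWithin_le (f := F)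
    (f' := fun w => f (ofComplex w)) (C := C * Real.exp (-c * y))
    (x := x + y * Complex.I) (y := x' + y * Complex.I)
    (fun w hw => by
      have hw0 : 0 < w.im := (hb.trans_le hy).trans_le hw
      have := hF ⟨w, hw0⟩
      rw [ofComplex_apply_of_im_pos hw0]
      exact this.hasDerivWithinAt)
    (fun w hw => by
      have hw0 : 0 < w.im := (hb.trans_le hy).trans_le hw
      rw [ofComplex_apply_of_im_pos hw0]
      refine (hC ⟨w, hw0⟩ (hy.trans hw)).trans ?_
      have hw' : y ≤ (⟨w, hw0⟩ : ℍ).im := hw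
      gcongr C * Real.exp ?_
      nlinarith)
    (by simp) (by simp)
  refine h.trans (le_of_eq ?_)
  congr 1
  rw [add_sub_add_right_eq_sub, ← Complex.ofReal_sub, Complex.norm_real, Real.norm_eq_abs]

/-- A primitive of a function with exponential decay at `i∞` has a limit at `i∞`, which it
approaches exponentially fast. -/
theorem exists_norm_sub_le_exp (hF : ∀ z : ℍ, HasDerivAt F (f z) z) (hb : 0 < b) (hc : 0 < c)
    (hC0 : 0 ≤ C) (hC : ∀ z : ℍ, b ≤ z.im → ‖f z‖ ≤ C * Real.exp (-c * z.im)) :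
    ∃ a : ℂ, ∀ z : ℍ, b ≤ z.im → ‖F z - a‖ ≤ C / c * Real.exp (-c * z.im) := by
  have hexp : Tendsto (fun y : ℝ => Real.exp (-c * y)) atTop (𝓝 0) := by
    refine Real.tendsto_exp_atBot.comp ?_
    exact tendsto_id.const_mul_atTop_of_neg (by linarith)
  have hcauchy : CauchySeq fun y : ℝ => F ((0 : ℝ) + y * Complex.I) := by
    rw [Metric.cauchySeq_iff']
    intro ε hε
    have h1 : Tendsto (fun y : ℝ => C / c * Real.exp (-c * y)) atTop (𝓝 0) := by
      simpa using hexp.const_mul (C / c)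
    obtain ⟨y, hy1, hy2⟩ := ((h1.eventually_lt_const hε).and (eventually_ge_atTop b)).exists
    refine ⟨y, fun y' hy' => ?_⟩
    rw [dist_eq_norm]
    refine (norm_sub_vertical_le hF hb hc hC 0 hy2 hy').trans_lt (lt_of_le_of_lt ?_ hy1)
    gcongr
    linarith [Real.exp_pos (-c * y')]
  obtain ⟨a, ha⟩ := cauchySeq_tendsto_of_complete hcauchy
  -- The horizontal estimate tends to 0 with growing height, so the limit is the same on every
  -- vertical line.
  have hall : ∀ x : ℝ, Tendsto (fun y : ℝ => F (x + y * Complex.I)) atTop (𝓝 a) := fun x => by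
    have h1 : Tendsto (fun y : ℝ => F (x + y * Complex.I) - F ((0 : ℝ) + y * Complex.I)) atTop
        (𝓝 0) := by
      refine squeeze_zero_norm' (a := fun y => C * Real.exp (-c * y) * |x - 0|) ?_ ?_
      · filter_upwards [eventually_ge_atTop b] with y hy
        exact norm_sub_horizontal_le hF hb hc hC0 hC 0 x hy
      · simpa using (hexp.const_mul C).mul_const |x - 0|
    simpa using h1.add ha
  refine ⟨a, fun z hz => ?_⟩
  have hzc : (z : ℂ) = (z.re : ℂ) + (z.im : ℂ) * Complex.I := by
    apply Complex.ext <;> simp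
  have h1 : Tendsto (fun y : ℝ => ‖F (z.re + y * Complex.I) - F z‖) atTop (𝓝 ‖a - F z‖) :=
    ((hall z.re).sub_const _).norm
  rw [norm_sub_rev]
  refine le_of_tendsto h1 ?_
  filter_upwards [eventually_ge_atTop z.im] with y hy
  have h2 := norm_sub_vertical_le hF hb hc hC z.re hz hy
  rw [← hzc] at h2
  refine h2.trans ?_
  gcongr
  linarith [Real.exp_pos (-c * y)]

/-- Decay at `i∞` together with the weight two bound gives an exponential bound on every
half-plane above the real axis. -/
theorem exists_norm_le_exp_of_isBigO (hb : 0 < b) (hc : 0 < c) (hCf : ∀ z : ℍ, ‖f z‖ * z.im ≤ C)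
    (hO : f =O[atImInfty] fun z => Real.exp (-c * z.im)) :
    ∃ C' : ℝ, 0 ≤ C' ∧ ∀ z : ℍ, b ≤ z.im → ‖f z‖ ≤ C' * Real.exp (-c * z.im) := by
  obtain ⟨D, hD⟩ := hO.bound
  obtain ⟨Y, hY⟩ := (atImInfty_mem _).1 hD
  have hC0 : 0 ≤ C := le_trans (by positivity) (hCf UpperHalfPlane.I)
  -- Above Y the constant D serves; for b ≤ Im z ≤ Y the invariant bound gives C / b, and exp (c Y)
  -- offsets the decaying factor.
  refine ⟨max D (C / b * Real.exp (c * Y)), le_max_of_le_right (by positivity), fun z hz => ?_⟩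
  rcases le_total Y z.im with h | h
  · have h1 : ‖f z‖ ≤ D * ‖Real.exp (-c * z.im)‖ := hY z h
    rw [Real.norm_of_nonneg (Real.exp_pos _).le] at h1
    exact h1.trans (by gcongr; exact le_max_left _ _)
  · have h1 : ‖f z‖ ≤ C / b := by
      rw [le_div_iff₀ hb]
      exact le_trans (by gcongr) (hCf z)
    calc ‖f z‖ ≤ C / b * 1 := by rwa [mul_one]
      _ ≤ C / b * (Real.exp (c * Y) * Real.exp (-c * z.im)) := by
          gcongr
          rw [← Real.exp_add, Real.one_le_exp_iff]
          nlinarith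
      _ = C / b * Real.exp (c * Y) * Real.exp (-c * z.im) := by ring
      _ ≤ _ := by gcongr; exact le_max_right _ _

end Cusp

end LimitingModularSymbols

/-! ### The group `G` as an arithmetic group -/

namespace LimitingModularSymbols

open UpperHalfPlane ModularForm Matrix.ProjGenLinGroup

/-- The inclusion of `GL(2,ℤ)` in `GL(2,ℝ)`. -/
noncomputable abbrev toRealGL : GL (Fin 2) ℤ →* GL (Fin 2) ℝ :=
  Matrix.GeneralLinearGroup.map (Int.castRingHom ℝ)

theorem toRealGL_injective : Function.Injective toRealGL :=
  Units.map_injective (Matrix.map_injective Int.cast_injective)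

variable {G : Subgroup PGL(2, ℤ)}

instance [G.FiniteIndex] : Finite (Cosets G) :=
  inferInstanceAs (Finite (PGL(2, ℤ) ⧸ G))

/-- This group and SL(2,ℤ) are both images of finite-index subgroups of GL(2,ℤ), hence
commensurable. -/
instance isArithmetic_realGroup [hG : G.FiniteIndex] : (realGroup G).IsArithmetic := by
  have hΓ : (G.comap (mk (n := Fin 2) (R := ℤ))).FiniteIndex := by
    refine ⟨?_⟩
    rw [Subgroup.index_comap_of_surjective _ mk_surjective]
    exact hG.index_ne_zero
  have hS : (Matrix.GeneralLinearGroup.det (n := Fin 2) (R := ℤ)).ker.FiniteIndex :=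
    Subgroup.finiteIndex_ker _
  have hSL : (Matrix.SpecialLinearGroup.mapGL ℝ : SL(2, ℤ) →* GL (Fin 2) ℝ).range =
      (Matrix.GeneralLinearGroup.det (n := Fin 2) (R := ℤ)).ker.map toRealGL := by
    ext g
    constructor
    · rintro ⟨s, rfl⟩
      refine ⟨(s : GL (Fin 2) ℤ), ?_, ?_⟩
      · rw [SetLike.mem_coe, MonoidHom.mem_ker]; ext; simp
      · ext i j; simp
    · rintro ⟨s, hs, rfl⟩
      rw [SetLike.mem_coe, MonoidHom.mem_ker] at hs
      refine ⟨⟨s.val, ?_⟩, ?_⟩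
      · have := congrArg Units.val hs
        simpa using this
      · ext i j; rfl
  refine ⟨?_, ?_⟩
  · rw [hSL, realGroup, Subgroup.relIndex_map_map_of_injective _ _ toRealGL_injective]
    exact fun h => Subgroup.FiniteIndex.index_ne_zero (Subgroup.index_eq_zero_of_relIndex_eq_zero h)
  · rw [hSL, realGroup, Subgroup.relIndex_map_map_of_injective _ _ toRealGL_injective]
    exact fun h => Subgroup.FiniteIndex.index_ne_zero (Subgroup.index_eq_zero_of_relIndex_eq_zero h)

open ConjAct Pointwise in
theorem isArithmetic_conj_toRealGL (Γ : Subgroup (GL (Fin 2) ℝ)) [Γ.IsArithmetic]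
    (g : GL (Fin 2) ℤ) : (toConjAct (toRealGL g) • Γ).IsArithmetic := by
  have h := Subgroup.IsArithmetic.conj Γ (Matrix.GeneralLinearGroup.map (Int.castRingHom ℚ) g)
  have : Matrix.GeneralLinearGroup.map (Rat.castHom ℝ)
      (Matrix.GeneralLinearGroup.map (Int.castRingHom ℚ) g) = toRealGL g := by
    ext i j; simp
  rwa [this] at h

/-- The translate of ω is a cusp form for a conjugate group, again arithmetic, so decay at i∞ is
available after moving any cusp there. -/
theorem isBigO_exp_slash [G.FiniteIndex] (ω : CuspForm (realGroup G) 2) (g : GL (Fin 2) ℤ) :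
    ∃ c > 0, (⇑ω ∣[(2 : ℤ)] (toRealGL g)) =O[atImInfty] fun z => Real.exp (-c * z.im) := by
  have := isArithmetic_conj_toRealGL (realGroup G) g⁻¹
  rw [map_inv] at this
  exact CuspFormClass.exp_decay_atImInfty' (CuspForm.translate ω (toRealGL g))

theorem exists_norm_mul_im_le [G.FiniteIndex] (ω : CuspForm (realGroup G) 2) :
    ∃ C : ℝ, ∀ z : ℍ, ‖ω z‖ * z.im ≤ C := by
  obtain ⟨C, hC⟩ := CuspFormClass.exists_bound ω
  refine ⟨C, fun z => ?_⟩
  have := hC z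
  norm_num at this
  rwa [le_div_iff₀ z.im_pos] at this

theorem exists_primitive {Γ : Subgroup (GL (Fin 2) ℝ)} {k : ℤ} (ω : CuspForm Γ k) :
    ∃ F : ℂ → ℂ, ∀ z : ℍ, HasDerivAt F (ω z) z := by
  obtain ⟨F, hF⟩ := isExactOn_upperHalfPlane
    (UpperHalfPlane.mdifferentiable_iff.1 (CuspFormClass.holo ω))
  exact ⟨F, fun z => by simpa using hF z z.im_pos⟩

/-- Both `cosetRep (mk g • t)` and `g * cosetRep t` represent the same coset. -/
theorem mk_cosetRep_smul (g : GL (Fin 2) ℤ) (t : Cosets G) :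
    (cosetRep (mk g • t))⁻¹ * g * cosetRep t ∈ G.comap mk := by
  rw [Subgroup.mem_comap, map_mul, map_mul, map_inv, mul_assoc, ← QuotientGroup.eq,
    cosetRep_spec (mk g • t)]
  conv_lhs => rw [← cosetRep_spec t]
  rfl

/-- The element γ comparing the representatives lies in the preimage of G, so slashing with it fixes
ω. Thus F and its slash by γ are two primitives of ω on a connected set. -/
theorem exists_im_primitive_smul_eq_add {ω : CuspForm (realGroup G) 2} {F : ℂ → ℂ}
    (hF : ∀ z : ℍ, HasDerivAt F (ω z) z) (g : GL (Fin 2) ℤ) (t : Cosets G) :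
    ∃ c : ℝ, ∀ z : ℍ, (F ((toRealGL (cosetRep (mk g • t)))⁻¹ • toRealGL g • z : ℍ)).im =
      (F ((toRealGL (cosetRep t))⁻¹ • z : ℍ)).im + c := by
  set γ := (cosetRep (mk g • t))⁻¹ * g * cosetRep t with hγ
  have hmem : toRealGL γ ∈ realGroup G := ⟨γ, mk_cosetRep_smul g t, rfl⟩
  have hder : ∀ z : ℍ, HasDerivAt (slashPrimitive F (toRealGL γ)) (ω z) z := fun z => by
    have := hasDerivAt_slashPrimitive hF (toRealGL γ) z
    rwa [SlashInvariantForm.slash_action_eqn ω _ hmem] at this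
  have hopen : IsOpen {z : ℂ | 0 < z.im} := isOpen_lt continuous_const Complex.continuous_im
  have hconn : IsPreconnected {z : ℂ | 0 < z.im} :=
    (convex_halfSpace_gt Complex.imCLM.toLinearMap.isLinear 0).isPreconnected
  have hd : ∀ z : ℂ, 0 < z.im → HasDerivAt (fun w => slashPrimitive F (toRealGL γ) w - F w) 0 z :=
    fun z hz => by
      have := (hder ⟨z, hz⟩).sub (hF ⟨z, hz⟩)
      rwa [sub_self] at this
  obtain ⟨a, ha⟩ := hopen.exists_is_const_of_deriv_eq_zero hconn
    (fun z hz => (hd z hz).differentiableAt.differentiableWithinAt) (fun z hz => (hd z hz).deriv)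
  refine ⟨a.im, fun z => ?_⟩
  have h1 : (toRealGL (cosetRep (mk g • t)))⁻¹ • toRealGL g • z =
      toRealGL γ • (toRealGL (cosetRep t))⁻¹ • z := by
    rw [smul_smul, smul_smul, hγ]
    simp only [map_mul, map_inv, mul_assoc, mul_inv_cancel, mul_one]
  rw [h1, ← im_slashPrimitive, ← ha _ ((toRealGL (cosetRep t))⁻¹ • z).im_pos]
  simp

end LimitingModularSymbols

/-! ### Heights: normalized primitives of harmonic forms -/

namespace LimitingModularSymbols

open UpperHalfPlane ModularForm Matrix.ProjGenLinGroup

variable {G : Subgroup PGL(2, ℤ)}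

noncomputable instance [G.FiniteIndex] : Fintype (Cosets G) := Fintype.ofFinite _

/-! ### The shift matrices acting on the upper half-plane -/

section Shift

theorem coe_toRealGL_shiftMatrix_smul (k : ℤ) (z : ℍ) :
    ((toRealGL (shiftMatrix k) • z : ℍ) : ℂ) = ((starRingEnd ℂ) z)⁻¹ - k := by
  have hdet : (toRealGL (shiftMatrix k)).det.val = -1 := by
    rw [Matrix.GeneralLinearGroup.val_det_apply, Matrix.det_fin_two]
    simp [shiftMatrix]
  have hz : (starRingEnd ℂ) (z : ℂ) ≠ 0 := by simpa using z.ne_zero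
  rw [coe_smul, σ, if_neg (by rw [hdet]; norm_num)]
  simp [num, denom, shiftMatrix]
  field_simp
  ring

/-- The matrix `(1, -k; 0, 1)`. -/
def translationMatrix (k : ℤ) : GL (Fin 2) ℤ := shiftMatrix k * (shiftMatrix 0)⁻¹

/-- A shift matrix is the inversion z ↦ 1 / z̄ followed by a translation, which fixes i∞. This makes
the constant φ of `IsHeight` the same for all digits. -/
theorem translationMatrix_mul (k : ℤ) : translationMatrix k * shiftMatrix 0 = shiftMatrix k := by
  simp [translationMatrix]

theorem coe_translationMatrix (k : ℤ) :
    (translationMatrix k : Matrix (Fin 2) (Fin 2) ℤ) = !![1, -k; 0, 1] := by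
  have : ((shiftMatrix 0)⁻¹ : GL (Fin 2) ℤ).val = !![0, 1; 1, 0] := rfl
  rw [translationMatrix, Units.val_mul, this]
  simp [shiftMatrix]

theorem im_toRealGL_translationMatrix_smul (k : ℤ) (z : ℍ) :
    (toRealGL (translationMatrix k) • z).im = z.im := by
  rw [im_smul_eq_div_normSq, Matrix.GeneralLinearGroup.val_det_apply, Matrix.det_fin_two]
  simp [denom, coe_translationMatrix]

theorem toRealGL_shiftMatrix_zero_smul_I : toRealGL (shiftMatrix 0) • UpperHalfPlane.I =
    UpperHalfPlane.I := by
  ext : 1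
  rw [coe_toRealGL_shiftMatrix_smul]
  simp

end Shift

/-- `A t` is a primitive, on the sheet `ℍ × {t}`, of the harmonic form `Im (ω dz)`, normalized to
vanish at `i∞`; `φ t` is the integral of the form along the geodesic that joins `0` and `i∞`; and
`C` bounds all error terms. -/
structure IsHeight (ω : CuspForm (realGroup G) 2) (A : Cosets G → ℍ → ℝ) (φ : Cosets G → ℝ)
    (C : ℝ) : Prop where
  continuous : ∀ t, Continuous (A t)
  modularSymbol_eq : ∀ x₀ τ t, modularSymbol x₀ τ t ω = A t (geodesicPoint x₀ τ) - A t x₀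
  abs_sub_le : ∀ t x₀ s, |A t (geodesicPoint x₀ s) - A t x₀| ≤ C * |s|
  abs_le : ∀ t z, 1 / 2 ≤ z.im → |A t z| ≤ C
  shift_smul : ∀ (k : ℤ) t z,
    A (mk (shiftMatrix k) • t) (toRealGL (shiftMatrix k) • z) = A t z - φ t

theorem exists_normalized_primitive [G.FiniteIndex] (ω : CuspForm (realGroup G) 2) {F : ℂ → ℂ}
    (hF : ∀ z : ℍ, HasDerivAt F (ω z) z) {C : ℝ} (hC : ∀ z : ℍ, ‖ω z‖ * z.im ≤ C)
    (g : GL (Fin 2) ℤ) : ∃ a c D : ℝ, 0 < c ∧ 0 ≤ D ∧ ∀ z : ℍ, 1 / 2 ≤ z.im →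
      |(F (toRealGL g • z : ℍ)).im - a| ≤ D * Real.exp (-c * z.im) := by
  obtain ⟨c, hc, hO⟩ := isBigO_exp_slash ω g
  obtain ⟨D, hD0, hD⟩ := exists_norm_le_exp_of_isBigO (b := 1 / 2) (C := C) (by norm_num) hc
    (fun z => (norm_slash_two_mul_im ω (toRealGL g) z).trans_le (hC _)) hO
  obtain ⟨a, ha⟩ := exists_norm_sub_le_exp (hasDerivAt_slashPrimitive hF (toRealGL g))
    (by norm_num) hc hD0 hD
  refine ⟨a.im, c, D / c, hc, by positivity, fun z hz => ?_⟩
  rw [← im_slashPrimitive, ← Complex.sub_im]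
  exact (Complex.abs_im_le_norm _).trans (ha z hz)

theorem exists_isHeight [G.FiniteIndex] (ω : CuspForm (realGroup G) 2) :
    ∃ A φ C, IsHeight ω A φ C ∧ ∑ t, φ t = 0 := by
  obtain ⟨F, hF⟩ := exists_primitive ω
  obtain ⟨C₀, hC₀⟩ := exists_norm_mul_im_le ω
  have hC₀0 : 0 ≤ C₀ := 
    (mul_nonneg (norm_nonneg (ω UpperHalfPlane.I)) UpperHalfPlane.I.im_pos.le).trans (hC₀ UpperHalfPlane.I)
  have hnorm := fun t : Cosets G => exists_normalized_primitive ω hF hC₀ (cosetRep t)⁻¹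
  choose a c D hc hD0 hD using hnorm
  set A : Cosets G → ℍ → ℝ := fun t z => (F ((toRealGL (cosetRep t))⁻¹ • z : ℍ)).im - a t with hA
  have hAD : ∀ t z, 1 / 2 ≤ z.im → |A t z| ≤ D t * Real.exp (-c t * z.im) := fun t z hz => by
    simpa only [hA, map_inv] using hD t z hz
  have hequiv : ∀ (g : GL (Fin 2) ℤ) t, ∃ e : ℝ, ∀ z, A (mk g • t) (toRealGL g • z) = A t z + e :=
    fun g t => by
      obtain ⟨e, he⟩ := exists_im_primitive_smul_eq_add hF g t
      refine ⟨e + a t - a (mk g • t), fun z => ?_⟩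
      simp only [hA, he z]
      ring
  have hlim : ∀ t (w : ℕ → ℍ), (∀ n, (w n).im = (n : ℝ) + 1) →
      Tendsto (fun n => A t (w n)) atTop (𝓝 0) := fun t w hw => by
    refine squeeze_zero_norm (a := fun n : ℕ => D t * Real.exp (-c t * ((n : ℝ) + 1)))
      (fun n => ?_) ?_
    · rw [Real.norm_eq_abs, ← hw n]
      exact hAD t _ (by rw [hw n]; linarith [n.cast_nonneg (α := ℝ)])
    · have : Tendsto (fun n : ℕ => -c t * ((n : ℝ) + 1)) atTop atBot :=
        (tendsto_atTop_add_const_right _ _ tendsto_natCast_atTop_atTop).const_mul_atTop_of_neg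
          (by linarith [hc t])
      simpa using (Real.tendsto_exp_atBot.comp this).const_mul (D t)
  -- Translations preserve Im, so letting the point go to i∞ in `hequiv` forces the additive
  -- constant to be 0.
  have htrans : ∀ (k : ℤ) t z,
      A (mk (translationMatrix k) • t) (toRealGL (translationMatrix k) • z) = A t z :=
    fun k t z => by
      obtain ⟨e, he⟩ := hequiv (translationMatrix k) t
      let w : ℕ → ℍ := fun n => ⟨⟨0, n + 1⟩, by simp; positivity⟩
      have h1 := hlim (mk (translationMatrix k) • t) (fun n => toRealGL (translationMatrix k) • w n)
        (fun n => im_toRealGL_translationMatrix_smul k (w n))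
      have h2 := (hlim t w fun n => rfl).add_const e
      simp only [he] at h1
      have := tendsto_nhds_unique h1 h2
      rw [he, ← zero_add e, ← this, add_zero]
  -- The inversion fixes i, so its additive constant can be read off there. As a difference along a
  -- permutation of the cosets, φ sums to 0.
  set φ : Cosets G → ℝ := fun t =>
    A t UpperHalfPlane.I - A (mk (shiftMatrix 0) • t) UpperHalfPlane.I with hφ
  have hFc : ∀ γ : GL (Fin 2) ℝ, Continuous fun z : ℍ => (F (γ • z : ℍ)).im := fun γ => by
    have h1 : Continuous fun z : ℍ => F z := continuous_iff_continuousAt.2 fun z =>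
      (hF z).continuousAt.comp UpperHalfPlane.continuous_coe.continuousAt
    exact Complex.continuous_im.comp (h1.comp (continuous_const_smul γ))
  refine ⟨A, φ, C₀ + ∑ t, D t, ⟨fun t => (hFc _).sub continuous_const, fun x₀ τ t => ?_,
    fun t x₀ s => ?_, fun t z hz => ?_, fun k t z => ?_⟩, ?_⟩
  · have := integral_im_mul_deriv_eq_sub hF (CuspFormClass.holo ω).continuous
      (toRealGL (cosetRep t))⁻¹ x₀ τ
    rw [modularSymbol]
    simp only [hA, sub_sub_sub_cancel_right]
    exact this
  · simp only [hA, sub_sub_sub_cancel_right]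
    refine (abs_im_geodesicPoint_sub_le hF hC₀ _ x₀ s).trans ?_
    gcongr
    linarith [Finset.sum_nonneg fun t (_ : t ∈ Finset.univ) => hD0 t]
  · refine (hAD t z hz).trans ?_
    have h1 : Real.exp (-c t * z.im) ≤ 1 := by
      rw [Real.exp_le_one_iff]
      nlinarith [hc t, z.im_pos]
    have h2 : D t ≤ ∑ t, D t := Finset.single_le_sum (fun t _ => hD0 t) (Finset.mem_univ t)
    nlinarith [hD0 t]
  · obtain ⟨e, he⟩ := hequiv (shiftMatrix 0) t
    have hI := he UpperHalfPlane.I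
    rw [toRealGL_shiftMatrix_zero_smul_I] at hI
    rw [← translationMatrix_mul k, map_mul, map_mul, mul_smul, mul_smul, htrans, he]
    simp only [hφ, hI]
    ring
  · simp only [hφ, Finset.sum_sub_distrib]
    rw [sub_eq_zero]
    exact (Equiv.sum_comp (MulAction.toPerm (mk (shiftMatrix 0) : PGL(2, ℤ)))
      (fun t => A t UpperHalfPlane.I)).symm

/-! ### Continued fractions and the return to the horoball -/

section ContinuedFraction

variable {b : ℕ → ℝ} {k : ℕ → ℤ}

/-- The denominators `q₋₁ = 0, q₀ = 1, q₁, …` of the continued fraction with digits `k`. -/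
noncomputable def convergentDenom (k : ℕ → ℤ) : ℕ → ℝ
  | 0 => 0
  | 1 => 1
  | n + 2 => k n * convergentDenom k (n + 1) + convergentDenom k n

theorem convergentDenom_nonneg (hk : ∀ n, 1 ≤ k n) : ∀ n, 0 ≤ convergentDenom k n
  | 0 => le_rfl
  | 1 => zero_le_one
  | n + 2 => by
    have h1 := convergentDenom_nonneg hk n
    have h2 := convergentDenom_nonneg hk (n + 1)
    have h3 : (1 : ℝ) ≤ k n := by exact_mod_cast hk n
    rw [convergentDenom]
    positivity

theorem add_le_convergentDenom (hk : ∀ n, 1 ≤ k n) (n : ℕ) :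
    convergentDenom k (n + 1) + convergentDenom k n ≤ convergentDenom k (n + 2) := by
  have h2 := convergentDenom_nonneg hk (n + 1)
  have h3 : (1 : ℝ) ≤ k n := by exact_mod_cast hk n
  rw [convergentDenom]
  nlinarith

/-- The denominators at least double every two steps. -/
theorem two_pow_le_convergentDenom (hk : ∀ n, 1 ≤ k n) :
    ∀ n, (2 : ℝ) ^ n ≤ 2 * convergentDenom k (n + 1) ^ 2
  | 0 => by norm_num [convergentDenom]
  | 1 => by
    have h := add_le_convergentDenom hk 0
    have h1 : convergentDenom k (0 + 1) + convergentDenom k 0 = 1 := by simp [convergentDenom]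
    rw [h1] at h
    have h2 : (1 : ℝ) ≤ convergentDenom k (1 + 1) := h
    nlinarith
  | n + 2 => by
    have h1 := two_pow_le_convergentDenom hk n
    have h2 := add_le_convergentDenom hk n
    have h3 := add_le_convergentDenom hk (n + 1)
    have h4 := convergentDenom_nonneg hk n
    have h5 := convergentDenom_nonneg hk (n + 1)
    have h6 : 2 * convergentDenom k (n + 1) ≤ convergentDenom k (n + 2 + 1) := by
      have : convergentDenom k (n + 1 + 1) = convergentDenom k (n + 2) := rfl
      have : convergentDenom k (n + 1 + 2) = convergentDenom k (n + 2 + 1) := rfl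
      linarith
    rw [pow_add]
    nlinarith

/-- The classical identity q_n |q_{n-1} β - p_{n-1}| + q_{n-1} |q_n β - p_n| = 1, with products of
orbit points in place of the approximation errors, so that no numerators are needed. -/
theorem convergentDenom_mul_prod_add (hb : ∀ n, b n ≠ 0) (hbk : ∀ n, b (n + 1) = 1 / b n - k n)
    (n : ℕ) : convergentDenom k (n + 1) * ∏ j ∈ Finset.range n, b j +
      convergentDenom k n * ∏ j ∈ Finset.range (n + 1), b j = 1 := by
  induction n with
  | zero => simp [convergentDenom]
  | succ n ih =>
    rw [← ih, Finset.prod_range_succ _ (n + 1), hbk, Finset.prod_range_succ, convergentDenom]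
    have := hb n
    field_simp
    ring

theorem coe_mul_prod_sub (hb : ∀ n, b n ≠ 0) (hbk : ∀ n, b (n + 1) = 1 / b n - k n) {z : ℕ → ℍ}
    {y : ℝ} (hz0 : (z 0 : ℂ) = b 0 + y * Complex.I)
    (hz : ∀ n, (z (n + 1) : ℂ) = ((starRingEnd ℂ) (z n))⁻¹ - k n) (n : ℕ) :
    (z n : ℂ) * ((∏ j ∈ Finset.range n, b j : ℝ) - (convergentDenom k n * y : ℝ) * Complex.I) =
      (∏ j ∈ Finset.range (n + 1), b j : ℝ) + (convergentDenom k (n + 1) * y : ℝ) * Complex.I := by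
  induction n with
  | zero => simp [convergentDenom, hz0]
  | succ n ih =>
    have h1 := congrArg (starRingEnd ℂ) ih
    simp only [map_mul, map_sub, map_add, Complex.conj_ofReal, Complex.conj_I] at h1
    have hz' : (starRingEnd ℂ) (z n : ℂ) ≠ 0 := by simpa using (z n).ne_zero
    have hbn : (b n : ℂ) ≠ 0 := by exact_mod_cast hb n
    have h2 : ((∏ j ∈ Finset.range (n + 2), b j : ℝ) : ℂ) = (∏ j ∈ Finset.range n, b j : ℝ) -
        k n * (∏ j ∈ Finset.range (n + 1), b j : ℝ) := by
      rw [Finset.prod_range_succ _ (n + 1), hbk, Finset.prod_range_succ]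
      push_cast
      field_simp
    have h3 : ((convergentDenom k (n + 2) : ℝ) : ℂ) =
        k n * convergentDenom k (n + 1) + convergentDenom k n := by
      rw [convergentDenom]; push_cast; ring
    have h4 : ((∏ j ∈ Finset.range (n + 1), b j : ℝ) : ℂ) -
        (convergentDenom k (n + 1) * y : ℝ) * Complex.I = (starRingEnd ℂ) (z n : ℂ) *
          ((∏ j ∈ Finset.range n, b j : ℝ) + (convergentDenom k n * y : ℝ) * Complex.I) := by
      linear_combination -h1
    rw [hz, sub_mul, h4, inv_mul_cancel_left₀ hz', ← h4, h2]
    push_cast [h3]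
    ring

/-- Eliminating Re (z n) from the real and imaginary parts of `coe_mul_prod_sub` leaves the identity
`convergentDenom_mul_prod_add`, which plays the role of a determinant. -/
theorem im_mul_eq (hb : ∀ n, b n ≠ 0) (hbk : ∀ n, b (n + 1) = 1 / b n - k n) {z : ℕ → ℍ}
    {y : ℝ} (hz0 : (z 0 : ℂ) = b 0 + y * Complex.I)
    (hz : ∀ n, (z (n + 1) : ℂ) = ((starRingEnd ℂ) (z n))⁻¹ - k n) (n : ℕ) :
    (z n).im * ((∏ j ∈ Finset.range n, b j) ^ 2 + convergentDenom k n ^ 2 * y ^ 2) = y := by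
  have h1 := coe_mul_prod_sub hb hbk hz0 hz n
  have h2 := convergentDenom_mul_prod_add hb hbk n
  set P := ∏ j ∈ Finset.range n, b j
  set P' := ∏ j ∈ Finset.range (n + 1), b j
  set q := convergentDenom k n
  set q' := convergentDenom k (n + 1)
  have hre := congrArg Complex.re h1
  have him := congrArg Complex.im h1
  simp at hre him
  linear_combination P * him + q * y * hre + y * h2

/-- Along the orbit of a vertical geodesic under the shift, the image of the point at height
`y ≤ 1` enters the horoball `Im z ≥ 1/2` after at most `2 log (1/y) + 2` steps. -/
theorem exists_half_le_im (hb0 : ∀ n, 0 < b n) (hbk : ∀ n, b (n + 1) = 1 / b n - k n)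
    (hk : ∀ n, 1 ≤ k n) {z : ℕ → ℍ} {τ : ℝ} (hτ : 0 ≤ τ)
    (hz0 : (z 0 : ℂ) = b 0 + (Real.exp (-τ) : ℝ) * Complex.I)
    (hz : ∀ n, (z (n + 1) : ℂ) = ((starRingEnd ℂ) (z n))⁻¹ - k n) :
    ∃ n : ℕ, (n : ℝ) ≤ 2 * τ + 2 ∧ 1 / 2 ≤ (z n).im := by
  classical
  set y := Real.exp (-τ) with hy
  have hy0 : 0 < y := Real.exp_pos _
  have hy1 : y ≤ 1 := Real.exp_le_one_iff.2 (by linarith)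
  have hbne : ∀ n, b n ≠ 0 := fun n => (hb0 n).ne'
  -- Stop at the first n with q_n² y > 1, where q_n is `convergentDenom k (n + 1)`. Then q_{n-1}² y
  -- ≤ 1, and the product P of the first n orbit points satisfies q_n P ≤ 1, hence P² ≤ y. So the
  -- factor of Im (z n) in `im_mul_eq` is at most 2 y.
  have hex : ∃ n, 1 < convergentDenom k (n + 1) ^ 2 * y := by
    obtain ⟨n, hn⟩ := pow_unbounded_of_one_lt (2 / y) (one_lt_two)
    refine ⟨n, ?_⟩
    have := hn.trans_le (two_pow_le_convergentDenom hk n)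
    rw [div_lt_iff₀ hy0] at this
    linarith
  set n := Nat.find hex with hn
  have h1 : 1 < convergentDenom k (n + 1) ^ 2 * y := Nat.find_spec hex
  obtain ⟨m, hm⟩ : ∃ m, n = m + 1 := Nat.exists_eq_succ_of_ne_zero fun h0 => by
    rw [h0] at h1
    norm_num [convergentDenom] at h1
    linarith
  have h2 : convergentDenom k n ^ 2 * y ≤ 1 := by
    have := Nat.find_min hex (m := m) (by omega)
    rw [hm]
    exact not_lt.1 this
  refine ⟨n, ?_, ?_⟩
  · have h3 := two_pow_le_convergentDenom hk m
    rw [← hm] at h3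
    have h4 : (2 : ℝ) ^ m ≤ 2 * Real.exp τ := by
      have : y * Real.exp τ = 1 := by rw [hy, ← Real.exp_add]; simp
      have : convergentDenom k n ^ 2 ≤ Real.exp τ := by
        have h5 := mul_le_mul_of_nonneg_right h2 (Real.exp_pos τ).le
        rw [mul_assoc, this, mul_one, one_mul] at h5
        exact h5
      linarith
    have h5 := Real.log_le_log (by positivity) h4
    rw [Real.log_pow, Real.log_mul (by norm_num) (Real.exp_pos _).ne', Real.log_exp] at h5
    -- With n = m + 1 one has 2^m ≤ 2 exp τ, and log 2 > 1/2 turns this into m ≤ 2 τ + 1.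
    have h6 : (1 : ℝ) / 2 < Real.log 2 := by linarith [Real.log_two_gt_d9]
    rw [hm]
    push_cast
    by_contra! h7
    nlinarith
  · have h3 := im_mul_eq hbne hbk hz0 hz n
    have h4 := convergentDenom_mul_prod_add hbne hbk n
    set P := ∏ j ∈ Finset.range n, b j with hP
    have hP0 : 0 < P := Finset.prod_pos fun j _ => hb0 j
    have hP'0 : 0 < ∏ j ∈ Finset.range (n + 1), b j := Finset.prod_pos fun j _ => hb0 j
    have hq0 := convergentDenom_nonneg hk n
    have hq0' := convergentDenom_nonneg hk (n + 1)
    have h5 : convergentDenom k (n + 1) * P ≤ 1 := by nlinarith [mul_nonneg hq0 hP'0.le]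
    have h6 : P ^ 2 ≤ y := by
      have h7 : (convergentDenom k (n + 1) * P) ^ 2 ≤ 1 := by
        have := mul_nonneg hq0' hP0.le
        nlinarith
      have h8 : P ^ 2 * 1 ≤ P ^ 2 * (convergentDenom k (n + 1) ^ 2 * y) := by gcongr
      nlinarith
    have h7 : convergentDenom k n ^ 2 * y ^ 2 ≤ y := by nlinarith
    have h8 : (z n).im * (P ^ 2 + convergentDenom k n ^ 2 * y ^ 2) ≤ (z n).im * (2 * y) := by
      have := (z n).im_pos
      gcongr
      linarith
    have h9 : y * 1 ≤ y * (2 * (z n).im) := by linarith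
    have := le_of_mul_le_mul_left h9 hy0
    linarith

end ContinuedFraction

end LimitingModularSymbols

/-! ### Modular symbols and sums along orbits of the shift -/

namespace LimitingModularSymbols

open UpperHalfPlane ModularForm Matrix.ProjGenLinGroup

variable {G : Subgroup PGL(2, ℤ)}

theorem shift_fst_mem_Ioo {p : ℝ × Cosets G} (hp : Irrational p.1) :
    Irrational (shift G p).1 ∧ (shift G p).1 ∈ Ioo (0 : ℝ) 1 := by
  have h1 : Irrational (shift G p).1 := by
    simp only [shift, one_div]
    exact (hp.inv).sub_intCast _
  refine ⟨h1, lt_of_le_of_ne ?_ ?_, ?_⟩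
  · simp only [shift]
    exact Int.fract_nonneg (1 / p.1)
  · intro h
    exact h1 ⟨0, by rw [← h]; simp⟩
  · simp only [shift]
    exact Int.fract_lt_one (1 / p.1)

theorem iterate_shift_fst_mem_Ioo {p : ℝ × Cosets G} (hp : Irrational p.1)
    (hp1 : p.1 ∈ Icc (0 : ℝ) 1) (n : ℕ) :
    Irrational ((shift G)^[n] p).1 ∧ ((shift G)^[n] p).1 ∈ Ioo (0 : ℝ) 1 := by
  induction n with
  | zero =>
    refine ⟨hp, lt_of_le_of_ne hp1.1 fun h => hp ⟨0, ?_⟩, lt_of_le_of_ne hp1.2 fun h => hp ⟨1, ?_⟩⟩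
    · simpa using h
    · simpa using h.symm
  | succ n ih =>
    rw [Function.iterate_succ_apply']
    exact shift_fst_mem_Ioo ih.1

/-- The height of the point at distance `τ` on the geodesic to `β` is, up to a bounded error, a
Birkhoff sum of `φ` over at most `2 τ + 2` steps of the shift. -/
theorem exists_abs_height_sub_sum_le {ω : CuspForm (realGroup G) 2} {A : Cosets G → ℍ → ℝ}
    {φ : Cosets G → ℝ} {C : ℝ} (hA : IsHeight ω A φ C) {p : ℝ × Cosets G} (hp : Irrational p.1)
    (hp1 : p.1 ∈ Icc (0 : ℝ) 1) {z : ℍ} (hre : z.re = p.1) (him : z.im = 1) {τ : ℝ} (hτ : 0 ≤ τ) :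
    ∃ n : ℕ, (n : ℝ) ≤ 2 * τ + 2 ∧
      |A p.2 (geodesicPoint z τ) - ∑ j ∈ Finset.range n, φ ((shift G)^[j] p).2| ≤ C := by
  set P : ℕ → ℝ × Cosets G := fun n => (shift G)^[n] p with hP
  set k : ℕ → ℤ := fun n => ⌊1 / (P n).1⌋ with hk
  have hPs : ∀ n, P (n + 1) = shift G (P n) := fun n => Function.iterate_succ_apply' _ _ _
  -- The point moves along with the orbit of p; each shift peels one value of φ off the height,
  -- until the horoball is reached.
  let w : ℕ → ℍ := fun n => Nat.rec (geodesicPoint z τ)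
    (fun n w => toRealGL (shiftMatrix (k n)) • w) n
  have hw : ∀ n, w (n + 1) = toRealGL (shiftMatrix (k n)) • w n := fun n => rfl
  have hmem := iterate_shift_fst_mem_Ioo hp hp1
  have hsum : ∀ n, A (P n).2 (w n) =
      A p.2 (geodesicPoint z τ) - ∑ j ∈ Finset.range n, φ (P j).2 := fun n => by
    induction n with
    | zero => simp [hP, w]
    | succ n ih =>
      have h1 : (P (n + 1)).2 = mk (shiftMatrix (k n)) • (P n).2 := by rw [hPs]; rfl
      rw [hw, h1, hA.shift_smul, ih, Finset.sum_range_succ]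
      ring
  obtain ⟨n, hn, hn2⟩ := exists_half_le_im (b := fun n => (P n).1) (k := k) (z := w) (τ := τ)
    (fun n => (hmem n).2.1) (fun n => by rw [hPs]; rfl) (fun n => by
      rw [hk, Int.le_floor]
      have h1 := (hmem n).2
      rw [Int.cast_one, le_div_iff₀ h1.1, one_mul]
      exact h1.2.le) hτ (by
      change (geodesicPoint z τ : ℂ) = _
      rw [coe_geodesicPoint, hre, him, one_mul]; rfl) (fun n => by
      rw [hw, coe_toRealGL_shiftMatrix_smul])
  refine ⟨n, hn, ?_⟩
  rw [← hsum]
  exact hA.abs_le _ _ hn2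

end LimitingModularSymbols

/-! ### Hausdorff measure under inverse branches of the Gauss map -/

namespace LimitingModularSymbols

section HausdorffBranch

/-- An inverse branch of the Gauss map. -/
noncomputable def gaussBranch (k : ℕ) (x : ℝ) : ℝ := 1 / (x + k)

theorem gaussBranch_injective (k : ℕ) : Function.Injective (gaussBranch k) := fun x y h => by
  simpa [gaussBranch] using h

theorem measurableEmbedding_gaussBranch (k : ℕ) : MeasurableEmbedding (gaussBranch k) :=
  Measurable.measurableEmbedding (by unfold gaussBranch; fun_prop) (gaussBranch_injective k)

theorem dist_gaussBranch {k : ℕ} (hk : 1 ≤ k) {x y : ℝ} (hx : 0 ≤ x) (hy : 0 ≤ y) :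
    dist (gaussBranch k x) (gaussBranch k y) = dist x y / ((x + k) * (y + k)) := by
  have hk' : (1 : ℝ) ≤ k := by exact_mod_cast hk
  have h1 : 0 < x + k := by linarith
  have h2 : 0 < y + k := by linarith
  rw [Real.dist_eq, Real.dist_eq, gaussBranch, gaussBranch, div_sub_div _ _ h1.ne' h2.ne', abs_div,
    abs_of_pos (mul_pos h1 h2), one_mul, mul_one, add_sub_add_right_eq_sub, abs_sub_comm]

variable {d : ℝ} {k : ℕ}

/-- The branch contracts distances by 1 / ((x + k) (y + k)), at most (a + k)⁻² to the right of a. -/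
theorem hausdorffMeasure_image_gaussBranch_le (hd : 0 ≤ d) (hk : 1 ≤ k) {a : ℝ} (ha : 0 ≤ a)
    {S : Set ℝ} (hS : ∀ x ∈ S, a ≤ x) :
    μH[d] (gaussBranch k '' S) ≤ ENNReal.ofReal ((a + k) ^ (-(2 * d))) * μH[d] S := by
  have hk' : (1 : ℝ) ≤ k := by exact_mod_cast hk
  have h0 : 0 < a + k := by linarith
  have hlip : LipschitzOnWith (Real.toNNReal ((a + k) ^ (-(2 : ℝ)))) (gaussBranch k) S := by
    refine LipschitzOnWith.of_dist_le_mul fun x hx y hy => ?_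
    have h1 := hS x hx
    have h2 := hS y hy
    rw [dist_gaussBranch hk (ha.trans h1) (ha.trans h2),
      Real.coe_toNNReal _ (Real.rpow_nonneg h0.le _), Real.rpow_neg h0.le, Real.rpow_two,
      div_eq_inv_mul]
    gcongr
    nlinarith
  refine (hlip.hausdorffMeasure_image_le hd).trans (le_of_eq ?_)
  congr 1
  rw [← ENNReal.ofReal.eq_1, ENNReal.ofReal_rpow_of_nonneg (Real.rpow_nonneg h0.le _) hd,
    ← Real.rpow_mul h0.le, neg_mul]

/-- The inverse map y ↦ 1 / y - k expands by at most (c + k)² on the image of a set to the left of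
c. -/
theorem le_hausdorffMeasure_image_gaussBranch (hd : 0 ≤ d) (hk : 1 ≤ k) {c : ℝ}
    {S : Set ℝ} (hS : ∀ x ∈ S, 0 ≤ x) (hSc : ∀ x ∈ S, x ≤ c) :
    ENNReal.ofReal ((c + k) ^ (-(2 * d))) * μH[d] S ≤ μH[d] (gaussBranch k '' S) := by
  rcases S.eq_empty_or_nonempty with rfl | ⟨x₀, hx₀⟩
  · simp
  have hk' : (1 : ℝ) ≤ k := by exact_mod_cast hk
  have hc : 0 ≤ c := (hS _ hx₀).trans (hSc _ hx₀)
  have h0 : 0 < c + k := by linarith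
  have hinv : ∀ x, 1 / gaussBranch k x - k = x := fun x => by simp [gaussBranch]
  have hlip : LipschitzOnWith (Real.toNNReal ((c + k) ^ (2 : ℝ))) (fun y => 1 / y - (k : ℝ))
      (gaussBranch k '' S) := by
    refine LipschitzOnWith.of_dist_le_mul ?_
    rintro _ ⟨x, hx, rfl⟩ _ ⟨y, hy, rfl⟩
    have h1 := hS x hx
    have h2 := hS y hy
    have h3 := hSc x hx
    have h4 := hSc y hy
    rw [hinv, hinv, dist_gaussBranch hk h1 h2, Real.coe_toNNReal _ (Real.rpow_nonneg h0.le _),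
      Real.rpow_two, mul_div_assoc', le_div_iff₀ (by positivity), mul_comm]
    gcongr
    nlinarith
  have himg : (fun y => 1 / y - (k : ℝ)) '' (gaussBranch k '' S) = S := by
    rw [image_image]
    simp only [hinv, image_id']
  have h := hlip.hausdorffMeasure_image_le hd
  rw [himg, ← ENNReal.ofReal.eq_1, ENNReal.ofReal_rpow_of_nonneg (Real.rpow_nonneg h0.le _) hd,
    ← Real.rpow_mul h0.le] at h
  calc ENNReal.ofReal ((c + k) ^ (-(2 * d))) * μH[d] S
      ≤ ENNReal.ofReal ((c + k) ^ (-(2 * d))) * (ENNReal.ofReal ((c + k) ^ (2 * d)) *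
        μH[d] (gaussBranch k '' S)) := by gcongr
    _ = μH[d] (gaussBranch k '' S) := by
        rw [← mul_assoc, ← ENNReal.ofReal_mul (Real.rpow_nonneg h0.le _), ← Real.rpow_add h0]
        simp

theorem measure_eq_sum_inter_Ico (m : Measure ℝ) {N : ℕ} (hN : 0 < N) {S : Set ℝ}
    (hSm : MeasurableSet S) (hS : S ⊆ Ico 0 1) :
    m S = ∑ i ∈ Finset.range N, m (S ∩ Ico ((i : ℝ) / N) ((i + 1 : ℝ) / N)) := by
  have hN' : (0 : ℝ) < N := by exact_mod_cast hN
  rw [← measure_biUnion_finset]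
  · congr 1
    ext x
    simp only [mem_iUnion, Finset.mem_range, mem_inter_iff, exists_prop]
    refine ⟨fun hx => ?_, fun ⟨i, _, hx, _⟩ => hx⟩
    have hx1 := hS hx
    have h0 : 0 ≤ x * N := mul_nonneg hx1.1 hN'.le
    refine ⟨⌊x * N⌋₊, ?_, hx, ?_, ?_⟩
    · rw [Nat.floor_lt h0]
      nlinarith [hx1.2]
    · rw [div_le_iff₀ hN']
      exact Nat.floor_le h0
    · rw [lt_div_iff₀ hN']
      exact Nat.lt_floor_add_one _
  · intro i _ j _ hij
    refine Set.disjoint_left.2 fun x hx hx' => hij ?_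
    have h1 := hx.2
    have h2 := hx'.2
    rw [mem_Ico, div_le_iff₀ hN', lt_div_iff₀ hN'] at h1 h2
    have h3 : (i : ℝ) < j + 1 := by linarith
    have h4 : (j : ℝ) < i + 1 := by linarith
    norm_cast at h3 h4
    omega
  · exact fun i _ => hSm.inter measurableSet_Ico

theorem rpow_neg_le_mul_rpow_neg (hd : 0 ≤ d) (hk : 1 ≤ k) {N : ℕ} (hN : 0 < N) {x y : ℝ}
    (hx : 0 ≤ x) (hy : 0 ≤ y) (hyx : y ≤ x + 1 / N) :
    (x + k) ^ (-(2 * d)) ≤ (1 + 1 / (N : ℝ)) ^ (2 * d) * (y + k) ^ (-(2 * d)) := by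
  have hk' : (1 : ℝ) ≤ k := by exact_mod_cast hk
  have hN' : (0 : ℝ) < 1 / N := by positivity
  have h1 : 0 < x + k := by linarith
  have h2 : 0 < y + k := by linarith
  have h3 : (y + k) ^ (2 * d) ≤ (1 + 1 / (N : ℝ)) ^ (2 * d) * (x + k) ^ (2 * d) := by
    rw [← Real.mul_rpow (by positivity) h1.le]
    refine Real.rpow_le_rpow h2.le ?_ (by positivity)
    nlinarith
  rw [Real.rpow_neg h1.le, Real.rpow_neg h2.le, ← div_eq_mul_inv, le_div_iff₀ (by positivity),
    inv_mul_le_iff₀ (by positivity)]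
  exact h3.trans_eq (mul_comm _ _)

/-- **Change of variables for the Hausdorff measure** under an inverse branch of the Gauss map. -/
theorem hausdorffMeasure_image_gaussBranch (hd : 0 ≤ d) (hk : 1 ≤ k) {S : Set ℝ}
    (hSm : MeasurableSet S) (hS : S ⊆ Ico 0 1) :
    μH[d] (gaussBranch k '' S) = ∫⁻ x in S, ENNReal.ofReal ((x + k) ^ (-(2 * d))) ∂μH[d] := by
  have hemb := measurableEmbedding_gaussBranch k
  set m₁ : Measure ℝ := (μH[d] : Measure ℝ).comap (gaussBranch k) with hm₁
  set m₂ : Measure ℝ :=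
    (μH[d] : Measure ℝ).withDensity fun x => ENNReal.ofReal ((x + k) ^ (-(2 * d))) with hm₂
  have hm₁S : ∀ S, m₁ S = μH[d] (gaussBranch k '' S) := fun S => hemb.comap_apply _ _
  have hm₂S : ∀ S, MeasurableSet S →
      m₂ S = ∫⁻ x in S, ENNReal.ofReal ((x + k) ^ (-(2 * d))) ∂μH[d] :=
    fun S hS => withDensity_apply _ hS
  rw [← hm₁S, ← hm₂S S hSm]
  -- Cut [0, 1) into N + 1 intervals. On each, the Lipschitz bounds for the branch and its inverse
  -- compare the two measures up to the factor r N, which tends to 1.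
  set r : ℕ → ℝ≥0∞ := fun N => ENNReal.ofReal ((1 + 1 / ((N : ℝ) + 1)) ^ (2 * d)) with hr
  have hrlim : Tendsto r atTop (𝓝 1) := by
    have h1 : Tendsto (fun N : ℕ => (1 + 1 / ((N : ℝ) + 1)) ^ (2 * d)) atTop (𝓝 1) := by
      have h2 := (tendsto_one_div_add_atTop_nhds_zero_nat (𝕜 := ℝ)).const_add 1
      rw [add_zero] at h2
      have h3 := h2.rpow_const (p := 2 * d) (Or.inl one_ne_zero)
      rwa [Real.one_rpow] at h3
    have h2 := ENNReal.tendsto_ofReal h1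
    rwa [ENNReal.ofReal_one] at h2
  have hpiece : ∀ N i : ℕ, m₁ (S ∩ Ico ((i : ℝ) / (N + 1 : ℕ)) ((i + 1 : ℝ) / (N + 1 : ℕ))) ≤
        r N * m₂ (S ∩ Ico ((i : ℝ) / (N + 1 : ℕ)) ((i + 1 : ℝ) / (N + 1 : ℕ))) ∧
      m₂ (S ∩ Ico ((i : ℝ) / (N + 1 : ℕ)) ((i + 1 : ℝ) / (N + 1 : ℕ))) ≤
        r N * m₁ (S ∩ Ico ((i : ℝ) / (N + 1 : ℕ)) ((i + 1 : ℝ) / (N + 1 : ℕ))) := fun N i => by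
    set S' := S ∩ Ico ((i : ℝ) / (N + 1 : ℕ)) ((i + 1 : ℝ) / (N + 1 : ℕ)) with hS'
    have hS'm : MeasurableSet S' := hSm.inter measurableSet_Ico
    have hi : (0 : ℝ) ≤ (i : ℝ) / (N + 1 : ℕ) := by positivity
    have hi' : (0 : ℝ) ≤ (i + 1 : ℝ) / (N + 1 : ℕ) := by positivity
    have hgap : (i + 1 : ℝ) / (N + 1 : ℕ) = (i : ℝ) / (N + 1 : ℕ) + 1 / (N + 1 : ℕ) := add_div _ _ _
    have hrN : r N = ENNReal.ofReal ((1 + 1 / ((N + 1 : ℕ) : ℝ)) ^ (2 * d)) := by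
      simp [hr]
    have hr0 : (0 : ℝ) ≤ (1 + 1 / ((N + 1 : ℕ) : ℝ)) ^ (2 * d) := by positivity
    rw [hm₁S, hm₂S _ hS'm]
    constructor
    · refine (hausdorffMeasure_image_gaussBranch_le hd hk hi fun x hx => hx.2.1).trans ?_
      rw [hrN, ← lintegral_const_mul' _ _ ENNReal.ofReal_ne_top, ← setLIntegral_const]
      refine setLIntegral_mono' hS'm fun x hx => ?_
      rw [← ENNReal.ofReal_mul hr0]
      refine ENNReal.ofReal_le_ofReal (rpow_neg_le_mul_rpow_neg hd hk N.succ_pos hi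
        (hS hx.1).1 ?_)
      exact hx.2.2.le.trans hgap.le
    · refine le_trans ?_ (mul_le_mul_right (le_hausdorffMeasure_image_gaussBranch hd hk
        (fun x hx => (hS hx.1).1) (fun x hx => hx.2.2.le)) _)
      rw [← mul_assoc, hrN, ← ENNReal.ofReal_mul hr0, ← setLIntegral_const]
      refine setLIntegral_mono' hS'm fun x hx => ENNReal.ofReal_le_ofReal
        (rpow_neg_le_mul_rpow_neg hd hk N.succ_pos (hS hx.1).1 hi' ?_)
      rw [hgap]
      linarith [hx.2.1]
  have hle : ∀ N, m₁ S ≤ r N * m₂ S ∧ m₂ S ≤ r N * m₁ S := fun N => by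
    rw [measure_eq_sum_inter_Ico m₁ N.succ_pos hSm hS, measure_eq_sum_inter_Ico m₂ N.succ_pos hSm hS,
      Finset.mul_sum, Finset.mul_sum]
    exact ⟨Finset.sum_le_sum fun i _ => (hpiece N i).1, Finset.sum_le_sum fun i _ => (hpiece N i).2⟩
  have hlim : ∀ a : ℝ≥0∞, Tendsto (fun N => r N * a) atTop (𝓝 a) := fun a => by
    simpa using ENNReal.Tendsto.mul_const (b := a) hrlim (Or.inl one_ne_zero)
  exact le_antisymm (ge_of_tendsto' (hlim _) fun N => (hle N).1)
    (ge_of_tendsto' (hlim _) fun N => (hle N).2)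

end HausdorffBranch

end LimitingModularSymbols

/-! ### The measure `𝓗^{δ_E}` on cylinders -/

namespace LimitingModularSymbols

open Matrix.ProjGenLinGroup

variable {G : Subgroup PGL(2, ℤ)}

instance : DiscreteMeasurableSpace (Cosets G) := ⟨fun _ => trivial⟩

theorem measurable_branch (k : ℕ) : Measurable (branch G k) := by
  refine Measurable.prodMk ?_ ?_
  · exact measurable_const.div (measurable_fst.add_const _)
  · exact (Measurable.of_discrete (f := fun t : Cosets G => mk (branchMatrix k) • t)).comp
      measurable_snd

theorem measurable_shift [G.FiniteIndex] : Measurable (shift G) := by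
  have h1 : Measurable fun p : ℝ × Cosets G => 1 / p.1 := measurable_const.div measurable_fst
  have h2 : Measurable fun p : ℝ × Cosets G => ⌊1 / p.1⌋ := Int.measurable_floor.comp h1
  have h3 : Measurable fun p : ℝ × Cosets G => ((⌊1 / p.1⌋ : ℤ) : ℝ) :=
    (Measurable.of_discrete (f := fun n : ℤ => (n : ℝ))).comp h2
  have h4 : Measurable fun q : ℤ × Cosets G => mk (shiftMatrix q.1) • q.2 := Measurable.of_discrete
  have h5 : Measurable fun p : ℝ × Cosets G => mk (shiftMatrix ⌊1 / p.1⌋) • p.2 := by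
    have := h4.comp (h2.prodMk measurable_snd)
    simpa only [Function.comp_def] using this
  have h6 := (h1.sub h3).prodMk h5
  exact h6

theorem branchMatrix_mul_shiftMatrix (k : ℕ) : branchMatrix k * shiftMatrix k = 1 := by
  have : shiftMatrix k = (branchMatrix k)⁻¹ := by ext i j; rfl
  rw [this, mul_inv_cancel]

theorem shift_branch {k : ℕ} {p : ℝ × Cosets G} (hp : p.1 ∈ Ioo (0 : ℝ) 1) :
    shift G (branch G k p) = p := by
  have h1 : 1 / (branch G k p).1 = p.1 + k := by simp [branch]
  have h2 : ⌊1 / (branch G k p).1⌋ = k := by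
    rw [h1, Int.floor_add_natCast, Int.floor_eq_zero_iff.2 ⟨hp.1.le, hp.2⟩, zero_add]
  have h3 : shiftMatrix k * branchMatrix k = 1 := mul_eq_one_comm.1 (branchMatrix_mul_shiftMatrix k)
  refine Prod.ext ?_ ?_
  · simp only [shift]
    rw [h2, h1]
    simp
  · simp only [shift]
    rw [h2]
    simp only [branch]
    rw [smul_smul, ← map_mul, h3, map_one, one_smul]

variable {B : Set ℝ} {E : Set (ℝ × Cosets G)}

theorem hausdorffOn_eq_sum [G.FiniteIndex] (hBm : MeasurableSet B) (hE : E = B ×ˢ univ) :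
    hausdorffOn E = Measure.sum fun t : Cosets G =>
      ((μH[hausdorffDim E] : Measure ℝ).restrict B).map fun x => (x, t) := by
  have hEm : MeasurableSet E := by rw [hE]; exact hBm.prod MeasurableSet.univ
  rw [hausdorffOn, sheetHausdorff, Measure.restrict_sum _ hEm]
  congr 1
  ext1 t
  rw [Measure.restrict_map measurable_prodMk_right hEm]
  congr 2
  rw [hE]
  ext x
  simp

theorem lintegral_hausdorffOn [G.FiniteIndex] (hBm : MeasurableSet B) (hE : E = B ×ˢ univ)
    {F : ℝ × Cosets G → ℝ≥0∞} (hF : Measurable F) :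
    ∫⁻ p, F p ∂(hausdorffOn E) = ∑ t, ∫⁻ x in B, F (x, t) ∂μH[hausdorffDim E] := by
  rw [hausdorffOn_eq_sum hBm hE, lintegral_sum_measure, tsum_fintype]
  refine Finset.sum_congr rfl fun t _ => ?_
  rw [lintegral_map hF measurable_prodMk_right]

theorem hausdorffOn_apply [G.FiniteIndex] (hBm : MeasurableSet B) (hE : E = B ×ˢ univ)
    {S : Set (ℝ × Cosets G)} (hS : MeasurableSet S) :
    hausdorffOn E S = ∑ t, μH[hausdorffDim E] {x | x ∈ B ∧ (x, t) ∈ S} := by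
  rw [hausdorffOn_eq_sum hBm hE, Measure.sum_apply _ hS, tsum_fintype]
  refine Finset.sum_congr rfl fun t _ => ?_
  rw [Measure.map_apply measurable_prodMk_right hS,
    Measure.restrict_apply (measurable_prodMk_right hS)]
  congr 1
  ext x
  simp [and_comm]

/-- The set on which the first digit is `k` (up to end points). -/
def cylinder (G : Subgroup PGL(2, ℤ)) (k : ℕ) : Set (ℝ × Cosets G) :=
  {p | p.1 ∈ Ioo (1 / ((k : ℝ) + 1)) (1 / (k : ℝ))}

/-- The domain of the inverse branch with digit `k`, as a map into `E`. -/
def branchDomain (E : Set (ℝ × Cosets G)) (k : ℕ) : Set (ℝ × Cosets G) :=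
  {p | p.1 ∈ Ioo (0 : ℝ) 1 ∧ branch G k p ∈ E}

theorem measurableSet_cylinder (k : ℕ) : MeasurableSet (cylinder G k) :=
  measurable_fst measurableSet_Ioo

theorem measurableSet_branchDomain (hE : MeasurableSet E) (k : ℕ) :
    MeasurableSet (branchDomain E k) :=
  (measurable_fst measurableSet_Ioo).inter (measurable_branch k hE)

theorem floor_of_mem_cylinder {k : ℕ} (hk : 1 ≤ k) {y : ℝ}
    (hy : y ∈ Ioo (1 / ((k : ℝ) + 1)) (1 / (k : ℝ))) :
    ⌊1 / y⌋ = k ∧ 1 / y - k ∈ Ioo (0 : ℝ) 1 := by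
  have hk' : (0 : ℝ) < k := by exact_mod_cast hk
  have hy0 : 0 < y := lt_trans (by positivity) hy.1
  have h1 : (k : ℝ) < 1 / y := by
    rw [lt_div_iff₀ hy0, ← lt_div_iff₀' hk']
    exact hy.2
  have h2 : 1 / y < k + 1 := by
    rw [div_lt_iff₀ hy0, ← div_lt_iff₀' (by positivity)]
    exact hy.1
  refine ⟨?_, by linarith, by linarith⟩
  rw [Int.floor_eq_iff]
  exact ⟨by exact_mod_cast h1.le, by exact_mod_cast h2⟩

theorem gaussBranch_mem_Ioo {k : ℕ} (hk : 1 ≤ k) {x : ℝ} (hx : x ∈ Ioo (0 : ℝ) 1) :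
    gaussBranch k x ∈ Ioo (1 / ((k : ℝ) + 1)) (1 / (k : ℝ)) := by
  have hk' : (0 : ℝ) < k := by exact_mod_cast hk
  have := hx.1
  have := hx.2
  constructor <;> rw [gaussBranch] <;> apply one_div_lt_one_div_of_lt <;> linarith

/-- On the cylinder the branch inverts the shift, and the density is its Jacobian. Shift invariance
brings points of E in the cylinder from points of E; a branch may leave E, whence `branchDomain`.
The branch permutes the sheets, over which E has equal slices. -/
theorem restrict_cylinder_eq_map [G.FiniteIndex] (hBm : MeasurableSet B) (hE : E = B ×ˢ univ)
    (hT : ShiftInvariant E) {k : ℕ} (hk : 1 ≤ k) :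
    (hausdorffOn E).restrict (cylinder G k) =
      (((hausdorffOn E).restrict (branchDomain E k)).withDensity
        fun p => ENNReal.ofReal ((p.1 + k) ^ (-(2 * hausdorffDim E)))).map (branch G k) := by
  set d := hausdorffDim E with hd
  have hd0 : 0 ≤ d := ENNReal.toReal_nonneg
  have hEm : MeasurableSet E := by rw [hE]; exact hBm.prod MeasurableSet.univ
  have hDm := measurableSet_branchDomain hEm k
  have hρ : Measurable fun p : ℝ × Cosets G => ENNReal.ofReal ((p.1 + k) ^ (-(2 * d))) :=
    ENNReal.measurable_ofReal.comp ((measurable_fst.add_const _).pow_const _)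
  ext S hS
  have hSb := measurable_branch (G := G) k hS
  rw [Measure.restrict_apply hS, hausdorffOn_apply hBm hE (hS.inter (measurableSet_cylinder k)),
    Measure.map_apply (measurable_branch k) hS, withDensity_apply _ hSb,
    Measure.restrict_restrict hSb, ← lintegral_indicator (hSb.inter hDm),
    lintegral_hausdorffOn hBm hE (hρ.indicator (hSb.inter hDm)),
    ← Equiv.sum_comp (MulAction.toPerm (mk (branchMatrix k) : PGL(2, ℤ)))]
  refine Finset.sum_congr rfl fun t _ => ?_
  have hAm : MeasurableSet ((fun x : ℝ => (x, t)) ⁻¹' (branch G k ⁻¹' S ∩ branchDomain E k)) :=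
    measurable_prodMk_right (hSb.inter hDm)
  have hind : (fun x : ℝ => (branch G k ⁻¹' S ∩ branchDomain E k).indicator
      (fun p => ENNReal.ofReal ((p.1 + k) ^ (-(2 * d)))) (x, t)) =
      ((fun x : ℝ => (x, t)) ⁻¹' (branch G k ⁻¹' S ∩ branchDomain E k)).indicator
        fun x => ENNReal.ofReal ((x + k) ^ (-(2 * d))) := by
    ext x; rfl
  rw [hind, lintegral_indicator hAm, Measure.restrict_restrict hAm,
    ← hausdorffMeasure_image_gaussBranch hd0 hk (hAm.inter hBm)
      (fun x hx => ⟨hx.1.2.1.1.le, hx.1.2.1.2⟩)]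
  congr 1
  have hEB : ∀ p : ℝ × Cosets G, p ∈ E ↔ p.1 ∈ B := fun p => by rw [hE]; simp
  ext y
  constructor
  · rintro ⟨hyB, hyS, hyC⟩
    obtain ⟨h1, h2⟩ := floor_of_mem_cylinder hk hyC
    have h3 : gaussBranch k (1 / y - k) = y := by simp [gaussBranch]
    have h4 : branch G k (1 / y - k, t) = (y, mk (branchMatrix k) • t) :=
      Prod.ext h3 rfl
    have h5 := (hEB _).1 (hT ((hEB (y, t)).2 hyB))
    simp only [shift, h1] at h5
    refine ⟨1 / y - k, ⟨⟨?_, h2, ?_⟩, by exact_mod_cast h5⟩, h3⟩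
    · rw [mem_preimage, h4]; exact hyS
    · rw [h4, hEB]; exact hyB
  · rintro ⟨x, ⟨⟨hxS, hx1, hxE⟩, hxB⟩, rfl⟩
    exact ⟨(hEB _).1 hxE, hxS, gaussBranch_mem_Ioo hk hx1⟩

theorem integral_cylinder [G.FiniteIndex] (hBm : MeasurableSet B) (hE : E = B ×ˢ univ)
    (hT : ShiftInvariant E) {k : ℕ} (hk : 1 ≤ k) {ψ f : ℝ × Cosets G → ℝ}
    (hint : Integrable (fun p => ψ (shift G p) * f p) (hausdorffOn E)) :
    Integrable ((branchDomain E k).indicator fun p =>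
        ψ p * ((p.1 + k) ^ (-(2 * hausdorffDim E)) * f (branch G k p))) (hausdorffOn E) ∧
      ∫ p, (branchDomain E k).indicator (fun p =>
        ψ p * ((p.1 + k) ^ (-(2 * hausdorffDim E)) * f (branch G k p))) p ∂(hausdorffOn E) =
      ∫ p in cylinder G k, ψ (shift G p) * f p ∂(hausdorffOn E) := by
  set d := hausdorffDim E with hd
  have hEm : MeasurableSet E := by rw [hE]; exact hBm.prod MeasurableSet.univ
  have hDm := measurableSet_branchDomain hEm k
  have hρ : Measurable fun p : ℝ × Cosets G => ENNReal.ofReal ((p.1 + k) ^ (-(2 * d))) :=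
    ENNReal.measurable_ofReal.comp ((measurable_fst.add_const _).pow_const _)
  have hrest := restrict_cylinder_eq_map hBm hE hT hk
  have hi := hint.restrict (s := cylinder G k)
  have hk' : (1 : ℝ) ≤ k := by exact_mod_cast hk
  have hcongr : ∀ p ∈ branchDomain E k,
      (ENNReal.ofReal ((p.1 + k) ^ (-(2 * d)))).toReal •
        (ψ (shift G (branch G k p)) * f (branch G k p)) =
      ψ p * ((p.1 + k) ^ (-(2 * d)) * f (branch G k p)) := fun p hp => by
    rw [shift_branch hp.1, ENNReal.toReal_ofReal (Real.rpow_nonneg (by linarith [hp.1.1]) _),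
      smul_eq_mul]
    ring
  rw [hrest] at hi
  have hi2 := (integrable_map_measure hi.aestronglyMeasurable
    (measurable_branch k).aemeasurable).1 hi
  rw [integrable_withDensity_iff_integrable_smul' hρ
    (Eventually.of_forall fun _ => ENNReal.ofReal_lt_top)] at hi2
  constructor
  · rw [integrable_indicator_iff hDm]
    refine (integrableOn_congr_fun (fun p hp => ?_) hDm).1 hi2
    exact hcongr p hp
  · rw [integral_indicator hDm, hrest, integral_map (measurable_branch k).aemeasurable
      hi.aestronglyMeasurable, integral_withDensity_eq_integral_toReal_smul hρ
      (Eventually.of_forall fun _ => ENNReal.ofReal_lt_top)]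
    exact (setIntegral_congr_fun hDm hcongr).symm

end LimitingModularSymbols

/-! ### The Gauss–Kuzmin operator as the adjoint of the shift -/

namespace LimitingModularSymbols

open Matrix.ProjGenLinGroup

variable {G : Subgroup PGL(2, ℤ)} {B : Set ℝ} {E : Set (ℝ × Cosets G)}

theorem ae_hausdorffOn_mem (hE : MeasurableSet E) : ∀ᵐ p ∂(hausdorffOn E), p ∈ E :=
  ae_restrict_mem hE

theorem pairwise_disjoint_cylinder :
    Pairwise (Function.onFun Disjoint fun j : ℕ => cylinder G (j + 1)) := by
  intro i j hij
  refine Set.disjoint_left.2 fun p hp hp' => hij ?_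
  have h1 := (floor_of_mem_cylinder (by omega) hp).1
  have h2 := (floor_of_mem_cylinder (by omega) hp').1
  rw [h1] at h2
  have : i + 1 = j + 1 := by exact_mod_cast h2
  omega

theorem mem_iUnion_cylinder {p : ℝ × Cosets G} (hp : Irrational p.1) (h01 : p.1 ∈ Icc (0 : ℝ) 1) :
    p ∈ ⋃ j : ℕ, cylinder G (j + 1) := by
  have h0 : 0 < p.1 := lt_of_le_of_ne h01.1 fun h => hp ⟨0, by simpa using h⟩
  have hinv : Irrational (1 / p.1) := by rw [one_div]; exact hp.inv
  have h1 : 1 ≤ 1 / p.1 := by rw [le_div_iff₀ h0, one_mul]; exact h01.2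
  obtain ⟨j, hj⟩ : ∃ j, ⌊1 / p.1⌋₊ = j + 1 :=
    Nat.exists_eq_succ_of_ne_zero (Nat.one_le_iff_ne_zero.1 (Nat.le_floor (by exact_mod_cast h1)))
  have h2 := Nat.floor_le (by positivity : 0 ≤ 1 / p.1)
  have h3 := Nat.lt_floor_add_one (1 / p.1)
  rw [hj] at h2 h3
  have h2' : ((j + 1 : ℕ) : ℝ) < 1 / p.1 := lt_of_le_of_ne h2 fun h => hinv ⟨(j + 1 : ℕ), by
    rw [← h]; simp⟩
  refine mem_iUnion.2 ⟨j, ?_, ?_⟩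
  · rw [div_lt_iff₀ (by positivity), ← div_lt_iff₀' h0]
    exact h3
  · rw [lt_div_iff₀ (by positivity), ← lt_div_iff₀' h0]
    exact h2'

/-- The transfer operator is the adjoint of composition with the shift. -/
theorem integral_comp_shift_mul [G.FiniteIndex] (hB : B ⊆ Icc 0 1) (hBm : MeasurableSet B)
    (hE : E = B ×ˢ univ) (hT : ShiftInvariant E)
    (hrat : ∀ᵐ p ∂(hausdorffOn E), Irrational p.1) {ψ f g : ℝ × Cosets G → ℝ}
    (hψ : Measurable ψ) {M : ℝ} (hM : ∀ p, |ψ p| ≤ M) (hf : Integrable f (hausdorffOn E))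
    (hfg : IsGaussKuzmin E (2 * hausdorffDim E) f g) :
    ∫ p, ψ (shift G p) * f p ∂(hausdorffOn E) = ∫ p, ψ p * g p ∂(hausdorffOn E) := by
  set d := hausdorffDim E with hd
  have hEm : MeasurableSet E := by rw [hE]; exact hBm.prod MeasurableSet.univ
  have hEB : ∀ p : ℝ × Cosets G, p ∈ E ↔ p.1 ∈ B := fun p => by rw [hE]; simp
  have hint : Integrable (fun p => ψ (shift G p) * f p) (hausdorffOn E) :=
    hf.bdd_mul (hψ.comp measurable_shift).aestronglyMeasurable (c := M)
      (Eventually.of_forall fun p => hM _)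
  set F : (ℝ × Cosets G → ℝ) → (ℝ × Cosets G → ℝ) → ℕ → ℝ × Cosets G → ℝ := fun ψ f j =>
    (branchDomain E (j + 1)).indicator fun p =>
      ψ p * ((p.1 + (j + 1 : ℕ)) ^ (-(2 * d)) * f (branch G (j + 1) p)) with hF
  have hcyl := fun j : ℕ => integral_cylinder hBm hE hT (k := j + 1) (by omega) hint
  -- The same cylinder identities for |ψ| and |f| give the absolute summability that allows sum and
  -- integral to be exchanged.
  have hint' : Integrable (fun p => |ψ (shift G p)| * |f p|) (hausdorffOn E) := by
    simpa [abs_mul] using hint.abs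
  have hcyl' := fun j : ℕ => integral_cylinder hBm hE hT (k := j + 1) (ψ := fun p => |ψ p|)
    (f := fun p => |f p|) (by omega) hint'
  have hnorm : ∀ j p, ‖F ψ f j p‖ = F (fun p => |ψ p|) (fun p => |f p|) j p := fun j p => by
    simp only [hF, norm_indicator_eq_indicator_norm]
    by_cases hp : p ∈ branchDomain E (j + 1)
    · have h0 : (0 : ℝ) ≤ (p.1 + (j + 1 : ℕ)) ^ (-(2 * d)) :=
        Real.rpow_nonneg (by have := hp.1.1; positivity) _
      rw [indicator_of_mem hp, indicator_of_mem hp, norm_mul, norm_mul, Real.norm_eq_abs,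
        Real.norm_of_nonneg h0, Real.norm_eq_abs]
    · rw [indicator_of_notMem hp, indicator_of_notMem hp]
  have hsum := fun {Φ : ℝ × Cosets G → ℝ} (hΦ : Integrable Φ (hausdorffOn E)) =>
    hasSum_integral_iUnion (f := Φ) (μ := hausdorffOn E)
      (fun j : ℕ => measurableSet_cylinder (G := G) (j + 1)) pairwise_disjoint_cylinder
      hΦ.integrableOn
  have hmem : ∀ᵐ p ∂(hausdorffOn E), p ∈ ⋃ j : ℕ, cylinder G (j + 1) := by
    filter_upwards [hrat, ae_hausdorffOn_mem hEm] with p hp hpE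
    exact mem_iUnion_cylinder hp (hB ((hEB p).1 hpE))
  have h1 := hasSum_integral_of_summable_integral_norm (F := F ψ f) (fun j => (hcyl j).1) (by
    simp only [hnorm]
    refine (hsum hint').summable.congr fun j => ?_
    exact (hcyl' j).2.symm)
  have h2 : HasSum (fun j => ∫ p, F ψ f j p ∂(hausdorffOn E))
      (∫ p, ψ (shift G p) * f p ∂(hausdorffOn E)) := by
    have h3 := hsum hint
    rw [Measure.restrict_eq_self_of_ae_mem hmem] at h3
    have h4 : (fun j => ∫ p, F ψ f j p ∂(hausdorffOn E)) =
        fun j : ℕ => ∫ p in cylinder G (j + 1), ψ (shift G p) * f p ∂(hausdorffOn E) :=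
      funext fun j => (hcyl j).2
    rw [h4]
    exact h3
  rw [h2.unique h1]
  refine integral_congr_ae ?_
  filter_upwards [hrat, ae_hausdorffOn_mem hEm, hfg] with p hp hpE hpg
  have hp01 := hB ((hEB p).1 hpE)
  have hp0 : 0 < p.1 := lt_of_le_of_ne hp01.1 fun h => hp ⟨0, by simpa using h⟩
  have hp1 : p.1 < 1 := lt_of_le_of_ne hp01.2 fun h => hp ⟨1, by simpa using h.symm⟩
  -- Summing over all k instead of `digits E` adds only zeros: a branch with k ≥ 1 that lands in E
  -- witnesses a digit, and 1 / x > 1 excludes k = 0.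
  have h4 : HasSum (fun k : ℕ => (p.1 + k) ^ (-(2 * d)) * E.indicator f (branch G k p)) (g p) := by
    have h5 := (hasSum_subtype_iff_indicator (s := digits E)
      (f := fun k : ℕ => (p.1 + k) ^ (-(2 * d)) * E.indicator f (branch G k p))).1 hpg
    rwa [indicator_eq_self.2] at h5
    intro k hk
    by_contra hkd
    refine hk ?_
    have h6 : branch G k p ∉ E := fun hbE => by
      rcases Nat.eq_zero_or_pos k with rfl | hkpos
      · have h7 := (hB ((hEB _).1 hbE)).2
        simp only [branch, Nat.cast_zero, add_zero] at h7
        rw [div_le_iff₀ hp0] at h7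
        linarith
      · have h7 := gaussBranch_mem_Ioo hkpos ⟨hp0, hp1⟩
        exact hkd ⟨hkpos, _, hbE, h7.1.le, h7.2.le⟩
    simp only [indicator_of_notMem h6, mul_zero]
  have h5 : HasSum (fun j => F ψ f j p) (ψ p * g p) := by
    have h6 := (hasSum_nat_add_iff' 1).2 (h4.mul_left (ψ p))
    have h7 : branch G 0 p ∉ E := fun hbE => by
      have h7 := (hB ((hEB _).1 hbE)).2
      simp only [branch, Nat.cast_zero, add_zero] at h7
      rw [div_le_iff₀ hp0] at h7
      linarith
    rw [Finset.sum_range_one, indicator_of_notMem h7, mul_zero, mul_zero, sub_zero] at h6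
    have h8 : (fun j => F ψ f j p) = fun j : ℕ => ψ p * ((p.1 + (j + 1 : ℕ)) ^ (-(2 * d)) *
        E.indicator f (branch G (j + 1) p)) := funext fun j => ?_
    · rw [h8]
      exact h6
    simp only [hF]
    by_cases hb : branch G (j + 1) p ∈ E
    · rw [indicator_of_mem (show p ∈ branchDomain E (j + 1) from ⟨⟨hp0, hp1⟩, hb⟩),
        indicator_of_mem hb]
    · rw [indicator_of_notMem (fun h : p ∈ branchDomain E (j + 1) => hb h.2),
        indicator_of_notMem hb, mul_zero, mul_zero]
  exact h5.tsum_eq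

end LimitingModularSymbols

/-! ### Cones of functions; rational points are negligible -/

namespace LimitingModularSymbols

open Matrix.ProjGenLinGroup

section Cone

variable {V : Type*} [NormedAddCommGroup V] [NormedSpace ℝ V] {G : Subgroup PGL(2, ℤ)}
  {E : Set (ℝ × Cosets G)} {I : Set ℝ} {res : V →ₗ[ℝ] (ℝ × Cosets G → ℝ)} {L : ℝ → V →L[ℝ] V}
  {K : ProperCone ℝ V}

/-- As an order unit, u dominates every function of the space pointwise on E. -/
theorem exists_abs_res_le (hK : ∀ f ∈ K, ∀ p ∈ E, 0 ≤ res f p) {u : V}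
    (hu : u ∈ interior (K : Set V)) :
    ∃ C : ℝ, 0 < C ∧ ∀ f, ∀ p ∈ E, |res f p| ≤ C * ‖f‖ * res u p := by
  obtain ⟨C, hC, h⟩ := exists_pos_smul_sub_mem_of_mem_interior hu
  refine ⟨C, hC, fun f p hp => abs_le.2 ⟨?_, ?_⟩⟩
  · have h1 := hK _ (h (-f) (C * ‖f‖) (by rw [norm_neg])) p hp
    simp only [map_sub, map_smul, map_neg, Pi.sub_apply, Pi.smul_apply, Pi.neg_apply,
      smul_eq_mul] at h1
    linarith
  · have h1 := hK _ (h f (C * ‖f‖) le_rfl) p hp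
    simp only [map_sub, map_smul, Pi.sub_apply, Pi.smul_apply, smul_eq_mul] at h1
    linarith

/-- The indicator of S is orthogonal to a dense subset of L². -/
theorem measure_eq_zero_of_forall_res_eq_zero (hS : IsGSTSpace E I res L)
    (hfin : hausdorffOn E univ ≠ ∞) {S : Set (ℝ × Cosets G)} (hSm : MeasurableSet S)
    (h : ∀ f, ∀ᵐ p ∂(hausdorffOn E), p ∈ S → res f p = 0) : hausdorffOn E S = 0 := by
  have hSfin : hausdorffOn E S ≠ ∞ := ne_top_of_le_ne_top hfin (measure_mono (subset_univ _))
  have h1 : indicatorConstLp 2 hSm hSfin (1 : ℝ) = 0 := by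
    refine hS.dense.eq_zero_of_inner_left ℝ fun {v} hv => ?_
    obtain ⟨f, rfl⟩ := hv
    rw [L2.inner_indicatorConstLp_one]
    rw [← integral_indicator hSm]
    refine integral_eq_zero_of_ae ?_
    filter_upwards [h f, (hS.memLp f).coeFn_toLp] with p hp hp'
    by_cases hpS : p ∈ S
    · rw [indicator_of_mem hpS, hp', hp hpS]; rfl
    · rw [indicator_of_notMem hpS]; rfl
  have h2 := norm_indicatorConstLp (p := 2) (c := (1 : ℝ)) (hs := hSm) (hμs := hSfin)
    (by norm_num) (by norm_num)
  rw [h1, norm_zero, norm_one, one_mul, eq_comm, Real.rpow_eq_zero measureReal_nonneg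
    (by norm_num), measureReal_eq_zero_iff hSfin] at h2
  exact h2

theorem pow_mul_apply_sub_mem {L : V →L[ℝ] V} (hL : ∀ f ∈ K, L f ∈ K) {u : V} {k : ℕ} {a : ℝ}
    (ha : 0 ≤ a) (h : (L ^ k) u - a • u ∈ K) (m : ℕ) : (L ^ (k * m)) u - a ^ m • u ∈ K := by
  induction m with
  | zero => rw [mul_zero, pow_zero, pow_zero, one_smul, one_apply_eq_self,
      sub_self]; exact K.zero_mem
  | succ m ih =>
    have h1 : (L ^ (k * (m + 1))) u - a ^ (m + 1) • u =
        (L ^ k) ((L ^ (k * m)) u - a ^ m • u) + a ^ m • ((L ^ k) u - a • u) := by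
      rw [map_sub, map_smul, ← mul_apply_eq_comp, ← pow_add,
        smul_sub, smul_smul, ← pow_succ, Nat.mul_succ, add_comm k]
      abel
    rw [h1]
    exact K.add_mem (pow_apply_mem_of_mapsTo hL k ih) (K.smul_mem h (pow_nonneg ha m))

end Cone

variable {G : Subgroup PGL(2, ℤ)} {B : Set ℝ} {E : Set (ℝ × Cosets G)}

instance : Nonempty (Cosets G) := ⟨(QuotientGroup.mk 1 : PGL(2, ℤ) ⧸ G)⟩

/-! ### Rational points in dimension zero -/

section Zero

theorem hausdorffOn_singleton [G.FiniteIndex] (hBm : MeasurableSet B) (hE : E = B ×ˢ univ)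
    (h0 : hausdorffDim E = 0) {p : ℝ × Cosets G} (hp : p ∈ E) : 1 ≤ hausdorffOn E {p} := by
  rw [hausdorffOn_apply hBm hE (measurableSet_singleton p), h0]
  refine le_trans ?_ (Finset.single_le_sum (f := fun t => μH[0] {x | x ∈ B ∧ (x, t) ∈ ({p} : Set _)})
    (fun _ _ => zero_le) (Finset.mem_univ p.2))
  have h1 : {x | x ∈ B ∧ (x, p.2) ∈ ({p} : Set (ℝ × Cosets G))} = {p.1} := by
    ext x
    simp only [mem_ofPred_eq, mem_singleton_iff, Prod.ext_iff, and_true]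
    refine ⟨fun h => h.2, fun h => ⟨?_, h⟩⟩
    rw [hE] at hp
    rw [h]
    exact hp.1
  simp only [h1, Measure.hausdorffMeasure_zero_singleton, le_refl]

/-- In dimension zero every point of E is an atom, so almost everywhere means everywhere on E. -/
theorem of_ae_hausdorffOn [G.FiniteIndex] (hBm : MeasurableSet B) (hE : E = B ×ˢ univ)
    (h0 : hausdorffDim E = 0) {P : ℝ × Cosets G → Prop} (hP : ∀ᵐ p ∂(hausdorffOn E), P p)
    {p : ℝ × Cosets G} (hp : p ∈ E) : P p := by
  by_contra hn
  have h1 : hausdorffOn E {p} ≤ 0 := by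
    rw [← (ae_iff.1 hP)]
    exact measure_mono (by simpa using hn)
  exact absurd ((hausdorffOn_singleton hBm hE h0 hp).trans h1) (by simp)

theorem finite_of_hausdorffDim_eq_zero [G.FiniteIndex] (hBm : MeasurableSet B)
    (hE : E = B ×ˢ univ) (h0 : hausdorffDim E = 0) (hfin : hausdorffOn E univ ≠ ∞) : B.Finite := by
  by_contra hinf
  obtain ⟨n, hn⟩ := ENNReal.exists_nat_gt hfin
  obtain ⟨s, hs, hcard⟩ := Set.Infinite.exists_subset_card_eq hinf n
  refine hn.not_ge ?_
  rw [hausdorffOn_apply hBm hE MeasurableSet.univ, h0]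
  refine le_trans ?_ (Finset.single_le_sum
    (f := fun t : Cosets G => μH[0] {x | x ∈ B ∧ (x, t) ∈ univ})
    (fun _ _ => zero_le) (Finset.mem_univ (Classical.arbitrary (Cosets G))))
  refine le_trans ?_ (measure_mono (s := (s : Set ℝ)) fun x hx => ⟨hs hx, trivial⟩)
  rw [← sum_measure_singleton]
  simp [hcard]

/-- On rationals the shift is the Euclidean algorithm a / b ↦ (b mod a) / a, which ends at 0. -/
theorem zero_mem_of_rational_mem (hE : E = B ×ˢ univ) (hT : ShiftInvariant E) :
    ∀ a b : ℕ, 0 < b → (a : ℝ) / b ∈ B → (0 : ℝ) ∈ B := by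
  intro a
  induction a using Nat.strong_induction_on with
  | _ a ih =>
    intro b hb hab
    rcases Nat.eq_zero_or_pos a with rfl | ha
    · simpa using hab
    · have h1 : ((a : ℝ) / b, Classical.arbitrary (Cosets G)) ∈ E := by
        rw [hE]; exact ⟨hab, trivial⟩
      have h2 := hT h1
      rw [hE] at h2
      have h3 : (1 / ((a : ℝ) / b) - ⌊1 / ((a : ℝ) / b)⌋ : ℝ) ∈ B := h2.1
      have h4 : (1 / ((a : ℝ) / b) - ⌊1 / ((a : ℝ) / b)⌋ : ℝ) = ((b % a : ℕ) : ℝ) / a := by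
        have h5 : 1 / ((a : ℝ) / b) = (b % a : ℕ) / a + (b / a : ℕ) := by
          have h6 : ((a * (b / a) + b % a : ℕ) : ℝ) = b := by rw [Nat.div_add_mod]
          have ha' : (a : ℝ) ≠ 0 := by exact_mod_cast ha.ne'
          rw [one_div_div, eq_comm, ← h6]
          field_simp
          push_cast
          ring
        have h7 : ⌊((b % a : ℕ) : ℝ) / a⌋ = 0 := by
          rw [Int.floor_eq_zero_iff]
          refine ⟨by positivity, ?_⟩
          rw [div_lt_one (by exact_mod_cast ha)]
          exact_mod_cast Nat.mod_lt b ha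
        rw [h5, Int.floor_add_natCast, h7, zero_add, Int.cast_natCast, add_sub_cancel_right]
      rw [h4] at h3
      exact ih _ (Nat.mod_lt b ha) a ha h3

theorem eq_zero_of_isGaussKuzmin [G.FiniteIndex] (hBm : MeasurableSet B)
    (hE : E = B ×ˢ univ) (h0 : hausdorffDim E = 0) {f g : ℝ × Cosets G → ℝ}
    (hfg : IsGaussKuzmin E (2 * hausdorffDim E) f g) {p : ℝ × Cosets G} (hp : p ∈ E)
    (h : ∀ k ∈ digits E, branch G k p ∈ E → f (branch G k p) = 0) : g p = 0 := by
  have h1 := of_ae_hausdorffOn hBm hE h0 hfg hp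
  refine h1.unique ?_
  convert hasSum_zero with k
  by_cases hk : branch G k p ∈ E
  · rw [indicator_of_mem hk, h k k.2 hk, mul_zero]
  · rw [indicator_of_notMem hk, mul_zero]

/-- Inverse branches raise denominators and B is finite, so a fixed power of the operator kills all
values at (0, t). As T^k u ≥ a u for some k, a > 0 (unless u = 0), also u vanishes there, and with u
every function of the space, against density at an atom. -/
theorem zero_notMem [G.FiniteIndex] (hBm : MeasurableSet B)
    (hE : E = B ×ˢ univ) (h0 : hausdorffDim E = 0) (hfin : hausdorffOn E univ ≠ ∞) {I : Set ℝ}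
    (hδ : 2 * hausdorffDim E ∈ I) {V : Type*} [NormedAddCommGroup V] [NormedSpace ℝ V]
    {res : V →ₗ[ℝ] (ℝ × Cosets G → ℝ)} {L : ℝ → V →L[ℝ] V} (hS : IsGSTSpace E I res L) :
    (0 : ℝ) ∉ B := by
  intro hB0
  set T := L (2 * hausdorffDim E) with hTdef
  have hgk : ∀ f, IsGaussKuzmin E (2 * hausdorffDim E) (res f) (res (T f)) :=
    hS.gaussKuzmin _ hδ
  -- Denominators of rational points of `B` are bounded and increase along inverse branches.
  obtain ⟨D, hD⟩ : ∃ D : ℕ, ∀ a b : ℕ, 0 < b → a.Coprime b → (a : ℝ) / b ∈ B → b ≤ D := by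
    have hBf := finite_of_hausdorffDim_eq_zero hBm hE h0 hfin
    have h1 : (((↑) : ℚ → ℝ) ⁻¹' B).Finite := hBf.preimage Rat.cast_injective.injOn
    obtain ⟨D, hD⟩ := (h1.image Rat.den).bddAbove
    refine ⟨D, fun a b hb hab h => ?_⟩
    refine hD ⟨(a : ℤ) / (b : ℤ), ?_, ?_⟩
    · simpa using h
    · have := Rat.den_div_eq_of_coprime (a := a) (b := b) (by exact_mod_cast hb) (by simpa using hab)
      exact_mod_cast this
  have hEB : ∀ p : ℝ × Cosets G, p ∈ E ↔ p.1 ∈ B := fun p => by rw [hE]; simp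
  -- An inverse branch sends a / b to b / (a + b k), of denominator at least b + 1; after n steps no
  -- point of B remains once b + n > D.
  have hvan : ∀ n : ℕ, ∀ f : V, ∀ a b : ℕ, 0 < a → 0 < b → a.Coprime b → ∀ t : Cosets G,
      ((a : ℝ) / b, t) ∈ E → D < b + n → res ((T ^ n) f) ((a : ℝ) / b, t) = 0 := by
    intro n
    induction n with
    | zero =>
      intro f a b _ hb hab t ht hlt
      exact absurd (hD a b hb hab ((hEB _).1 ht)) (by omega)
    | succ n ih =>
      intro f a b ha hb hab t ht hlt
      rw [pow_succ', mul_apply_eq_comp]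
      refine eq_zero_of_isGaussKuzmin hBm hE h0 (hgk _) ht fun k hk hbE => ?_
      have h1 : branch G k ((a : ℝ) / b, t) =
          (((b : ℕ) : ℝ) / ((a + b * k : ℕ) : ℝ), mk (branchMatrix k) • t) := by
        refine Prod.ext ?_ rfl
        simp only [branch]
        push_cast
        field_simp
      rw [h1] at hbE ⊢
      have hk1 := hk.1
      have h2 : b ≤ b * k := Nat.le_mul_of_pos_right b hk1
      refine ih f b (a + b * k) hb (by omega) ?_ _ hbE (by omega)
      rw [Nat.coprime_add_mul_left_right]
      exact hab.symm
  have hvan0 : ∀ (f : V) (t : Cosets G), res ((T ^ (D + 1)) f) (0, t) = 0 := by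
    intro f t
    rw [pow_succ', mul_apply_eq_comp]
    refine eq_zero_of_isGaussKuzmin hBm hE h0 (hgk _) ((hEB _).2 hB0) fun k hk hbE => ?_
    have h1 : branch G k ((0 : ℝ), t) = (((1 : ℕ) : ℝ) / (k : ℝ), mk (branchMatrix k) • t) := by
      refine Prod.ext ?_ rfl
      simp [branch]
    rw [h1] at hbE ⊢
    exact hvan D f 1 k one_pos hk.1 (Nat.coprime_one_left k) _ hbE (by have := hk.1; omega)
  obtain ⟨K, hKpt, hK, u, hu, hL, hpos⟩ := hS.uPositive _ hδ
  obtain ⟨C, hC, hres⟩ := exists_abs_res_le hK hu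
  set t : Cosets G := Classical.arbitrary _
  have ht : ((0 : ℝ), t) ∈ E := (hEB _).2 hB0
  have hu0 : res u (0, t) = 0 := by
    by_cases hne : u = 0
    · rw [hne, map_zero]; rfl
    obtain ⟨k, hk, a, b, ha, hb, hau, -⟩ := hpos u (interior_subset hu) hne
    have h1 := hK _ (pow_mul_apply_sub_mem hL ha.le hau (D + 1)) _ ht
    -- Since k ≥ 1, the power k (D + 1) factors through the power D + 1 that vanishes at (0, t).
    obtain ⟨j, rfl⟩ : ∃ j, k = j + 1 := ⟨k - 1, by omega⟩
    have h2 : (j + 1) * (D + 1) = (D + 1) + j * (D + 1) := by ring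
    have h3 := hvan0 ((T ^ (j * (D + 1))) u) t
    rw [← mul_apply_eq_comp, ← pow_add, ← h2] at h3
    rw [map_sub, map_smul, Pi.sub_apply, Pi.smul_apply, smul_eq_mul] at h1
    rw [h3] at h1
    have h4 := hK u (interior_subset hu) _ ht
    have h5 : 0 < a ^ (D + 1) := by positivity
    nlinarith
  have hz := measure_eq_zero_of_forall_res_eq_zero hS hfin
    (measurableSet_singleton ((0 : ℝ), t)) fun f => Eventually.of_forall fun p hp => by
      rw [mem_singleton_iff] at hp
      have h1 := hres f p (by rw [hp]; exact ht)
      rw [hp, hu0, mul_zero] at h1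
      rw [hp]
      exact abs_nonpos_iff.1 h1
  exact absurd ((hausdorffOn_singleton hBm hE h0 ht).trans hz.le) (by simp)

end Zero

/-- In positive dimension Hausdorff measure ignores countable sets. In dimension zero a rational
point of B would be shifted to 0, which is not in B. -/
theorem ae_irrational [G.FiniteIndex] (hB : B ⊆ Icc 0 1) (hBm : MeasurableSet B)
    (hE : E = B ×ˢ univ) (hT : ShiftInvariant E) (hfin : hausdorffOn E univ ≠ ∞) {I : Set ℝ}
    (hδ : 2 * hausdorffDim E ∈ I) {V : Type*} [NormedAddCommGroup V] [NormedSpace ℝ V]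
    {res : V →ₗ[ℝ] (ℝ × Cosets G → ℝ)} {L : ℝ → V →L[ℝ] V} (hS : IsGSTSpace E I res L) :
    ∀ᵐ p ∂(hausdorffOn E), Irrational p.1 := by
  have hEm : MeasurableSet E := by rw [hE]; exact hBm.prod MeasurableSet.univ
  rcases (ENNReal.toReal_nonneg : 0 ≤ hausdorffDim E).eq_or_lt with h0 | h0
  · filter_upwards [ae_hausdorffOn_mem hEm] with p hp
    rintro ⟨q, hq⟩
    have hpB : p.1 ∈ B := by rw [hE] at hp; exact hp.1
    refine zero_notMem hBm hE h0.symm hfin hδ hS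
      (zero_mem_of_rational_mem hE hT q.num.natAbs q.den q.den_pos ?_)
    have hq0 : 0 ≤ q := by
      have := (hB hpB).1
      rw [← hq] at this
      exact_mod_cast this
    have h1 : ((q.num.natAbs : ℕ) : ℝ) / q.den = q := by
      have h2 : ((q.num.natAbs : ℕ) : ℤ) = q.num := Int.natAbs_of_nonneg (Rat.num_nonneg.2 hq0)
      have h3 : ((q.num.natAbs : ℕ) : ℝ) = (q.num : ℝ) := by rw [← Int.cast_natCast, h2]
      rw [h3, ← Rat.cast_def]
    rw [h1, hq]
    exact hpB
  · have : NullSingletonClass (μH[hausdorffDim E] : Measure ℝ) :=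
      Measure.nullSingletonClass_hausdorff ℝ h0
    have hm : MeasurableSet {p : ℝ × Cosets G | ¬ Irrational p.1} := by
      have h1 : MeasurableSet (range ((↑) : ℚ → ℝ)) := (countable_range _).measurableSet
      have h2 : {p : ℝ × Cosets G | ¬ Irrational p.1} = Prod.fst ⁻¹' range ((↑) : ℚ → ℝ) := by
        ext p
        exact not_not
      rw [h2]
      exact measurable_fst h1
    rw [ae_iff, hausdorffOn_apply hBm hE hm]
    refine Finset.sum_eq_zero fun t _ => measure_mono_null ?_
      ((countable_range ((↑) : ℚ → ℝ)).measure_zero _)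
    intro x hx
    exact not_not.1 hx.2

end LimitingModularSymbols

/-! ### The invariant density -/

namespace LimitingModularSymbols

section

variable {V : Type*} [NormedAddCommGroup V] [NormedSpace ℝ V] {K : ProperCone ℝ V}

theorem mem_interior_of_sub_smul_mem {u h : V} (hu : u ∈ interior (K : Set V)) {a : ℝ}
    (ha : 0 < a) (hau : h - a • u ∈ K) : h ∈ interior (K : Set V) := by
  rw [mem_interior_iff_mem_nhds] at hu ⊢
  have hcont : Continuous fun y : V => a⁻¹ • (y - (h - a • u)) := by fun_prop
  have h1 : a⁻¹ • (h - (h - a • u)) = u := by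
    rw [sub_sub_cancel, smul_smul, inv_mul_cancel₀ ha.ne', one_smul]
  have h2 := hcont.tendsto h
  rw [h1] at h2
  filter_upwards [h2 hu] with y hy
  have h3 : y = a • (a⁻¹ • (y - (h - a • u))) + (h - a • u) := by
    rw [smul_smul, mul_inv_cancel₀ ha.ne', one_smul, sub_add_cancel]
  rw [h3]
  exact K.add_mem (K.smul_mem hy ha.le) hau

end

variable {G : Subgroup PGL(2, ℤ)} {B : Set ℝ} {E : Set (ℝ × Cosets G)}

theorem measurable_shift_iterate [G.FiniteIndex] (n : ℕ) : Measurable ((shift G)^[n]) :=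
  measurable_shift.iterate n

section

variable {V : Type*} [NormedAddCommGroup V] [NormedSpace ℝ V] {K : ProperCone ℝ V}
  {res : V →ₗ[ℝ] (ℝ × Cosets G → ℝ)}

theorem integral_comp_shift_iterate_mul_res [G.FiniteIndex] (hB : B ⊆ Icc 0 1)
    (hBm : MeasurableSet B) (hE : E = B ×ˢ univ) (hT : ShiftInvariant E)
    (hrat : ∀ᵐ p ∂(hausdorffOn E), Irrational p.1) {L : V →L[ℝ] V}
    (hint : ∀ f, Integrable (res f) (hausdorffOn E))
    (hgk : ∀ f, IsGaussKuzmin E (2 * hausdorffDim E) (res f) (res (L f)))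
    {ψ : ℝ × Cosets G → ℝ} (hψ : Measurable ψ) {M : ℝ} (hM : ∀ p, |ψ p| ≤ M) (n : ℕ) (f : V) :
    ∫ p, ψ ((shift G)^[n] p) * res f p ∂(hausdorffOn E) =
      ∫ p, ψ p * res ((L ^ n) f) p ∂(hausdorffOn E) := by
  induction n generalizing f with
  | zero => rfl
  | succ n ih =>
    rw [pow_succ, mul_apply_eq_comp, ← ih]
    exact integral_comp_shift_mul (ψ := fun p => ψ ((shift G)^[n] p)) hB hBm hE hT hrat
      (hψ.comp (measurable_shift_iterate n)) (fun p => hM _) (hint f) (hgk f)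

/-- Continuity comes from the domination by u; no bound of the L² norm by the norm of the Banach
space is assumed. -/
theorem exists_continuousLinearMap_integral_mul_res (hEm : MeasurableSet E)
    (hint : ∀ f, Integrable (res f) (hausdorffOn E)) {u : V} {C : ℝ}
    (hres : ∀ f, ∀ p ∈ E, |res f p| ≤ C * ‖f‖ * res u p)
    {ψ : ℝ × Cosets G → ℝ} (hψ : Measurable ψ) {M : ℝ} (hM : ∀ p, |ψ p| ≤ M) :
    ∃ ℓ : V →L[ℝ] ℝ, ∀ f, ℓ f = ∫ p, ψ p * res f p ∂(hausdorffOn E) := by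
  have hi : ∀ f, Integrable (fun p => ψ p * res f p) (hausdorffOn E) := fun f =>
    (hint f).bdd_mul hψ.aestronglyMeasurable (c := M) (Eventually.of_forall hM)
  let l : V →ₗ[ℝ] ℝ :=
    { toFun := fun f => ∫ p, ψ p * res f p ∂(hausdorffOn E)
      map_add' := fun f g => by
        rw [← integral_add (hi f) (hi g)]
        refine integral_congr_ae (Eventually.of_forall fun p => ?_)
        simp only [map_add, Pi.add_apply, mul_add]
      map_smul' := fun c f => by
        rw [RingHom.id_apply, smul_eq_mul, ← integral_const_mul]
        refine integral_congr_ae (Eventually.of_forall fun p => ?_)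
        simp only [map_smul, Pi.smul_apply, smul_eq_mul]
        ring }
  refine ⟨l.mkContinuous (M * C * ∫ p, res u p ∂(hausdorffOn E)) fun f => ?_, fun f => rfl⟩
  have h1 : ‖l f‖ ≤ ∫ p, M * C * ‖f‖ * res u p ∂(hausdorffOn E) := by
    refine norm_integral_le_of_norm_le ((hint u).const_mul _) ?_
    filter_upwards [ae_hausdorffOn_mem hEm] with p hp
    rw [norm_mul, Real.norm_eq_abs, Real.norm_eq_abs]
    calc |ψ p| * |res f p| ≤ M * (C * ‖f‖ * res u p) :=
          mul_le_mul (hM p) (hres f p hp) (abs_nonneg _) ((abs_nonneg _).trans (hM p))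
      _ = _ := by ring
  rw [integral_const_mul] at h1
  linarith

/-- On a finite measure the L² norm controls the L¹ norm, so L² density yields L¹ approximation. -/
theorem exists_integral_abs_sub_res_lt {I : Set ℝ} {L : ℝ → V →L[ℝ] V} (hS : IsGSTSpace E I res L)
    (hfin : hausdorffOn E univ ≠ ∞) {f : ℝ × Cosets G → ℝ} (hf : MemLp f 2 (hausdorffOn E))
    {ε : ℝ} (hε : 0 < ε) : ∃ g, ∫ p, |f p - res g p| ∂(hausdorffOn E) < ε := by
  have : IsFiniteMeasure (hausdorffOn E) := ⟨hfin.lt_top⟩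
  set m : ℝ := ((hausdorffOn E) univ ^ (1 / 2 : ℝ)).toReal with hm
  have hm0 : 0 ≤ m := ENNReal.toReal_nonneg
  obtain ⟨_, ⟨g, rfl⟩, hg⟩ := hS.dense.exists_dist_lt (hf.toLp f) (ε := ε / (m + 1)) (by positivity)
  refine ⟨g, ?_⟩
  have hk : MemLp (f - res g) 2 (hausdorffOn E) := hf.sub (hS.memLp g)
  rw [Lp.dist_def, eLpNorm_congr_ae (hf.coeFn_toLp.sub (hS.memLp g).coeFn_toLp)] at hg
  have h1 := eLpNorm_le_eLpNorm_mul_rpow_measure_univ (μ := hausdorffOn E) (p := 1) (q := 2)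
    (by norm_num) hk.aestronglyMeasurable
  have h2 : ∫ p, |f p - res g p| ∂(hausdorffOn E) = (eLpNorm (f - res g) 1 (hausdorffOn E)).toReal := by
    rw [eLpNorm_one_eq_lintegral_enorm, ← integral_norm_eq_lintegral_enorm hk.aestronglyMeasurable]
    rfl
  have h3 : (1 / (1 : ℝ≥0∞).toReal - 1 / (2 : ℝ≥0∞).toReal) = (1 / 2 : ℝ) := by norm_num
  rw [h3] at h1
  have h4 := ENNReal.toReal_mono (ENNReal.mul_ne_top hk.eLpNorm_ne_top
    (ENNReal.rpow_ne_top_of_nonneg (by norm_num) hfin)) h1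
  rw [ENNReal.toReal_mul] at h4
  rw [h2]
  rw [lt_div_iff₀ (by positivity)] at hg
  refine h4.trans_lt (lt_of_le_of_lt ?_ hg)
  exact mul_le_mul_of_nonneg_left (by linarith) ENNReal.toReal_nonneg

end

/-- Good spectral theory yields a positive invariant density, with respect to which the shift is
mixing. -/
theorem exists_invariant_density [G.FiniteIndex] (hB : B ⊆ Icc 0 1)
    (hBm : MeasurableSet B) (hE : E = B ×ˢ univ) (hT : ShiftInvariant E)
    (hfin : hausdorffOn E univ ≠ ∞) (hne : hausdorffOn E ≠ 0) {I : Set ℝ}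
    (hδ : 2 * hausdorffDim E ∈ I) (hGST : HasGST E I) :
    (∀ᵐ p ∂(hausdorffOn E), Irrational p.1) ∧ ∃ h : ℝ × Cosets G → ℝ,
      MemLp h 2 (hausdorffOn E) ∧ (∀ᵐ p ∂(hausdorffOn E), 0 < h p) ∧
      (∀ ψ : ℝ × Cosets G → ℝ, Measurable ψ → ∀ M, (∀ p, |ψ p| ≤ M) →
        ∫ p, ψ (shift G p) * h p ∂(hausdorffOn E) = ∫ p, ψ p * h p ∂(hausdorffOn E)) ∧
      ∀ ψ : ℝ × Cosets G → ℝ, Measurable ψ → ∀ M, (∀ p, |ψ p| ≤ M) →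
        ∀ f : ℝ × Cosets G → ℝ, MemLp f 2 (hausdorffOn E) →
        Tendsto (fun n : ℕ => ∫ p, ψ ((shift G)^[n] p) * f p ∂(hausdorffOn E)) atTop
          (𝓝 ((∫ p, f p ∂(hausdorffOn E)) * ∫ p, ψ p * h p ∂(hausdorffOn E))) := by
  have : IsFiniteMeasure (hausdorffOn E) := ⟨hfin.lt_top⟩
  obtain ⟨V, _, _, _, res, L, hS⟩ := hGST
  have hrat := ae_irrational hB hBm hE hT hfin hδ hS
  refine ⟨hrat, ?_⟩
  have hEm : MeasurableSet E := by rw [hE]; exact hBm.prod MeasurableSet.univ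
  set T := L (2 * hausdorffDim E)
  have hgk : ∀ f, IsGaussKuzmin E (2 * hausdorffDim E) (res f) (res (T f)) := hS.gaussKuzmin _ hδ
  have hint : ∀ f, Integrable (res f) (hausdorffOn E) := fun f =>
    (hS.memLp f).integrable (by norm_num)
  obtain ⟨K, hKpt, hK, u, hu, hL, hpos⟩ := hS.uPositive _ hδ
  obtain ⟨C, hC, hres⟩ := exists_abs_res_le hK hu
  have hdual := fun {ψ : ℝ × Cosets G → ℝ} (hψ : Measurable ψ) {M : ℝ} (hM : ∀ p, |ψ p| ≤ M) =>
    exists_continuousLinearMap_integral_mul_res hEm hint hres hψ hM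
  -- Adjointness tested against the constant 1 makes integration over E a T-invariant functional.
  obtain ⟨ℓ, hℓ⟩ := hdual (ψ := fun _ => 1) measurable_const (M := 1) (by simp)
  simp only [one_mul] at hℓ
  have hℓT : ∀ f, ℓ (T f) = ℓ f := fun f => by
    have := integral_comp_shift_mul (ψ := fun _ => 1) hB hBm hE hT hrat measurable_const
      (M := 1) (by simp) (hint f) (hgk f)
    rw [hℓ, hℓ]
    simpa only [one_mul] using this.symm
  -- Where u vanishes every function of the space vanishes, so density makes this set null.
  have hu0 : ∀ᵐ p ∂(hausdorffOn E), 0 < res u p := by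
    have hm := (hS.memLp u).aestronglyMeasurable
    have hz := measure_eq_zero_of_forall_res_eq_zero hS hfin
      (S := {p | hm.mk _ p = 0}) (hm.stronglyMeasurable_mk.measurable (measurableSet_singleton 0))
      fun f => by
        filter_upwards [hm.ae_eq_mk, ae_hausdorffOn_mem hEm] with p hp hpE hp0
        have h1 := hres f p hpE
        rw [hp, show hm.mk _ p = 0 from hp0, mul_zero] at h1
        exact abs_nonpos_iff.1 h1
    filter_upwards [hm.ae_eq_mk, ae_hausdorffOn_mem hEm, measure_eq_zero_iff_ae_notMem.1 hz]
      with p hp hpE hp0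
    refine lt_of_le_of_ne (hK u (interior_subset hu) p hpE) fun h => hp0 ?_
    exact (hp.symm.trans h.symm)
  have hℓu : 0 < ℓ u := by
    rw [hℓ, integral_pos_iff_support_of_nonneg_ae (hu0.mono fun p hp => hp.le) (hint u)]
    have h1 : (Function.support (res u) : Set _) =ᵐ[hausdorffOn E] univ := by
      filter_upwards [hu0] with p hp
      exact propext ⟨fun _ => trivial, fun _ => hp.ne'⟩
    rw [measure_congr h1]
    exact pos_iff_ne_zero.2 (Measure.measure_univ_ne_zero.2 hne)
  obtain ⟨h', hh'K, hh'0, hh'T⟩ := exists_fixed_vector_mem_cone (hS.compact _ hδ) hL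
    hS.spectralRadius hℓT (interior_subset hu) hℓu
  -- For a fixed vector u-positivity reads h' ≥ a' u, so h' is interior, and positive almost
  -- everywhere. It is then scaled to integral 1.
  obtain ⟨k, -, a', -, ha', -, hau', -⟩ := hpos h' hh'K hh'0
  rw [pow_apply_of_apply_eq hh'T] at hau'
  have hℓ0 : ∀ f ∈ K, 0 ≤ ℓ f := fun f hf => by
    rw [hℓ]
    refine integral_nonneg_of_ae ?_
    filter_upwards [ae_hausdorffOn_mem hEm] with p hp using hK f hf p hp
  have hℓh' : 0 < ℓ h' := by
    have h1 := hℓ0 _ hau'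
    rw [map_sub, map_smul, smul_eq_mul] at h1
    have := mul_pos ha' hℓu
    linarith
  obtain ⟨h, hh⟩ : ∃ h, h = (ℓ h')⁻¹ • h' := ⟨_, rfl⟩
  obtain ⟨a, ha_def⟩ : ∃ a, a = (ℓ h')⁻¹ * a' := ⟨_, rfl⟩
  have ha : 0 < a := by rw [ha_def]; positivity
  have hau : h - a • u ∈ K := by
    rw [hh, ha_def, mul_smul, ← smul_sub]
    exact K.smul_mem hau' (by positivity)
  have hhT : T h = h := by rw [hh, map_smul, hh'T]
  have hℓh : ℓ h = 1 := by rw [hh, map_smul, smul_eq_mul, inv_mul_cancel₀ hℓh'.ne']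
  obtain ⟨C', hC', hsub⟩ := exists_pos_smul_sub_mem_of_mem_interior hu
  have hconv := fun f => tendsto_pow_apply_smul hKpt (hS.compact _ hδ) hL
    (mem_interior_of_sub_smul_mem hu ha hau) hhT (fun f hf hf0 => by
      obtain ⟨k, -, c, -, hc, -, hcu, -⟩ := hpos f hf hf0
      set b := C' * ‖h‖ + 1 with hb_def
      have hb : 0 < b := by positivity
      refine ⟨k, c / b, by positivity, ?_⟩
      have h1 : (T ^ k) f - (c / b) • h =
          ((T ^ k) f - c • u) + (c / b) • (b • u - h) := by
        rw [smul_sub, smul_smul (c / b) b, div_mul_cancel₀ _ hb.ne']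
        abel
      rw [h1]
      exact K.add_mem hcu (K.smul_mem (hsub h b (by linarith)) (by positivity))) hℓT hℓh f
  refine ⟨res h, hS.memLp h, ?_, ?_, ?_⟩
  · filter_upwards [hu0, ae_hausdorffOn_mem hEm] with p hp hpE
    have h1 := hK _ hau p hpE
    rw [map_sub, map_smul, Pi.sub_apply, Pi.smul_apply, smul_eq_mul] at h1
    have := mul_pos ha hp
    linarith
  · intro ψ hψ M hM
    have := integral_comp_shift_mul hB hBm hE hT hrat hψ hM (hint h) (hgk h)
    rwa [hhT] at this
  · intro ψ hψ M hM f hf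
    have hM0 : 0 ≤ M := (abs_nonneg _).trans (hM (0, Classical.arbitrary _))
    obtain ⟨Λ, hΛ⟩ := hdual hψ hM
    have hres_tendsto : ∀ g : V,
        Tendsto (fun n : ℕ => ∫ p, ψ ((shift G)^[n] p) * res g p ∂(hausdorffOn E)) atTop
          (𝓝 ((∫ p, res g p ∂(hausdorffOn E)) * ∫ p, ψ p * res h p ∂(hausdorffOn E))) := by
      intro g
      have h1 := (Λ.continuous.tendsto _).comp (hconv g)
      rw [map_smul, smul_eq_mul, hΛ, hℓ] at h1
      refine h1.congr fun n => ?_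
      rw [Function.comp_apply, hΛ,
        integral_comp_shift_iterate_mul_res hB hBm hE hT hrat hint hgk hψ hM]
    have hψn : ∀ n (k : ℝ × Cosets G → ℝ), Integrable k (hausdorffOn E) →
        Integrable (fun p => ψ ((shift G)^[n] p) * k p) (hausdorffOn E) := fun n k hk =>
      hk.bdd_mul (hψ.comp (measurable_shift_iterate n)).aestronglyMeasurable (c := M)
        (Eventually.of_forall fun p => hM _)
    have hfi : Integrable f (hausdorffOn E) := hf.integrable (by norm_num)
    set c := ∫ p, ψ p * res h p ∂(hausdorffOn E)
    rw [Metric.tendsto_atTop]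
    intro ε hε
    -- Replacing f by g costs at most M η in the integrals, uniformly in n, and |c| η in the limit.
    obtain ⟨g, hg⟩ := exists_integral_abs_sub_res_lt hS hfin hf
      (ε := ε / (2 * (M + |c| + 1))) (by positivity)
    set η := ∫ p, |f p - res g p| ∂(hausdorffOn E)
    rw [lt_div_iff₀ (by positivity)] at hg
    obtain ⟨N, hN⟩ := Metric.tendsto_atTop.1 (hres_tendsto g) (ε / 2) (by positivity)
    refine ⟨N, fun n hn => ?_⟩
    have h1 := hN n hn
    have h2 : |(∫ p, ψ ((shift G)^[n] p) * f p ∂(hausdorffOn E)) -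
        ∫ p, ψ ((shift G)^[n] p) * res g p ∂(hausdorffOn E)| ≤ M * η := by
      rw [← integral_sub (hψn n f hfi) (hψn n _ (hint g)), ← integral_const_mul, ← Real.norm_eq_abs]
      refine norm_integral_le_of_norm_le ((hfi.sub (hint g)).abs.const_mul M) ?_
      refine Eventually.of_forall fun p => ?_
      rw [← mul_sub, norm_mul]
      exact mul_le_mul_of_nonneg_right (hM _) (abs_nonneg _)
    have h3 : |(∫ p, f p ∂(hausdorffOn E)) - ∫ p, res g p ∂(hausdorffOn E)| ≤ η := by
      rw [← integral_sub hfi (hint g)]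
      exact abs_integral_le_integral_abs
    rw [Real.dist_eq] at h1 ⊢
    have h4 : |(∫ p, f p ∂(hausdorffOn E)) * c - (∫ p, res g p ∂(hausdorffOn E)) * c| ≤ η * |c| := by
      rw [← sub_mul, abs_mul]
      exact mul_le_mul_of_nonneg_right h3 (abs_nonneg _)
    have hη : 0 ≤ η := integral_nonneg fun p => abs_nonneg _
    rw [abs_lt] at h1 ⊢
    rw [abs_le] at h2 h4
    constructor <;> nlinarith [h1.1, h1.2, h2.1, h2.2, h4.1, h4.2]

end LimitingModularSymbols

/-! ### Birkhoff sums of functions with decaying correlations -/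

namespace LimitingModularSymbols

section Birkhoff

theorem abs_birkhoffSum_le {X : Type*} {T : X → X} {ψ : X → ℝ} {M : ℝ} (hM : ∀ x, |ψ x| ≤ M)
    (n : ℕ) (x : X) : |birkhoffSum T ψ n x| ≤ n * M := by
  unfold birkhoffSum
  refine (Finset.abs_sum_le_sum_abs _ _).trans ?_
  refine (Finset.sum_le_sum fun k _ => hM _).trans ?_
  simp

variable {X : Type*} [MeasurableSpace X] {ν : Measure X} [IsFiniteMeasure ν] {T : X → X}
  {ψ : X → ℝ} {M : ℝ}

theorem measurable_birkhoffSum (hT : Measurable T) (hψ : Measurable ψ) (n : ℕ) :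
    Measurable (birkhoffSum T ψ n) := by
  unfold birkhoffSum
  exact Finset.measurable_sum _ fun k _ => hψ.comp (hT.iterate k)

theorem integrable_of_abs_le {g : X → ℝ} (hg : Measurable g) {M : ℝ} (hM : ∀ x, |g x| ≤ M) :
    Integrable g ν :=
  Integrable.of_bound hg.aestronglyMeasurable M (Eventually.of_forall hM)

/-- Induction through S_{n+1} = ψ + S_n ∘ T: invariance keeps the integral of S_n², and the cross
terms are correlations with ψ. -/
theorem integral_birkhoffSum_sq_le (hT : MeasurePreserving T ν ν) (hψ : Measurable ψ)
    (hM : ∀ x, |ψ x| ≤ M) (n : ℕ) :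
    ∫ x, birkhoffSum T ψ n x ^ 2 ∂ν ≤
      2 * n * ∑ j ∈ Finset.range n, |∫ x, ψ (T^[j] x) * ψ x ∂ν| := by
  induction n with
  | zero => simp
  | succ n ih =>
    have hSm := measurable_birkhoffSum hT.measurable hψ n
    have hSb := abs_birkhoffSum_le (T := T) hM n
    have hmul : ∀ {a b : X → ℝ} {A B : ℝ}, Measurable a → Measurable b → (∀ x, |a x| ≤ A) →
        (∀ x, |b x| ≤ B) → Integrable (fun x => a x * b x) ν := fun ha hb hA hB =>
      integrable_of_abs_le (ha.mul hb) fun x => by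
        rw [abs_mul]
        exact mul_le_mul (hA x) (hB x) (abs_nonneg _) ((abs_nonneg _).trans (hA x))
    have hSTm : Measurable fun x => birkhoffSum T ψ n (T x) := hSm.comp hT.measurable
    have h0 : Integrable (fun x => ψ (T^[0] x) * ψ x) ν := hmul hψ hψ hM hM
    have h1 : Integrable (fun x => birkhoffSum T ψ n (T x) * ψ x) ν :=
      hmul hSTm hψ (fun x => hSb _) hM
    have h2 : Integrable (fun x => birkhoffSum T ψ n (T x) ^ 2) ν := by
      simpa only [sq] using hmul hSTm hSTm (fun x => hSb _) fun x => hSb _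
    have h3 : ∫ x, birkhoffSum T ψ n (T x) ^ 2 ∂ν = ∫ x, birkhoffSum T ψ n x ^ 2 ∂ν := by
      conv_rhs => rw [← hT.map_eq]
      rw [integral_map hT.measurable.aemeasurable (hSm.pow_const 2).aestronglyMeasurable]
    have h4 : ∫ x, birkhoffSum T ψ n (T x) * ψ x ∂ν =
        ∑ j ∈ Finset.range n, ∫ x, ψ (T^[j + 1] x) * ψ x ∂ν := by
      rw [← integral_finsetSum _ fun j _ => hmul (a := fun x => ψ (T^[j + 1] x))
        (hψ.comp (hT.measurable.iterate (j + 1))) hψ (fun x => hM _) hM]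
      refine integral_congr_ae (Eventually.of_forall fun x => ?_)
      simp only [birkhoffSum, Finset.sum_mul, Function.iterate_succ_apply]
    have h5 : ∫ x, birkhoffSum T ψ (n + 1) x ^ 2 ∂ν = ∫ x, ψ (T^[0] x) * ψ x ∂ν +
        2 * ∑ j ∈ Finset.range n, ∫ x, ψ (T^[j + 1] x) * ψ x ∂ν +
          ∫ x, birkhoffSum T ψ n x ^ 2 ∂ν := by
      rw [← h4, ← h3, ← integral_const_mul, ← integral_add h0 (h1.const_mul 2)]
      refine Eq.trans ?_ (integral_add (h0.add (h1.const_mul 2)) h2)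
      refine integral_congr_ae (Eventually.of_forall fun x => ?_)
      simp only [birkhoffSum_succ', Function.iterate_zero, id_eq]
      ring
    have h6 : ∑ j ∈ Finset.range n, ∫ x, ψ (T^[j + 1] x) * ψ x ∂ν ≤
        ∑ j ∈ Finset.range n, |∫ x, ψ (T^[j + 1] x) * ψ x ∂ν| :=
      Finset.sum_le_sum fun j _ => le_abs_self _
    have h7 := Finset.sum_range_succ' (fun j => |∫ x, ψ (T^[j] x) * ψ x ∂ν|) n
    have h8 := Finset.sum_range_succ (fun j => |∫ x, ψ (T^[j] x) * ψ x ∂ν|) n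
    have h9 := abs_nonneg (∫ x, ψ (T^[n] x) * ψ x ∂ν)
    have h10 := le_abs_self (∫ x, ψ (T^[0] x) * ψ x ∂ν)
    have h11 := abs_nonneg (∫ x, ψ (T^[0] x) * ψ x ∂ν)
    rw [h5]
    push_cast
    have hn : (0 : ℝ) ≤ n := n.cast_nonneg
    have h12 : 2 * (n : ℝ) * ∑ j ∈ Finset.range n, |∫ x, ψ (T^[j] x) * ψ x ∂ν| ≤
        2 * n * ∑ j ∈ Finset.range (n + 1), |∫ x, ψ (T^[j] x) * ψ x ∂ν| := by
      refine mul_le_mul_of_nonneg_left ?_ (by positivity)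
      linarith
    linarith

/-- Decaying correlations make the second moment o(n²), and |S| ≤ δ n + S² / (δ n) passes to the
first moment. -/
theorem tendsto_integral_abs_birkhoffSum_div (hT : MeasurePreserving T ν ν) (hψ : Measurable ψ)
    (hM : ∀ x, |ψ x| ≤ M)
    (hmix : Tendsto (fun n : ℕ => ∫ x, ψ (T^[n] x) * ψ x ∂ν) atTop (𝓝 0)) {ε : ℝ} (hε : 0 < ε) :
    ∃ N : ℕ, ∀ n, N ≤ n → ∫ x, |birkhoffSum T ψ n x| ∂ν ≤ ε * n := by
  set m := ν.real univ
  have hm : 0 ≤ m := measureReal_nonneg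
  set δ := ε / (2 * (m + 1)) with hδ_def
  have hδ : 0 < δ := by positivity
  have hc := (by simpa using hmix.abs : Tendsto (fun n : ℕ => |∫ x, ψ (T^[n] x) * ψ x ∂ν|)
    atTop (𝓝 0)).cesaro
  obtain ⟨N, hN⟩ := eventually_atTop.1 (hc.eventually_lt_const
    (show 0 < δ * ε / 4 by positivity))
  refine ⟨N + 1, fun n hn => ?_⟩
  have hn0 : (0 : ℝ) < n := by exact_mod_cast (by omega : 0 < n)
  have h1 := hN n (by omega)
  rw [inv_mul_lt_iff₀ hn0] at h1
  have h2 := integral_birkhoffSum_sq_le hT hψ hM n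
  have hSm := measurable_birkhoffSum hT.measurable hψ n
  have hSb := abs_birkhoffSum_le (T := T) hM n
  have hsq : Integrable (fun x => birkhoffSum T ψ n x ^ 2) ν :=
    integrable_of_abs_le (hSm.pow_const 2) (M := (n * M) ^ 2) fun x => by
      rw [abs_pow]
      exact pow_le_pow_left₀ (abs_nonneg _) (hSb x) 2
  have h3 : ∫ x, |birkhoffSum T ψ n x| ∂ν ≤
      ∫ x, (δ * n + (δ * n)⁻¹ * birkhoffSum T ψ n x ^ 2) ∂ν := by
    refine integral_mono (integrable_of_abs_le hSm hSb).abs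
      ((integrable_const _).add (hsq.const_mul _)) fun x => ?_
    have h4 : 0 < δ * n := by positivity
    have h5 : 0 ≤ (δ * n)⁻¹ * (|birkhoffSum T ψ n x| - δ * n) ^ 2 := by positivity
    have h6 : (δ * n)⁻¹ * (|birkhoffSum T ψ n x| - δ * n) ^ 2 =
        (δ * n)⁻¹ * birkhoffSum T ψ n x ^ 2 - 2 * |birkhoffSum T ψ n x| + δ * n := by
      rw [← sq_abs (birkhoffSum T ψ n x)]
      field_simp
      ring
    have h7 := abs_nonneg (birkhoffSum T ψ n x)
    show |birkhoffSum T ψ n x| ≤ δ * n + (δ * n)⁻¹ * birkhoffSum T ψ n x ^ 2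
    linarith
  rw [integral_add (integrable_const _) (hsq.const_mul _), integral_const, integral_const_mul,
    smul_eq_mul] at h3
  have h4 : (δ * n)⁻¹ * ∫ x, birkhoffSum T ψ n x ^ 2 ∂ν ≤ ε / 2 * n := by
    rw [inv_mul_le_iff₀ (by positivity)]
    nlinarith
  have h5 : m * (δ * n) ≤ ε / 2 * n := by
    rw [← mul_assoc]
    refine mul_le_mul_of_nonneg_right ?_ hn0.le
    rw [hδ_def, mul_div_assoc', div_le_iff₀ (by positivity)]
    nlinarith
  linarith

/-- A mean ergodic theorem for the maximal Birkhoff sums of a function whose correlations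
decay. -/
theorem exists_birkhoffSum_le_integrable (hT : MeasurePreserving T ν ν) (hψ : Measurable ψ)
    (hM : ∀ x, |ψ x| ≤ M)
    (hmix : Tendsto (fun n : ℕ => ∫ x, ψ (T^[n] x) * ψ x ∂ν) atTop (𝓝 0)) {ε : ℝ} (hε : 0 < ε) :
    ∃ N : ℕ, ∀ n, N ≤ n → ∃ g : X → ℝ, Integrable g ν ∧ ∫ x, g x ∂ν ≤ ε * n ∧
      ∀ k ≤ n, ∀ x, |birkhoffSum T ψ k x| ≤ g x := by
  by_cases hX : IsEmpty X
  · exact ⟨0, fun n _ => ⟨0, integrable_zero _ _ _, by simp; positivity, fun k _ x => hX.elim x⟩⟩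
  have hM0 : 0 ≤ M := (abs_nonneg _).trans (hM (not_isEmpty_iff.1 hX).some)
  set m := ν.real univ
  have hm : 0 ≤ m := measureReal_nonneg
  obtain ⟨J, hJ⟩ := exists_nat_gt (4 * M * m / ε)
  have hJ0 : (0 : ℝ) < J := lt_of_le_of_lt (by positivity) hJ
  have hJn : 0 < J := by exact_mod_cast hJ0
  rw [div_lt_iff₀ hε] at hJ
  obtain ⟨N, hN⟩ := tendsto_integral_abs_birkhoffSum_div hT hψ hM hmix
    (ε := ε / (4 * J)) (by positivity)
  refine ⟨J * (N + 1), fun n hn => ?_⟩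
  -- Any S_k with k ≤ n differs from one of the J sums S_{jq} by at most q M, roughly n M / J. J was
  -- fixed beforehand so that this error integrates to at most ε n / 2.
  set q := n / J + 1 with hq
  have hNq : N ≤ q := by
    have : N + 1 ≤ n / J := (Nat.le_div_iff_mul_le hJn).2 (by rwa [mul_comm])
    omega
  have hnq : n < J * q := Nat.lt_mul_div_succ n hJn
  have hqn : (J : ℝ) * q ≤ 2 * n := by
    have h1 : J * (n / J) ≤ n := Nat.mul_div_le n J
    have h2 : J ≤ n := le_trans (Nat.le_mul_of_pos_right J (by omega)) hn
    have h3 : J * q ≤ 2 * n := by rw [hq, mul_add]; omega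
    exact_mod_cast h3
  have hint : ∀ k, Integrable (fun x => |birkhoffSum T ψ k x|) ν := fun k =>
    (integrable_of_abs_le (measurable_birkhoffSum hT.measurable hψ k) (abs_birkhoffSum_le hM k)).abs
  have hsum : Integrable (fun x => ∑ j ∈ Finset.range J, |birkhoffSum T ψ (j * q) x|) ν :=
    integrable_finsetSum _ fun j _ => hint (j * q)
  refine ⟨fun x => ∑ j ∈ Finset.range J, |birkhoffSum T ψ (j * q) x| + q * M,
    hsum.add (integrable_const _), ?_, fun k hk x => ?_⟩
  · rw [integral_add hsum (integrable_const _), integral_finsetSum _ fun j _ => hint (j * q),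
      integral_const, smul_eq_mul]
    have h1 : ∀ j ∈ Finset.range J, ∫ x, |birkhoffSum T ψ (j * q) x| ∂ν ≤ ε / 4 * q := by
      intro j hj
      rcases Nat.eq_zero_or_pos j with rfl | hj0
      · simp only [zero_mul, birkhoffSum_zero, abs_zero, integral_zero]
        positivity
      · refine (hN (j * q) (hNq.trans (Nat.le_mul_of_pos_left q hj0))).trans ?_
        have h2 : (j : ℝ) ≤ J := by exact_mod_cast (Finset.mem_range.1 hj).le
        push_cast
        rw [div_mul_eq_mul_div, div_le_iff₀ (by positivity)]
        have h3 : (0 : ℝ) ≤ ε * q := by positivity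
        nlinarith
    have h2 := Finset.sum_le_sum h1
    rw [Finset.sum_const, Finset.card_range, nsmul_eq_mul] at h2
    have h3 : (J : ℝ) * (ε / 4 * q) ≤ ε / 2 * n := by nlinarith
    have h4 : m * (q * M) ≤ ε / 2 * n := by
      have h5 : (J : ℝ) * (m * (q * M)) ≤ J * (ε / 2 * n) := by
        have h6 : (J : ℝ) * (m * (q * M)) ≤ 2 * n * (m * M) := by
          have : (0 : ℝ) ≤ m * M := by positivity
          nlinarith
        have h7 : 2 * (n : ℝ) * (m * M) ≤ J * (ε / 2 * n) := by
          have : (0 : ℝ) ≤ n := n.cast_nonneg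
          nlinarith
        linarith
      exact le_of_mul_le_mul_left h5 hJ0
    change _ + m * (q * M) ≤ _
    linarith
  · have h1 : k = k / q * q + k % q := (Nat.div_add_mod' k q).symm
    have hq0 : 0 < q := Nat.succ_pos _
    have h2 : k / q < J := (Nat.div_lt_iff_lt_mul hq0).2 (lt_of_le_of_lt hk hnq)
    have h3 : birkhoffSum T ψ k x =
        birkhoffSum T ψ (k / q * q) x + birkhoffSum T ψ (k % q) (T^[k / q * q] x) := by
      conv_lhs => rw [h1]
      exact birkhoffSum_add _ _ _ _ _
    rw [h3]
    refine (abs_add_le _ _).trans (add_le_add ?_ ?_)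
    · exact Finset.single_le_sum (f := fun j => |birkhoffSum T ψ (j * q) x|)
        (fun _ _ => abs_nonneg _) (Finset.mem_range.2 h2)
    · refine (abs_birkhoffSum_le hM _ _).trans (mul_le_mul_of_nonneg_right ?_ hM0)
      exact_mod_cast (Nat.mod_lt k hq0).le

end Birkhoff

/-! ### Change of weight -/

section Weight

variable {X : Type*} [MeasurableSpace X] {μ : Measure X}

/-- A bounded family which tends to zero in the mean with respect to one positive weight does so
with respect to every integrable weight. -/
theorem tendsto_integral_mul_zero {h f : X → ℝ} (hh : Integrable h μ) (hpos : ∀ᵐ x ∂μ, 0 < h x)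
    (hf : Integrable f μ) {F : ℝ → X → ℝ} {C : ℝ}
    (hFm : ∀ τ, AEStronglyMeasurable (F τ) μ) (hC : ∀ᶠ τ in atTop, ∀ᵐ x ∂μ, |F τ x| ≤ C)
    (hF : Tendsto (fun τ => ∫ x, |F τ x| * h x ∂μ) atTop (𝓝 0)) :
    Tendsto (fun τ => ∫ x, F τ x * f x ∂μ) atTop (𝓝 0) := by
  -- Split |f| ≤ k h + (|f| - k h)⁺. As h > 0, the second part has small integral for large k; the
  -- first is governed by the hypothesis on h.
  have htail : Tendsto (fun k : ℕ => ∫ x, max (|f x| - k * h x) 0 ∂μ) atTop (𝓝 (∫ _, (0 : ℝ) ∂μ)) := by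
    refine tendsto_integral_of_dominated_convergence (fun x => |f x|) (fun k => ?_) hf.abs
      (fun k => ?_) ?_
    · exact ((hf.abs.sub (hh.const_mul _)).sup (integrable_zero _ _ _)).aestronglyMeasurable
    · filter_upwards [hpos] with x hx
      rw [Real.norm_of_nonneg (le_max_right _ _)]
      refine max_le ?_ (abs_nonneg _)
      have : 0 ≤ (k : ℝ) * h x := by positivity
      linarith
    · filter_upwards [hpos] with x hx
      obtain ⟨N, hN⟩ := exists_nat_gt (|f x| / h x)
      rw [div_lt_iff₀ hx] at hN
      refine tendsto_const_nhds.congr' (eventually_atTop.2 ⟨N, fun k hk => ?_⟩)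
      have : (N : ℝ) * h x ≤ k * h x := mul_le_mul_of_nonneg_right (by exact_mod_cast hk) hx.le
      exact (max_eq_right (by linarith)).symm
  rw [integral_zero] at htail
  rw [Metric.tendsto_atTop]
  intro ε hε
  obtain ⟨k, hk⟩ := (htail.eventually_lt_const (show 0 < ε / (2 * (|C| + 1)) by positivity)).exists
  rw [lt_div_iff₀ (by positivity)] at hk
  obtain ⟨τ₀, hτ₀⟩ := eventually_atTop.1 (hC.and (hF.eventually_lt_const
    (show 0 < ε / (2 * (k + 1)) by positivity)))
  refine ⟨τ₀, fun τ hτ => ?_⟩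
  obtain ⟨hb, hs⟩ := hτ₀ τ hτ
  rw [lt_div_iff₀ (by positivity)] at hs
  rw [dist_zero_right]
  have hi1 : Integrable (fun x => max (|f x| - k * h x) 0) μ :=
    (hf.abs.sub (hh.const_mul _)).sup (integrable_zero _ _ _)
  have hi2 : Integrable (fun x => |F τ x| * h x) μ :=
    hh.bdd_mul (hFm τ).norm (c := C) (by
      filter_upwards [hb] with x hx
      rwa [Real.norm_eq_abs, abs_abs])
  have h1 : ‖∫ x, F τ x * f x ∂μ‖ ≤
      ∫ x, (|C| * max (|f x| - k * h x) 0 + k * (|F τ x| * h x)) ∂μ := by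
    refine norm_integral_le_of_norm_le ((hi1.const_mul _).add (hi2.const_mul _)) ?_
    filter_upwards [hb] with x hx
    rw [norm_mul, Real.norm_eq_abs, Real.norm_eq_abs]
    have h2 := le_max_left (|f x| - k * h x) 0
    have h3 := le_max_right (|f x| - k * h x) 0
    have h4 : |F τ x| * max (|f x| - k * h x) 0 ≤ |C| * max (|f x| - k * h x) 0 :=
      mul_le_mul_of_nonneg_right (hx.trans (le_abs_self C)) h3
    have h5 := mul_le_mul_of_nonneg_left h2 (abs_nonneg (F τ x))
    linarith
  rw [integral_add (hi1.const_mul _) (hi2.const_mul _), integral_const_mul,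
    integral_const_mul] at h1
  have h2 : 0 ≤ ∫ x, max (|f x| - k * h x) 0 ∂μ := integral_nonneg fun x => le_max_right _ _
  have h3 : 0 ≤ ∫ x, |F τ x| * h x ∂μ := by
    refine integral_nonneg_of_ae ?_
    filter_upwards [hpos] with x hx
    exact mul_nonneg (abs_nonneg _) hx.le
  nlinarith

theorem integral_withDensity_ofReal {h : X → ℝ} (hh : AEMeasurable h μ)
    (hpos : ∀ᵐ x ∂μ, 0 ≤ h x) (g : X → ℝ) :
    ∫ x, g x ∂(μ.withDensity fun x => ENNReal.ofReal (h x)) = ∫ x, g x * h x ∂μ := by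
  rw [integral_withDensity_eq_integral_toReal_smul₀ hh.ennreal_ofReal
    (Eventually.of_forall fun x => ENNReal.ofReal_lt_top)]
  refine integral_congr_ae ?_
  filter_upwards [hpos] with x hx
  rw [ENNReal.toReal_ofReal hx, smul_eq_mul, mul_comm]

end Weight

end LimitingModularSymbols

/-! ### Equidistribution of modular symbols -/

namespace LimitingModularSymbols

open UpperHalfPlane Matrix.ProjGenLinGroup

variable {G : Subgroup PGL(2, ℤ)} {B : Set ℝ} {E : Set (ℝ × Cosets G)}

/-- The point `x + i` of the upper half-plane. -/
def verticalPoint (x : ℝ) : ℍ := ⟨⟨x, 1⟩, one_pos⟩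

theorem measurable_verticalPoint : Measurable verticalPoint := by
  refine Continuous.measurable ?_
  rw [UpperHalfPlane.isEmbedding_coe.continuous_iff]
  have h : Continuous fun x : ℝ => ((x : ℂ) + Complex.I) := by fun_prop
  refine h.congr fun x => ?_
  apply Complex.ext <;> simp [verticalPoint]

theorem geodesicPoint_geodesicPoint (z : ℍ) (s r : ℝ) :
    geodesicPoint (geodesicPoint z s) r = geodesicPoint z (s + r) := by
  refine UpperHalfPlane.ext (Complex.ext rfl ?_)
  change z.im * Real.exp (-s) * Real.exp (-r) = z.im * Real.exp (-(s + r))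
  rw [neg_add, Real.exp_add, mul_assoc]

theorem geodesicPoint_verticalPoint (z : ℍ) :
    geodesicPoint (verticalPoint z.re) (-Real.log z.im) = z := by
  refine UpperHalfPlane.ext (Complex.ext rfl ?_)
  change 1 * Real.exp (- -Real.log z.im) = z.im
  rw [one_mul, neg_neg, Real.exp_log z.im_pos]

section Height

variable {ω : CuspForm (realGroup G) 2} {A : Cosets G → ℍ → ℝ} {φ : Cosets G → ℝ} {C : ℝ}

theorem IsHeight.measurable_modularSymbol [G.FiniteIndex] (hA : IsHeight ω A φ C)
    {x₀ : ℝ × Cosets G → ℍ} (hx₀ : Measurable x₀) (τ : ℝ) :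
    Measurable fun p => modularSymbol (x₀ p) τ p.2 ω := by
  simp only [hA.modularSymbol_eq]
  have h1 : Measurable fun q : ℍ × Cosets G => A q.2 (geodesicPoint q.1 τ) - A q.2 q.1 := by
    refine measurable_from_prod_countable_left fun t => ?_
    exact (((hA.continuous t).comp (continuous_geodesicPoint_left τ)).sub
      (hA.continuous t)).measurable
  exact h1.comp (hx₀.prodMk measurable_snd)

theorem IsHeight.abs_modularSymbol_le (hA : IsHeight ω A φ C) (z : ℍ) {τ : ℝ} (hτ : 0 ≤ τ)
    (t : Cosets G) : |modularSymbol z τ t ω| ≤ C * τ := by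
  rw [hA.modularSymbol_eq]
  refine (hA.abs_sub_le t z τ).trans_eq ?_
  rw [abs_of_nonneg hτ]

/-- Changing the base point to x + i moves both ends of the arc by hyperbolic distance |log Im z|,
whatever τ is. -/
theorem IsHeight.abs_modularSymbol_sub_le (hA : IsHeight ω A φ C) (z : ℍ) (τ : ℝ)
    (t : Cosets G) : |modularSymbol z τ t ω - modularSymbol (verticalPoint z.re) τ t ω| ≤
      2 * C * |Real.log z.im| := by
  have h1 := hA.abs_sub_le t (verticalPoint z.re) (-Real.log z.im)
  have h2 := hA.abs_sub_le t (geodesicPoint (verticalPoint z.re) τ) (-Real.log z.im)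
  rw [geodesicPoint_geodesicPoint, add_comm, ← geodesicPoint_geodesicPoint,
    geodesicPoint_verticalPoint] at h2
  rw [geodesicPoint_verticalPoint] at h1
  rw [abs_neg] at h1 h2
  rw [hA.modularSymbol_eq, hA.modularSymbol_eq]
  rw [_root_.abs_le] at h1 h2 ⊢
  constructor <;> linarith [h1.1, h1.2, h2.1, h2.2]

theorem IsHeight.nonneg (hA : IsHeight ω A φ C) : 0 ≤ C :=
  (abs_nonneg _).trans (hA.abs_le (Classical.arbitrary _) (verticalPoint 0)
    (by change (1 / 2 : ℝ) ≤ 1; norm_num))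

end Height

/-- The digits depend only on the real coordinate, so over each x the iterate permutes ℙ. -/
theorem exists_shift_iterate_eq (n : ℕ) (x : ℝ) : ∃ (y : ℝ) (g : PGL(2, ℤ)), ∀ t : Cosets G,
    (shift G)^[n] (x, t) = (y, g • t) := by
  induction n with
  | zero => exact ⟨x, 1, fun t => by rw [one_smul]; rfl⟩
  | succ n ih =>
    obtain ⟨y, g, h⟩ := ih
    refine ⟨1 / y - ⌊1 / y⌋, mk (shiftMatrix ⌊1 / y⌋) * g, fun t => ?_⟩
    rw [Function.iterate_succ_apply', h, shift, mul_smul]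

theorem sum_comp_shift_iterate [G.FiniteIndex] (φ : Cosets G → ℝ) (n : ℕ) (x : ℝ) :
    ∑ t, φ ((shift G)^[n] (x, t)).2 = ∑ t, φ t := by
  obtain ⟨y, g, h⟩ := exists_shift_iterate_eq (G := G) n x
  simp only [h]
  exact Equiv.sum_comp (MulAction.toPerm g) φ

theorem integral_comp_shift_iterate_eq_zero [G.FiniteIndex] (hBm : MeasurableSet B)
    (hE : E = B ×ˢ univ) {φ : Cosets G → ℝ} (hφ : ∑ t, φ t = 0) (n : ℕ)
    (hint : Integrable (fun p => φ ((shift G)^[n] p).2) (hausdorffOn E)) :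
    ∫ p, φ ((shift G)^[n] p).2 ∂(hausdorffOn E) = 0 := by
  rw [hausdorffOn_eq_sum hBm hE] at hint ⊢
  rw [integral_sum_measure hint, tsum_fintype]
  have h1 := fun t : Cosets G => hint.mono_measure (Measure.le_sum _ t)
  have h2 : ∀ t : Cosets G, ∫ p, φ ((shift G)^[n] p).2
      ∂(((μH[hausdorffDim E] : Measure ℝ).restrict B).map fun x => (x, t)) =
      ∫ x in B, φ ((shift G)^[n] (x, t)).2 ∂μH[hausdorffDim E] := fun t =>
    integral_map measurable_prodMk_right.aemeasurable (h1 t).aestronglyMeasurable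
  simp only [h2]
  have h3 : ∀ t : Cosets G, Integrable (fun x => φ ((shift G)^[n] (x, t)).2)
      ((μH[hausdorffDim E] : Measure ℝ).restrict B) := fun t =>
    (h1 t).comp_measurable measurable_prodMk_right
  rw [← integral_finsetSum _ fun t _ => h3 t]
  simp only [sum_comp_shift_iterate, hφ, integral_zero]

theorem measurePreserving_withDensity {X : Type*} [MeasurableSpace X] {μ : Measure X} {T : X → X}
    (hT : Measurable T) {h : X → ℝ} (hh : Integrable h μ) (hpos : ∀ᵐ x ∂μ, 0 ≤ h x)
    (hinv : ∀ ψ : X → ℝ, Measurable ψ → ∀ M, (∀ x, |ψ x| ≤ M) →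
      ∫ x, ψ (T x) * h x ∂μ = ∫ x, ψ x * h x ∂μ) :
    MeasurePreserving T (μ.withDensity fun x => ENNReal.ofReal (h x))
      (μ.withDensity fun x => ENNReal.ofReal (h x)) := by
  have hfin := isFiniteMeasure_withDensity_ofReal hh.2
  refine ⟨hT, Measure.ext fun S hS => ?_⟩
  rw [Measure.map_apply hT hS]
  rw [← ENNReal.toReal_eq_toReal_iff' (measure_ne_top _ _) (measure_ne_top _ _)]
  have h1 := hinv (S.indicator 1) (measurable_one.indicator hS) 1 fun x => by
    by_cases hx : x ∈ S <;> simp [hx]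
  rw [← integral_withDensity_ofReal hh.aemeasurable hpos,
    ← integral_withDensity_ofReal hh.aemeasurable hpos, integral_indicator_one hS] at h1
  rw [← Measure.real, ← Measure.real, ← h1, ← integral_indicator_one (hT hS)]
  rfl

theorem tendsto_integral_vertical_modularSymbol [G.FiniteIndex] (hB : B ⊆ Icc 0 1)
    (hBm : MeasurableSet B) (hE : E = B ×ˢ univ) (hT : ShiftInvariant E)
    (hfin : hausdorffOn E univ ≠ ∞) (hne : hausdorffOn E ≠ 0) {I : Set ℝ}
    (hδ : 2 * hausdorffDim E ∈ I) (hGST : HasGST E I) {f : ℝ × Cosets G → ℝ}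
    (hf : MemLp f 2 (hausdorffOn E)) {ω : CuspForm (realGroup G) 2} {A : Cosets G → ℍ → ℝ}
    {φ : Cosets G → ℝ} {C : ℝ} (hA : IsHeight ω A φ C) (hφ : ∑ t, φ t = 0) :
    Tendsto (fun τ : ℝ => ∫ p, (1 / τ * modularSymbol (verticalPoint p.1) τ p.2 ω) * f p
      ∂(hausdorffOn E)) atTop (𝓝 0) := by
  have : IsFiniteMeasure (hausdorffOn E) := ⟨hfin.lt_top⟩
  have hEm : MeasurableSet E := by rw [hE]; exact hBm.prod MeasurableSet.univ
  obtain ⟨hrat, h, hh2, hpos, hinv, hmix⟩ :=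
    exists_invariant_density hB hBm hE hT hfin hne hδ hGST
  have hh : Integrable h (hausdorffOn E) := hh2.integrable (by norm_num)
  have hpos' : ∀ᵐ p ∂(hausdorffOn E), 0 ≤ h p := hpos.mono fun p hp => hp.le
  set ψ : ℝ × Cosets G → ℝ := fun p => φ p.2
  have hψ : Measurable ψ := (Measurable.of_discrete (f := φ)).comp measurable_snd
  obtain ⟨M, hM⟩ : ∃ M, ∀ p : ℝ × Cosets G, |ψ p| ≤ M :=
    ⟨∑ t, |φ t|, fun p => Finset.single_le_sum (f := fun t => |φ t|) (fun _ _ => abs_nonneg _)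
      (Finset.mem_univ p.2)⟩
  -- h is not known to be constant along ℙ, so this mean is found by mixing: the integrals of φ ∘
  -- T^n over E vanish, and they converge to the mass of E times the mean.
  have hc : ∫ p, ψ p * h p ∂(hausdorffOn E) = 0 := by
    have h1 := hmix ψ hψ M hM (fun _ => 1) (memLp_const 1)
    have h2 : ∀ n : ℕ, ∫ p, ψ ((shift G)^[n] p) * 1 ∂(hausdorffOn E) = 0 := fun n => by
      simp only [mul_one]
      exact integral_comp_shift_iterate_eq_zero hBm hE hφ n
        (integrable_of_abs_le (hψ.comp (measurable_shift_iterate n)) fun p => hM _)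
    simp only [h2] at h1
    have h3 := tendsto_nhds_unique h1 tendsto_const_nhds
    rw [integral_const, smul_eq_mul, mul_one] at h3
    refine (mul_eq_zero.1 h3).resolve_left ?_
    rw [measureReal_eq_zero_iff hfin]
    exact Measure.measure_univ_ne_zero.2 hne
  set ν := (hausdorffOn E).withDensity fun p => ENNReal.ofReal (h p) with hν
  have hνfin : IsFiniteMeasure ν := isFiniteMeasure_withDensity_ofReal hh.2
  have hνint : ∀ g : ℝ × Cosets G → ℝ, ∫ p, g p ∂ν = ∫ p, g p * h p ∂(hausdorffOn E) :=
    integral_withDensity_ofReal hh.aemeasurable hpos'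
  have hpres : MeasurePreserving (shift G) ν ν :=
    measurePreserving_withDensity measurable_shift hh hpos' hinv
  have hdecay : Tendsto (fun n : ℕ => ∫ p, ψ ((shift G)^[n] p) * ψ p ∂ν) atTop (𝓝 0) := by
    have h1 := hmix ψ hψ M hM (fun p => ψ p * h p)
      (MemLp.of_le_mul (c := M) hh2 (hψ.aestronglyMeasurable.mul hh2.aestronglyMeasurable)
        (Eventually.of_forall fun p => by
          rw [norm_mul]
          exact mul_le_mul_of_nonneg_right (hM p) (norm_nonneg _)))
    rw [hc, mul_zero] at h1
    refine h1.congr fun n => ?_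
    rw [hνint]
    simp only [mul_assoc]
  have hz : Measurable fun p : ℝ × Cosets G => verticalPoint p.1 :=
    measurable_verticalPoint.comp measurable_fst
  have hms := fun τ : ℝ => hA.measurable_modularSymbol hz τ
  have hC0 := hA.nonneg
  refine tendsto_integral_mul_zero hh hpos (hf.integrable (by norm_num)) (C := C)
    (fun τ => ((hms τ).const_mul _).aestronglyMeasurable) ?_ ?_
  · refine (eventually_gt_atTop 0).mono fun τ hτ => Eventually.of_forall fun p => ?_
    rw [abs_mul, abs_of_pos (by positivity : 0 < 1 / τ), one_div_mul_eq_div, div_le_iff₀ hτ]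
    exact hA.abs_modularSymbol_le _ hτ.le _
  simp only [← hνint]
  have hgood : ∀ᵐ p ∂ν, Irrational p.1 ∧ p.1 ∈ Icc (0 : ℝ) 1 := by
    refine (withDensity_absolutelyContinuous _ _).ae_le ?_
    filter_upwards [hrat, ae_hausdorffOn_mem hEm] with p hp hpE
    rw [hE] at hpE
    exact ⟨hp, hB hpE.1⟩
  rw [Metric.tendsto_atTop]
  intro ε hε
  obtain ⟨N, hN⟩ := exists_birkhoffSum_le_integrable hpres hψ hM hdecay
    (ε := ε / 8) (by positivity)
  -- The two pointwise errors C then contribute less than ε τ / 2, and 2 τ + 2 ≤ 4 τ turns ε / 8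
  -- into another ε τ / 2.
  refine ⟨max (max N 1) (4 * C * ν.real univ / ε + 1), fun τ hτ => ?_⟩
  have hτN : (N : ℝ) ≤ τ := (le_max_left _ _).trans ((le_max_left _ _).trans hτ)
  have hτ1 : 1 ≤ τ := (le_max_right _ _).trans ((le_max_left _ _).trans hτ)
  have hτC : 4 * C * ν.real univ / ε < τ :=
    (lt_add_one _).trans_le ((le_max_right _ _).trans hτ)
  have hτ0 : 0 < τ := by linarith
  rw [div_lt_iff₀ hε] at hτC
  -- The number of shifts varies with the point, so one integrable bound for all Birkhoff sums up to
  -- this length is needed.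
  obtain ⟨g, hg, hgi, hgS⟩ := hN ⌊2 * τ + 2⌋₊ (Nat.le_floor (by linarith))
  have hn : (⌊2 * τ + 2⌋₊ : ℝ) ≤ 2 * τ + 2 := Nat.floor_le (by positivity)
  have h1 : ∫ p, |1 / τ * modularSymbol (verticalPoint p.1) τ p.2 ω| ∂ν ≤
      ∫ p, 1 / τ * (2 * C + g p) ∂ν := by
    refine integral_mono_of_nonneg (Eventually.of_forall fun p => abs_nonneg _)
      (((integrable_const _).add hg).const_mul _) ?_
    filter_upwards [hgood] with p hp
    rw [abs_mul, abs_of_pos (by positivity : 0 < 1 / τ)]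
    refine mul_le_mul_of_nonneg_left ?_ (by positivity)
    obtain ⟨k, hk, hAk⟩ := exists_abs_height_sub_sum_le hA hp.1 hp.2 (z := verticalPoint p.1) rfl
      rfl hτ0.le
    have h2 := hgS k (Nat.le_floor hk) p
    have h3 : |A p.2 (verticalPoint p.1)| ≤ C :=
      hA.abs_le _ _ (by change (1 / 2 : ℝ) ≤ 1; norm_num)
    rw [hA.modularSymbol_eq]
    change |A p.2 (geodesicPoint (verticalPoint p.1) τ) - birkhoffSum (shift G) ψ k p| ≤ C at hAk
    rw [abs_le] at h2 h3 hAk ⊢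
    constructor <;> linarith [h2.1, h2.2, h3.1, h3.2, hAk.1, hAk.2]
  rw [integral_const_mul, integral_add (integrable_const _) hg, integral_const, smul_eq_mul,
    one_div_mul_eq_div, le_div_iff₀ hτ0] at h1
  have h2 : 0 ≤ ∫ p, |1 / τ * modularSymbol (verticalPoint p.1) τ p.2 ω| ∂ν :=
    integral_nonneg fun p => abs_nonneg _
  rw [dist_zero_right, Real.norm_of_nonneg h2]
  refine lt_of_mul_lt_mul_right (h1.trans_lt ?_) hτ0.le
  have h3 : ε / 8 * (⌊2 * τ + 2⌋₊ : ℝ) ≤ ε / 8 * (4 * τ) :=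
    mul_le_mul_of_nonneg_left (by linarith) (by positivity)
  nlinarith

end LimitingModularSymbols

/-! ### The lemma for arbitrary base points and test functions -/

theorem lemma5p1 (G : Subgroup PGL(2, ℤ)) [G.FiniteIndex]
    (B : Set ℝ) (hB : B ⊆ Icc 0 1) (hBm : MeasurableSet B)
    (E : Set (ℝ × Cosets G)) (hE : E = B ×ˢ univ)
    (hT : ShiftInvariant E) (hfin : hausdorffOn E univ ≠ ∞)
    (I : Set ℝ) (hI : I.OrdConnected) (hδ : 2 * hausdorffDim E ∈ I)
    (hGST : HasGST.{v} E I)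
    (x₀ : ℝ × Cosets G → UpperHalfPlane) (hx₀m : Measurable x₀) (hx₀ : ∀ p, (x₀ p).re = p.1)
    (f : ℝ × Cosets G → ℝ) (hf : MemLp f 2 (hausdorffOn E))
    (ω : CuspForm (realGroup G) 2) :
    (∀ τ : ℝ, 0 ≤ τ →
      Integrable (fun p => modularSymbol (x₀ p) τ p.2 ω * f p) (hausdorffOn E)) ∧
    Tendsto
      (fun τ : ℝ => (1 / τ) * ∫ p, modularSymbol (x₀ p) τ p.2 ω * f p ∂(hausdorffOn E))
      atTop (𝓝 0) := by
  have : IsFiniteMeasure (hausdorffOn E) := ⟨hfin.lt_top⟩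
  obtain ⟨A, φ, C, hA, hφ⟩ := exists_isHeight ω
  have hfi : Integrable f (hausdorffOn E) := hf.integrable (by norm_num)
  have hint : ∀ {z : ℝ × Cosets G → UpperHalfPlane}, Measurable z → ∀ τ : ℝ, 0 ≤ τ →
      Integrable (fun p => modularSymbol (z p) τ p.2 ω * f p) (hausdorffOn E) := fun hz τ hτ =>
    hfi.bdd_mul (hA.measurable_modularSymbol hz τ).aestronglyMeasurable (c := C * τ)
      (Eventually.of_forall fun p => hA.abs_modularSymbol_le _ hτ _)
  refine ⟨hint hx₀m, ?_⟩
  by_cases hne : hausdorffOn E = 0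
  · simp only [hne, integral_zero_measure, mul_zero]
    exact tendsto_const_nhds
  have hv : Measurable fun p : ℝ × Cosets G => verticalPoint p.1 :=
    measurable_verticalPoint.comp measurable_fst
  have hC0 := hA.nonneg
  have h1 := tendsto_integral_vertical_modularSymbol hB hBm hE hT hfin hne hδ hGST hf hA hφ
  -- log Im x₀ may be unbounded, so the symbols from x₀ and x + i are compared only pointwise; 2 C
  -- |f| dominates because each symbol is at most C τ.
  have h2 : Tendsto (fun τ : ℝ => ∫ p, 1 / τ * (modularSymbol (x₀ p) τ p.2 ω -
      modularSymbol (verticalPoint p.1) τ p.2 ω) * f p ∂(hausdorffOn E)) atTop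
      (𝓝 (∫ _, (0 : ℝ) ∂(hausdorffOn E))) := by
    refine tendsto_integral_filter_of_dominated_convergence (fun p => 2 * C * |f p|) ?_ ?_
      (hfi.abs.const_mul _) (Eventually.of_forall fun p => ?_)
    · exact Eventually.of_forall fun τ => ((((hA.measurable_modularSymbol hx₀m τ).sub
        (hA.measurable_modularSymbol hv τ)).const_mul _).aestronglyMeasurable).mul
          hfi.aestronglyMeasurable
    · refine (eventually_gt_atTop 0).mono fun τ hτ => Eventually.of_forall fun p => ?_
      rw [norm_mul, Real.norm_eq_abs, Real.norm_eq_abs, abs_mul,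
        abs_of_pos (by positivity : 0 < 1 / τ)]
      refine mul_le_mul_of_nonneg_right ?_ (abs_nonneg _)
      rw [one_div_mul_eq_div, div_le_iff₀ hτ]
      refine (abs_sub _ _).trans ?_
      linarith [hA.abs_modularSymbol_le (x₀ p) hτ.le p.2,
        hA.abs_modularSymbol_le (verticalPoint p.1) hτ.le p.2]
    · rw [← zero_mul (f p)]
      refine Tendsto.mul_const _ ?_
      have h3 : Tendsto (fun τ : ℝ => τ⁻¹ * (2 * C * |Real.log (x₀ p).im|)) atTop (𝓝 0) := by
        simpa using tendsto_inv_atTop_zero.mul_const (2 * C * |Real.log (x₀ p).im|)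
      refine squeeze_zero_norm' ((eventually_gt_atTop 0).mono fun τ hτ => ?_) h3
      rw [norm_mul, Real.norm_eq_abs, Real.norm_eq_abs, one_div,
        abs_of_pos (by positivity : 0 < τ⁻¹)]
      refine mul_le_mul_of_nonneg_left ?_ (by positivity)
      rw [← hx₀ p]
      exact hA.abs_modularSymbol_sub_le _ _ _
  rw [integral_zero] at h2
  have h3 := h1.add h2
  rw [add_zero] at h3
  refine h3.congr' ((eventually_ge_atTop 0).mono fun τ hτ => ?_)
  have h4 := hint hx₀m τ hτ
  have h5 := hint hv τ hτ
  have e1 : ∀ p, 1 / τ * modularSymbol (verticalPoint p.1) τ p.2 ω * f p =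
      1 / τ * (modularSymbol (verticalPoint p.1) τ p.2 ω * f p) := fun p => mul_assoc _ _ _
  have e2 : ∀ p, 1 / τ * (modularSymbol (x₀ p) τ p.2 ω -
      modularSymbol (verticalPoint p.1) τ p.2 ω) * f p =
      1 / τ * (modularSymbol (x₀ p) τ p.2 ω * f p) -
        1 / τ * (modularSymbol (verticalPoint p.1) τ p.2 ω * f p) := fun p => by ring
  simp only [e1, e2]
  rw [integral_sub (h4.const_mul _) (h5.const_mul _), integral_const_mul, integral_const_mul]
  ring
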